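/- Let $\Lambda$ be an undirected graph (loops and multiple edges are allowed) with vertex set $V$ and let $\mu\colon V\to(0,\infty)$. Let $\vec\Lambda$ be the directed graph on $V$ with one edge $\epsilon$, $s(\epsilon)=t(\epsilon)=\alpha$, for each loop $\epsilon$ of $\Lambda$ at $\alpha$, and two edges $\epsilon',\epsilon''$ with $s(\epsilon')=t(\epsilon'')=\alpha$, $t(\epsilon')=s(\epsilon'')=\beta$ for each non-loop $\epsilon$ between $\alpha$ and $\beta$. Let $Y$ be the Cuntz–Krieger Hilbert bimodule of $\vec\Lambda$ over $C_0(V)$ (the completion of the finitely supported functions on the edges of $\vec\Lambda$, with $\langle\epsilon_1|\epsilon_2\rangle=\delta_{\epsilon_1,\epsilon_2}p_{t(\epsilon_1)}$ and $p_\alpha\,\epsilon\,p_\beta=\delta_{s(\epsilon),\alpha}\delta_{t(\epsilon),\beta}\,\epsilon$, where $p_\alpha$ is the indicator function of the vertex $\alpha$), let $\mathcal F=\bigoplus_{n\ge0}Y^{\otimes n}$ be its Fock space, a Hilbert $C_0(V)$-module with $Y^{\otimes 0}=C_0(V)$, and let $L_+(\epsilon)$ be the creation operators on $\mathcal F$.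 Identify $C_0(V)$ with its left action on $\mathcal F$. For an edge $\epsilon$ of $\Lambda$ put $T_\epsilon=L_+(\epsilon)+L_+(\epsilon)^*$ if $\epsilon$ is a loop, and otherwise $$T_\epsilon=aL_+(\epsilon')+a^{-1}L_+(\epsilon'')^*+a^{-1}L_+(\epsilon'')+aL_+(\epsilon')^*,\qquad a=\Big(\tfrac{\mu(s(\epsilon'))}{\mu(t(\epsilon'))}\Big)^{1/4}.$$ Let $\mathcal S_\epsilon$ be the C*-algebra of adjointable operators on $\mathcal F$ generated by $C_0(V)$ and $T_\epsilon$. Put $E(x)=\sum_{\alpha\in V}\langle p_\alpha|xp_\alpha\rangle$, let $\tau_\mu$ be the weight $\tau_\mu(f)=\sum_v\mu(v)f(v)$ on $C_0(V)$, and $\mathrm{Tr}_\mu=\tau_\mu\circ E$. Then, for every edge $\epsilon$ of $\Lambda$, the sum defining $E(x)$ converges in norm in $C_0(V)$ for all $x\in\mathcal S_\epsilon$, and $\mathrm{Tr}_\mu$ is a lower semicontinuous tracial weight on $\mathcal S_\epsilon$. It is finite (on every positive element of $\mathcal S_\epsilon$) if and only if $\sum_{v\in V}\mu(v)<\infty$.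 Moreover: 1. If $\epsilon$ is a loop at $\alpha$, then there is a *-isomorphism $\mathcal S_\epsilon\cong C[0,1]\oplus C_0(V\setminus\{\alpha\})$ that sends $f\in C_0(V)$ to $(f(\alpha)1,\ f|_{V\setminus\{\alpha\}})$. In particular the unit of $C[0,1]$ is $p_\alpha$; $\mathrm{Tr}_\mu(p_\alpha)=\mu(\alpha)$, and $\mathrm{Tr}_\mu(f)=\mu(\alpha)\int_0^1f(\lambda)\,d\lambda$ for $f\in p_\alpha\mathcal S_\epsilon p_\alpha$. 2. If $\epsilon$ has endpoints $\alpha\ne\beta$ with $\mu(\alpha)>\mu(\beta)$, then there are projections $q_\alpha,r_\alpha\in\mathcal S_\epsilon$ with $p_\alpha=q_\alpha+r_\alpha$ and a *-isomorphism $\mathcal S_\epsilon\cong(M_2(\mathbb C)\otimes C[0,1])\oplus\mathbb C\oplus C_0(V\setminus\{\alpha,\beta\})$ such that the unit of the first summand is $p_\beta+q_\alpha$, the unit of the second is $r_\alpha$, and the component of $f\in C_0(V)$ in the third is $f|_{V\setminus\{\alpha,\beta\}}$. Here $\mathrm{Tr}_\mu(p_\beta+q_\alpha)=2\mu(\beta)$,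 $\mathrm{Tr}_\mu(r_\alpha)=\mu(\alpha)-\mu(\beta)$, and on $(p_\beta+q_\alpha)\mathcal S_\epsilon(p_\beta+q_\alpha)$ we have $\mathrm{Tr}_\mu=\mu(\beta)\,\mathrm{Tr}_{M_2(\mathbb C)}\otimes\int_0^1(\cdot)\,d\lambda$. 3. If $\epsilon$ has endpoints $\alpha\ne\beta$ with $\mu(\alpha)=\mu(\beta)$, then, with $\mathcal D=\{f\colon[0,1]\to M_2(\mathbb C)\ \text{continuous},\ f(0)\text{ diagonal}\}$, there is a *-isomorphism $\mathcal S_\epsilon\cong\mathcal D\oplus C_0(V\setminus\{\alpha,\beta\})$ that sends $f\in C_0(V)$ to $(f(\alpha)e_{11}+f(\beta)e_{22},\ f|_{V\setminus\{\alpha,\beta\}})$. In particular $p_\alpha,p_\beta$ are the matrix units $e_{11},e_{22}$ and the unit of $\mathcal D$ is $p_\alpha+p_\beta$; $\mathrm{Tr}_\mu(p_\alpha+p_\beta)=2\mu(\alpha)$, and on $(p_\alpha+p_\beta)\mathcal S_\epsilon(p_\alpha+p_\beta)$ we have $\mathrm{Tr}_\mu=\mu(\alpha)\,\mathrm{Tr}_{M_2(\mathbb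 C)}\otimes\int_0^1(\cdot)\,d\lambda$. -/

import Mathlib

open Filter Topology MeasureTheory
open scoped ComplexOrder ENNReal NNReal ZeroAtInfty lp

noncomputable section

/-! ## Adjointable operators on a Hilbert C*-module -/

section Adjointable

set_option linter.unusedSectionVars false

variable (A E : Type*) [NonUnitalCStarAlgebra A] [PartialOrder A] [StarOrderedRing A]
  [NormedAddCommGroup E] [NormedSpace ℂ E] [SMul A E] [CStarModule A E]

/-- `𝓛(E)`: the algebra of bounded operators on the Hilbert `A`-module `E` that have an adjoint
for the `A`-valued inner product. Its norm is the operator norm. -/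
def adjointable : Subalgebra ℂ (E →L[ℂ] E) where
  carrier := {T | ∃ S : E →L[ℂ] E, ∀ x y, inner A (T x) y = inner A x (S y)}
  mul_mem' := by
    rintro T T' ⟨S, hS⟩ ⟨S', hS'⟩
    exact ⟨S' * S, fun x y => by simp [hS, hS']⟩
  add_mem' := by
    rintro T T' ⟨S, hS⟩ ⟨S', hS'⟩
    exact ⟨S + S', fun x y => by simp [hS, hS']⟩
  algebraMap_mem' := by
    intro c
    refine ⟨algebraMap ℂ _ (star c), fun x y => ?_⟩
    simp [Algebra.algebraMap_eq_smul_one]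

variable {A E}

variable (A E) in
/-- The algebra `𝓛(E)` as a type. -/
def AdjOp : Type _ := adjointable A E

instance adjOpNormedRing : NormedRing (AdjOp A E) :=
  inferInstanceAs (NormedRing (adjointable A E))

instance adjOpNormedAlgebra : NormedAlgebra ℂ (AdjOp A E) :=
  inferInstanceAs (NormedAlgebra ℂ (adjointable A E))

lemma cstar_inner_ext {x x' : E} (h : ∀ z : E, inner A z x = inner A z x') : x = x' := by
  have h1 : inner A (x - x') (x - x') = 0 := by
    rw [CStarModule.inner_sub_right, h, sub_self]
  exact sub_eq_zero.1 (CStarModule.inner_self.1 h1)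

lemma adjoint_unique {T S S' : E →L[ℂ] E}
    (h : ∀ x y, inner A (T x) y = inner A x (S y))
    (h' : ∀ x y, inner A (T x) y = inner A x (S' y)) : S = S' := by
  ext y
  exact cstar_inner_ext (A := A) fun z => by rw [← h, ← h']

lemma adjoint_swap {T S : E →L[ℂ] E} (h : ∀ x y, inner A (T x) y = inner A x (S y)) :
    ∀ x y, inner A (S x) y = inner A x (T y) := by
  intro x y
  rw [← CStarModule.star_inner y (S x), ← h, CStarModule.star_inner]

/-- The star operation on `𝓛(E)` is the adjoint. -/
instance adjOpStar : Star (AdjOp A E) where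
  star T := ⟨T.2.choose, T.1, adjoint_swap T.2.choose_spec⟩

lemma adjOp_inner (T : AdjOp A E) (x y : E) :
    inner A (T.1 x) y = inner A x ((star T).1 y) := T.2.choose_spec x y

lemma adjOp_star_eq {T S : AdjOp A E}
    (h : ∀ x y, inner A (T.1 x) y = inner A x (S.1 y)) : star T = S :=
  Subtype.ext (adjoint_unique (A := A) (adjOp_inner T) h)

instance adjOpStarRing : StarRing (AdjOp A E) where
  star_involutive T := adjOp_star_eq (adjoint_swap (adjOp_inner T))
  star_mul T S := adjOp_star_eq fun x y => by
    change inner A (T.1 (S.1 x)) y = inner A x ((star S).1 ((star T).1 y))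
    rw [adjOp_inner, adjOp_inner]
  star_add T S := adjOp_star_eq fun x y => by
    change inner A (T.1 x + S.1 x) y = inner A x ((star T).1 y + (star S).1 y)
    rw [CStarModule.inner_add_left, CStarModule.inner_add_right, adjOp_inner, adjOp_inner]

instance adjOpStarModule : StarModule ℂ (AdjOp A E) where
  star_smul c T := adjOp_star_eq fun x y => by
    change inner A (c • T.1 x) y = inner A x (star c • (star T).1 y)
    rw [CStarModule.inner_smul_left_complex, CStarModule.inner_smul_right_complex, adjOp_inner]

lemma adjOp_norm_star_le (T : AdjOp A E) : ‖star T‖ ≤ ‖T‖ := by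
  change ‖(star T).1‖ ≤ ‖T.1‖
  refine ContinuousLinearMap.opNorm_le_bound _ (norm_nonneg _) fun x => ?_
  have h1 : ‖(star T).1 x‖ ^ 2 ≤ ‖T.1‖ * ‖x‖ * ‖(star T).1 x‖ := by
    rw [CStarModule.norm_sq_eq A, ← adjOp_inner T]
    calc ‖inner A (T.1 ((star T).1 x)) x‖ ≤ ‖T.1 ((star T).1 x)‖ * ‖x‖ :=
          CStarModule.norm_inner_le E
      _ ≤ ‖T.1‖ * ‖(star T).1 x‖ * ‖x‖ := by gcongr; exact T.1.le_opNorm _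
      _ = _ := by ring
  by_contra! h2
  have h3 : 0 < ‖(star T).1 x‖ := lt_of_le_of_lt (by positivity) h2
  nlinarith

instance adjOpNormedStarGroup : NormedStarGroup (AdjOp A E) where
  norm_star_le T := adjOp_norm_star_le T

end Adjointable

/-! ## The order on `C₀(X)` -/

section ZeroAtInfty

variable {X : Type*} [TopologicalSpace X]

/-- The pointwise order on `C₀(X, ℂ)`. -/
instance czeroPartialOrder : PartialOrder C₀(X, ℂ) :=
  PartialOrder.lift (fun f : C₀(X, ℂ) => (f : X → ℂ)) DFunLike.coe_injective

lemma czero_le_def {f g : C₀(X, ℂ)} : f ≤ g ↔ ∀ x, f x ≤ g x := Iff.rfl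

instance czeroStarOrderedRing : StarOrderedRing C₀(X, ℂ) := by
  refine StarOrderedRing.of_le_iff fun f g => ⟨fun h => ?_, ?_⟩
  · let s : C₀(X, ℂ) :=
      { toFun := fun x => ((Real.sqrt (g x - f x).re : ℝ) : ℂ)
        continuous_toFun := by fun_prop
        zero_at_infty' := by
          have h1 : Tendsto (fun x => ((Real.sqrt (g x - f x).re : ℝ) : ℂ)) (cocompact X)
              (𝓝 ((Real.sqrt ((0 : ℂ) - 0).re : ℝ) : ℂ)) := by
            have h2 := (zero_at_infty g).sub (zero_at_infty f)
            exact ((Complex.continuous_ofReal.comp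
              (Real.continuous_sqrt.comp Complex.continuous_re)).tendsto _).comp h2
          simpa using h1 }
    refine ⟨s, ?_⟩
    ext x
    have h1 : 0 ≤ g x - f x := sub_nonneg.2 (h x)
    have h2 : (star s * s) x = g x - f x := by
      change star (((Real.sqrt (g x - f x).re : ℝ) : ℂ)) * ((Real.sqrt (g x - f x).re : ℝ) : ℂ) = _
      rw [Complex.star_def, Complex.conj_ofReal, ← Complex.ofReal_mul,
        Real.mul_self_sqrt (Complex.nonneg_iff.1 h1).1]
      exact Complex.ext rfl (Complex.nonneg_iff.1 h1).2
    rw [ZeroAtInftyContinuousMap.add_apply, h2]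
    ring
  · rintro ⟨s, rfl⟩ x
    change f x ≤ f x + star (s x) * s x
    exact le_add_of_nonneg_right (star_mul_self_nonneg _)

end ZeroAtInfty

/-! ## Two kinds of operators on `ℓ²` -/

namespace FreeGraph

section lpOps

variable {ι : Type*}

lemma pequiv_sum_le (σ : ι ≃. ι) (f : lp (fun _ : ι => ℂ) 2) (s : Finset ι) :
    ∑ i ∈ s, ‖(σ.symm i).elim 0 (fun j => f j)‖ ^ (2 : ℝ≥0∞).toReal
      ≤ ‖f‖ ^ (2 : ℝ≥0∞).toReal := by
  classical
  let t : Finset ι := s.filter fun i => (σ.symm i).isSome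
  let e : ι → ι := fun i => (σ.symm i).getD i
  have he : ∀ i ∈ t, σ.symm i = some (e i) := by
    intro i hi
    obtain ⟨j, hj⟩ := Option.isSome_iff_exists.1 (Finset.mem_filter.1 hi).2
    simp [e, hj]
  have hinj : Set.InjOn e t := by
    intro i hi j hj hij
    have h1 := he i hi
    have h2 := he j hj
    rw [← hij] at h2
    exact PEquiv.inj _ h1 h2
  calc ∑ i ∈ s, ‖(σ.symm i).elim 0 (fun j => f j)‖ ^ (2 : ℝ≥0∞).toReal
      = ∑ i ∈ t, ‖(σ.symm i).elim 0 (fun j => f j)‖ ^ (2 : ℝ≥0∞).toReal := by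
        refine (Finset.sum_filter_of_ne fun i _ hi => ?_).symm
        by_contra h
        rw [Option.not_isSome_iff_eq_none] at h
        simp [h] at hi
    _ = ∑ i ∈ t, ‖f (e i)‖ ^ (2 : ℝ≥0∞).toReal :=
        Finset.sum_congr rfl fun i hi => by rw [he i hi]; rfl
    _ = ∑ j ∈ t.image e, ‖f j‖ ^ (2 : ℝ≥0∞).toReal := 
        (Finset.sum_image (f := fun j => ‖f j‖ ^ (2 : ℝ≥0∞).toReal) hinj).symm
    _ ≤ _ := lp.sum_rpow_le_norm_rpow (by simp) f _

/-- The operator `δ_j ↦ δ_{σ(j)}` (and `δ_j ↦ 0` where `σ` is undefined) on `ℓ²(ι)`. -/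
def pequivOp (σ : ι ≃. ι) : lp (fun _ : ι => ℂ) 2 →L[ℂ] lp (fun _ : ι => ℂ) 2 :=
  LinearMap.mkContinuous
    { toFun := fun f => ⟨fun i => (σ.symm i).elim 0 (fun j => f j),
          memℓp_gen' (pequiv_sum_le σ f)⟩
      map_add' := fun f g => lp.ext <| funext fun i => by
        change (σ.symm i).elim 0 (fun j => (f + g) j) =
          (σ.symm i).elim 0 (fun j => f j) + (σ.symm i).elim 0 (fun j => g j)
        cases σ.symm i <;> simp
      map_smul' := fun c f => lp.ext <| funext fun i => by
        change (σ.symm i).elim 0 (fun j => (c • f) j) =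
          c • (σ.symm i).elim 0 (fun j => f j)
        cases σ.symm i <;> simp }
    1 (fun f => by
      rw [one_mul]
      exact lp.norm_le_of_forall_sum_le (by simp) (norm_nonneg _) (pequiv_sum_le σ f))

lemma norm_pequivOp_le (σ : ι ≃. ι) : ‖pequivOp σ‖ ≤ 1 :=
  LinearMap.mkContinuous_norm_le _ zero_le_one _

lemma mul_sum_le (c : ι → ℂ) (C : ℝ) (hc : ∀ i, ‖c i‖ ≤ C) (f : lp (fun _ : ι => ℂ) 2)
    (s : Finset ι) :
    ∑ i ∈ s, ‖c i * f i‖ ^ (2 : ℝ≥0∞).toReal ≤ (max C 0 * ‖f‖) ^ (2 : ℝ≥0∞).toReal := by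
  rw [Real.mul_rpow (by positivity) (norm_nonneg _)]
  calc ∑ i ∈ s, ‖c i * f i‖ ^ (2 : ℝ≥0∞).toReal
      ≤ ∑ i ∈ s, max C 0 ^ (2 : ℝ≥0∞).toReal * ‖f i‖ ^ (2 : ℝ≥0∞).toReal := by
        refine Finset.sum_le_sum fun i _ => ?_
        rw [norm_mul, Real.mul_rpow (norm_nonneg _) (norm_nonneg _)]
        gcongr
        exact (hc i).trans (le_max_left _ _)
    _ = max C 0 ^ (2 : ℝ≥0∞).toReal * ∑ i ∈ s, ‖f i‖ ^ (2 : ℝ≥0∞).toReal :=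
        (Finset.mul_sum _ _ _).symm
    _ ≤ _ := by
        gcongr
        exact lp.sum_rpow_le_norm_rpow (by simp) f _

/-- Multiplication by a bounded function on `ℓ²(ι)`. -/
def mulOp (c : ι → ℂ) (C : ℝ) (hc : ∀ i, ‖c i‖ ≤ C) :
    lp (fun _ : ι => ℂ) 2 →L[ℂ] lp (fun _ : ι => ℂ) 2 :=
  LinearMap.mkContinuous
    { toFun := fun f => ⟨fun i => c i * f i, memℓp_gen' (mul_sum_le c C hc f)⟩
      map_add' := fun f g => lp.ext <| funext fun i => mul_add (c i) (f i) (g i)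
      map_smul' := fun a f => lp.ext <| funext fun i => mul_left_comm (c i) a (f i) }
    (max C 0) (fun f => lp.norm_le_of_forall_sum_le (by simp) (by positivity)
      (mul_sum_le c C hc f))

lemma norm_mulOp_le (c : ι → ℂ) (C : ℝ) (hC : 0 ≤ C) (hc : ∀ i, ‖c i‖ ≤ C) :
    ‖mulOp c C hc‖ ≤ C :=
  (LinearMap.mkContinuous_norm_le _ (by positivity) _).trans_eq (max_eq_left hC)

end lpOps

end FreeGraph

/-! ## The directed graph, its paths, and the Fock space -/

namespace FreeGraph

variable {V E : Type*}

/-- The edges of the directed graph `Λ⃗` of an undirected (multi)graph `Λ`: a loop `ε` at `α` gives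
the single edge `(ε, α, α)`; a non-loop `ε` between `α` and `β` gives the two edges `(ε, α, β)` and
`(ε, β, α)`. -/
structure DirEdge (Λ : Graph V E) where
  edge : E
  src : Λ.vertexSet
  tgt : Λ.vertexSet
  isLink : Λ.IsLink edge src tgt

/-- The involution on the edges of `Λ⃗`; it fixes a loop and exchanges the two directed edges of a
non-loop. -/
def DirEdge.op {Λ : Graph V E} (d : DirEdge Λ) : DirEdge Λ := ⟨d.edge, d.tgt, d.src, d.isLink.symm⟩

variable (Λ : Graph V E)

/-- The source of the word `ε₁ ⋯ εₙ` seen as a path with target `v` (it is `v` if `n = 0`). -/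
def startVertex (v : Λ.vertexSet) : List (DirEdge Λ) → Λ.vertexSet
  | [] => v
  | d :: _ => d.src

/-- The word `ε₁ ⋯ εₙ` is a directed path with target `v`: `t(εᵢ) = s(εᵢ₊₁)` and `t(εₙ) = v`. -/
def IsPathTo (v : Λ.vertexSet) : List (DirEdge Λ) → Prop
  | [] => True
  | d :: l => d.tgt = startVertex Λ v l ∧ IsPathTo v l

/-- The directed paths of `Λ⃗` of any length `n ≥ 0` with target `v`. The path of length `0` stands
for `p_v ∈ C₀(V)`, the path `ε₁ ⋯ εₙ` for the nonzero elementary tensor `ε₁ ⊗ ⋯ ⊗ εₙ`. -/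
def PathTo (v : Λ.vertexSet) : Type _ := {l : List (DirEdge Λ) // IsPathTo Λ v l}

variable {Λ}

/-- The source of a path. -/
def PathTo.start {v : Λ.vertexSet} (w : PathTo Λ v) : Λ.vertexSet := startVertex Λ v w.1

/-- The path of length `0` at `v`. -/
def PathTo.nil (v : Λ.vertexSet) : PathTo Λ v := ⟨[], trivial⟩

open Classical in
/-- The partial injection `w ↦ d w` on paths with target `v`, defined when `t(d) = s(w)`. -/
def prepend (d : DirEdge Λ) (v : Λ.vertexSet) : PathTo Λ v ≃. PathTo Λ v where
  toFun w := if h : d.tgt = w.start then some ⟨d :: w.1, h, w.2⟩ else none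
  invFun
    | ⟨[], _⟩ => none
    | ⟨d' :: l, h⟩ => if d' = d then some ⟨l, h.2⟩ else none
  inv := by
    rintro ⟨w, hw⟩ ⟨_ | ⟨d', l⟩, h⟩
    · simp only [reduceCtorEq, false_iff]
      split_ifs with h1
      · intro h2
        have h3 : d :: w = [] := congrArg Subtype.val (Option.some.inj h2)
        simp at h3
      · simp
    · constructor
      · intro h1
        have hd : d' = d := by
          by_contra hd
          simp [hd] at h1
        subst hd
        have h1' : (some ⟨l, h.2⟩ : Option (PathTo Λ v)) = some ⟨w, hw⟩ := by simpa using h1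
        have h3 : l = w := congrArg Subtype.val (Option.some.inj h1')
        subst h3
        have h4 : d'.tgt = PathTo.start ⟨l, hw⟩ := h.1
        simp [h4]
      · intro h1
        by_cases h2 : d.tgt = PathTo.start ⟨w, hw⟩
        · have h1' : (some ⟨d :: w, h2, hw⟩ : Option (PathTo Λ v)) = some ⟨d' :: l, h⟩ := by
            simpa [h2] using h1
          have h3 : d :: w = d' :: l := congrArg Subtype.val (Option.some.inj h1')
          obtain ⟨rfl, rfl⟩ := List.cons.inj h3
          simp
        · simp [h2] at h1

/-- `ℓ²` of the set of paths with target `v`. -/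
abbrev PathSpace (v : Λ.vertexSet) : Type _ := lp (fun _ : PathTo Λ v => ℂ) 2

variable (Λ)

/-- The Pimsner-Fock space `𝓕(Y(Λ⃗))`, that is, the completion of the finitely supported functions
on the set of all paths under the `C₀(V)`-valued inner product `⟨δ_w, δ_w'⟩ = δ_{w = w'} p_{t(w)}`.
It consists of the functions `f` on paths such that
`v ↦ ∑_{t(w) = v} |f(w)|²` is finite and vanishes at infinity; `f v` is the restriction of `f` to
the paths with target `v`. (On the paths of length `1` this is the Cuntz-Krieger bimodule.) -/
def Fock : Submodule ℂ (lp (fun v : Λ.vertexSet => PathSpace v) ∞) where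
  carrier := {f | Tendsto (fun v => ‖f v‖) cofinite (𝓝 0)}
  zero_mem' := by simpa using tendsto_const_nhds
  add_mem' := by
    intro f g hf hg
    refine squeeze_zero (fun v => norm_nonneg _) (fun v => norm_add_le (f v) (g v)) ?_
    simpa using Tendsto.add hf hg
  smul_mem' := by
    intro c f hf
    have h : Tendsto (fun v => ‖c‖ * ‖f v‖) cofinite (𝓝 (‖c‖ * 0)) :=
      Tendsto.const_mul _ hf
    simpa [norm_smul] using h

variable {Λ}

variable [TopologicalSpace V] [DiscreteTopology V]

/-- A function on the vertices that vanishes at infinity, as an element of `C₀(V(Λ))`. -/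
def mkCZero (c : Λ.vertexSet → ℂ) (h : Tendsto c cofinite (𝓝 0)) : C₀(Λ.vertexSet, ℂ) where
  toFun := c
  continuous_toFun := continuous_of_discreteTopology
  zero_at_infty' := by rwa [cocompact_eq_cofinite]

@[simp] lemma mkCZero_apply (c : Λ.vertexSet → ℂ) (h : Tendsto c cofinite (𝓝 0))
    (v : Λ.vertexSet) : mkCZero c h v = c v := rfl

lemma tendsto_czero (c : C₀(Λ.vertexSet, ℂ)) : Tendsto (fun v => ‖c v‖) cofinite (𝓝 0) := by
  have h := (zero_at_infty c).norm
  rw [cocompact_eq_cofinite] at h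
  simpa using h

lemma czero_norm_apply_le {X : Type*} [TopologicalSpace X] (c : C₀(X, ℂ)) (x : X) :
    ‖c x‖ ≤ ‖c‖ := by
  rw [← ZeroAtInftyContinuousMap.norm_toBCF_eq_norm]
  exact c.toBCF.norm_coe_le_norm x

/-- The right action of `C₀(V)` on the Fock space, `(f · c)(w) = f(w) c(t(w))`. -/
instance fockSMul : SMul C₀(Λ.vertexSet, ℂ) (Fock Λ) where
  smul c f := ⟨⟨fun v => c v • f.1 v, by
      refine memℓp_infty ⟨‖c‖ * ‖f.1‖, ?_⟩
      rintro _ ⟨v, rfl⟩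
      simp only [norm_smul]
      exact mul_le_mul (czero_norm_apply_le c v) (lp.norm_apply_le_norm (by simp) _ _)
        (norm_nonneg _) (norm_nonneg _)⟩, by
      have h := (tendsto_czero c).mul f.2
      rw [mul_zero] at h
      refine h.congr fun v => ?_
      exact (norm_smul (c v) (f.1 v)).symm⟩

lemma fock_smul_apply (c : C₀(Λ.vertexSet, ℂ)) (f : Fock Λ) (v : Λ.vertexSet) :
    (c • f).1 v = c v • f.1 v := rfl

/-- The `C₀(V)`-valued inner product `⟨f|g⟩(v) = ∑_{t(w) = v} conj (f(w)) g(w)` makes the Fock space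
a Hilbert `C₀(V)`-module. -/
instance fockModule : CStarModule C₀(Λ.vertexSet, ℂ) (Fock Λ) where
  inner f g := mkCZero (fun v => inner ℂ (f.1 v) (g.1 v)) <| by
    refine squeeze_zero_norm (fun v => norm_inner_le_norm _ _) ?_
    simpa using Tendsto.mul f.2 g.2
  inner_add_right := by intros; ext v; simp
  inner_self_nonneg := by
    intro f v
    change 0 ≤ inner ℂ (f.1 v) (f.1 v)
    rw [inner_self_eq_norm_sq_to_K]
    simp
  inner_self := by
    intro f
    constructor
    · intro h
      refine Subtype.ext (lp.ext (funext fun v => ?_))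
      have h1 := DFunLike.congr_fun h v
      exact inner_self_eq_zero.1 h1
    · rintro rfl
      ext v
      exact inner_self_eq_zero (𝕜 := ℂ) (x := (0 : PathSpace v)).2 rfl
  inner_op_smul_right := by
    intro c f g; ext v
    simp [fock_smul_apply]
  inner_smul_right_complex := by intros; ext v; simp
  star_inner f g := by ext v; exact inner_conj_symm (𝕜 := ℂ) (g.1 v) (f.1 v)
  norm_eq_sqrt_norm_inner_self f := by
    refine le_antisymm ?_ ?_
    · refine lp.norm_le_of_forall_le (Real.sqrt_nonneg _) fun v => Real.le_sqrt_of_sq_le ?_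
      refine le_trans (le_of_eq ?_) (czero_norm_apply_le _ v)
      rw [mkCZero_apply, inner_self_eq_norm_sq_to_K]
      simp
    · refine Real.sqrt_le_iff.2 ⟨norm_nonneg _, ?_⟩
      rw [← ZeroAtInftyContinuousMap.norm_toBCF_eq_norm]
      refine (BoundedContinuousFunction.norm_le (by positivity)).2 fun v => ?_
      change ‖inner ℂ (f.1 v) (f.1 v)‖ ≤ ‖f.1‖ ^ 2
      rw [inner_self_eq_norm_sq_to_K]
      simp only [norm_pow, Complex.coe_algebraMap, Complex.norm_real, norm_norm]
      gcongr
      exact lp.norm_apply_le_norm (by simp) _ _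

lemma fock_inner_apply (f g : Fock Λ) (v : Λ.vertexSet) :
    inner C₀(Λ.vertexSet, ℂ) f g v = inner ℂ (f.1 v) (g.1 v) := rfl

variable (Λ) in
/-- The C*-algebra `𝓛(𝓕(Y(Λ⃗)))` of adjointable operators on the Fock space. -/
abbrev FockOp : Type _ := AdjOp C₀(Λ.vertexSet, ℂ) (Fock Λ)

/-- The operator on the Fock space given by a bounded family of operators on the spaces
`ℓ²{w | t(w) = v}`. -/
def fiberCLM (x : ∀ v : Λ.vertexSet, PathSpace v →L[ℂ] PathSpace v) (C : ℝ)
    (hx : ∀ v, ‖x v‖ ≤ C) : Fock Λ →L[ℂ] Fock Λ :=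
  LinearMap.mkContinuous
    { toFun := fun f => ⟨⟨fun v => x v (f.1 v), by
          refine memℓp_infty ⟨C * ‖f.1‖, ?_⟩
          rintro _ ⟨v, rfl⟩
          exact (x v).le_of_opNorm_le_of_le (hx v) (lp.norm_apply_le_norm (by simp) _ _)⟩, by
          refine squeeze_zero (fun v => norm_nonneg _)
            (fun v => (x v).le_of_opNorm_le (hx v) (f.1 v)) ?_
          simpa using Tendsto.const_mul C f.2⟩
      map_add' := fun f g => Subtype.ext (lp.ext (funext fun v => map_add (x v) (f.1 v) (g.1 v)))
      map_smul' := fun c f => Subtype.ext (lp.ext (funext fun v => map_smul (x v) c (f.1 v))) }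
    (max C 0) (fun f => by
      refine lp.norm_le_of_forall_le (by positivity) fun v => ?_
      exact (x v).le_of_opNorm_le_of_le ((hx v).trans (le_max_left _ _))
        (lp.norm_apply_le_norm (by simp) f.1 v))

lemma fiberCLM_apply (x : ∀ v : Λ.vertexSet, PathSpace v →L[ℂ] PathSpace v) (C : ℝ)
    (hx : ∀ v, ‖x v‖ ≤ C) (f : Fock Λ) (v : Λ.vertexSet) :
    (fiberCLM x C hx f).1 v = x v (f.1 v) := rfl

/-- The same operator as an element of `𝓛(𝓕(Y(Λ⃗)))`. -/
def fiberOp (x : ∀ v : Λ.vertexSet, PathSpace v →L[ℂ] PathSpace v) (C : ℝ)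
    (hx : ∀ v, ‖x v‖ ≤ C) : FockOp Λ :=
  ⟨fiberCLM x C hx, fiberCLM (fun v => ContinuousLinearMap.adjoint (x v)) C
      (fun v => (LinearIsometryEquiv.norm_map _ _).trans_le (hx v)), fun f g => by
    ext v
    rw [fock_inner_apply, fock_inner_apply, fiberCLM_apply, fiberCLM_apply,
      ContinuousLinearMap.adjoint_inner_right]⟩

/-- The left action of `C₀(V)` on the Fock space, `(c · f)(w) = c(s(w)) f(w)`. -/
def leftAct (c : C₀(Λ.vertexSet, ℂ)) : FockOp Λ :=
  fiberOp (fun v => mulOp (fun w : PathTo Λ v => c w.start) ‖c‖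
    fun w => czero_norm_apply_le c w.start) ‖c‖ fun _ => norm_mulOp_le _ _ (norm_nonneg _) _

/-- The creation operator `L₊(d)`, which sends a path `w` to `d w` if `t(d) = s(w)` and to `0`
otherwise. -/
def create (d : DirEdge Λ) : FockOp Λ :=
  fiberOp (fun v => pequivOp (prepend d v)) 1 fun v => norm_pequivOp_le (prepend d v)

open Classical in
/-- The projection `p_α ∈ C₀(V)`, the indicator function of the vertex `α`. -/
def vertexProj (α : Λ.vertexSet) : C₀(Λ.vertexSet, ℂ) :=
  mkCZero (Pi.single α 1) <| by
    refine tendsto_nhds_of_eventually_eq ?_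
    filter_upwards [(Set.finite_singleton α).compl_mem_cofinite] with v hv
    exact Pi.single_eq_of_ne hv 1

open Classical in
/-- `p_α` as a vector of the summand `C₀(V)` of the Fock space. -/
def vacuum (α : Λ.vertexSet) : Fock Λ :=
  ⟨lp.single ∞ α (lp.single 2 (PathTo.nil α) 1), by
    refine tendsto_nhds_of_eventually_eq ?_
    filter_upwards [(Set.finite_singleton α).compl_mem_cofinite] with v hv
    rw [lp.single_apply_ne _ _ _ hv, norm_zero]⟩

/-! ## The algebras `𝓢_ε`, the expectation and the weight -/

/-- `√[4](μ(s(d)) / μ(t(d)))`. -/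
def ratio (μ : Λ.vertexSet → ℝ) (d : DirEdge Λ) : ℝ := (μ d.src / μ d.tgt) ^ (1 / 4 : ℝ)

open Classical in
/-- The self-adjoint operator `T_ε` of an undirected edge `ε`, where `ε' = d` is either of the
directed edges over `ε` (the choice does not matter). -/
def edgeOp (μ : Λ.vertexSet → ℝ) (d : DirEdge Λ) : FockOp Λ :=
  if d.src = d.tgt then create d + star (create d)
  else
    (ratio μ d : ℂ) • create d + ((ratio μ d)⁻¹ : ℂ) • star (create d.op)
      + ((ratio μ d)⁻¹ : ℂ) • create d.op + (ratio μ d : ℂ) • star (create d)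

/-- The C*-algebra `𝓢_ε` generated by `C₀(V)` and `T_ε`, with `d` one of the directed edges over
`ε`. -/
def edgeAlg (μ : Λ.vertexSet → ℝ) (d : DirEdge Λ) : NonUnitalStarSubalgebra ℂ (FockOp Λ) :=
  (NonUnitalStarAlgebra.adjoin ℂ (Set.range leftAct ∪ {edgeOp μ d})).topologicalClosure

/-- The inclusion of `C₀(V)` in `𝓢_ε`. -/
def incl (μ : Λ.vertexSet → ℝ) (d : DirEdge Λ) (c : C₀(Λ.vertexSet, ℂ)) : edgeAlg μ d :=
  ⟨leftAct c, NonUnitalStarSubalgebra.le_topologicalClosure _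
    (NonUnitalStarAlgebra.subset_adjoin ℂ _ (Or.inl ⟨c, rfl⟩))⟩

/-- `E(x) = ∑_α ⟨p_α | x p_α⟩`. -/
def condExp (x : FockOp Λ) : C₀(Λ.vertexSet, ℂ) :=
  ∑' α, inner C₀(Λ.vertexSet, ℂ) (vacuum α) (x.1 (vacuum α))

/-- The weight `τ_μ` on the positive elements of `C₀(V)`: `τ_μ(c) = ∑_v μ(v) c(v) ∈ [0, ∞]`. -/
def tauWeight (μ : Λ.vertexSet → ℝ) (c : C₀(Λ.vertexSet, ℂ)) : ℝ≥0∞ :=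
  ∑' v, ENNReal.ofReal (μ v) * ENNReal.ofReal (c v).re

/-- `Tr_μ = τ_μ ∘ E` on positive elements, with values in `[0, ∞]`. -/
def Tr (μ : Λ.vertexSet → ℝ) (x : FockOp Λ) : ℝ≥0∞ := tauWeight μ (condExp x)

/-- `Tr_μ(x) = z` for the linear extension of `Tr_μ` to not necessarily positive elements: the sum
`∑_v μ(v) E(x)(v)` converges absolutely to `z`. -/
def HasTr (μ : Λ.vertexSet → ℝ) (x : FockOp Λ) (z : ℂ) : Prop :=
  HasSum (fun v => (μ v : ℂ) * condExp x v) z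

/-- The positive elements `z* z` of a C*-algebra. -/
def IsPos {A : Type*} [Mul A] [Star A] (x : A) : Prop := ∃ z : A, x = star z * z

/-- `φ`, regarded on the positive cone of the C*-algebra `A` only, is a lower semicontinuous tracial
weight. -/
structure IsLscTracialWeight {A : Type*} [NonUnitalRing A] [StarRing A] [Module ℂ A]
    [TopologicalSpace A] (φ : A → ℝ≥0∞) : Prop where
  add : ∀ x y, IsPos x → IsPos y → φ (x + y) = φ x + φ y
  smul : ∀ (c : ℝ≥0) (x), IsPos x → φ (((c : ℝ) : ℂ) • x) = c * φ x
  lsc : LowerSemicontinuousOn φ {x | IsPos x}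
  tracial : ∀ z, φ (star z * z) = φ (z * star z)

/-- The algebra `𝓓` of continuous `f : [0, 1] → M₂(ℂ)` such that `f(0)` is diagonal. -/
def diagAtZero : StarSubalgebra ℂ C(unitInterval, Matrix (Fin 2) (Fin 2) ℂ) where
  carrier := {f | (f 0).IsDiag}
  mul_mem' := by
    intro f g hf hg
    change ((f 0) * (g 0)).IsDiag
    rw [← hf.diagonal_diag, ← hg.diagonal_diag, Matrix.diagonal_mul_diagonal]
    exact Matrix.isDiag_diagonal _
  add_mem' := fun hf hg => Matrix.IsDiag.add hf hg
  algebraMap_mem' := fun c => by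
    change (algebraMap ℂ (Matrix (Fin 2) (Fin 2) ℂ) c).IsDiag
    rw [Matrix.algebraMap_eq_diagonal]
    exact Matrix.isDiag_diagonal _
  star_mem' := fun hf => Matrix.IsDiag.conjTranspose hf

end FreeGraph

end

noncomputable section

/-! ## `𝓛(E)` is a C*-algebra -/

section AdjointableComplete

variable {A E : Type*} [NonUnitalCStarAlgebra A] [PartialOrder A] [StarOrderedRing A]
  [NormedAddCommGroup E] [NormedSpace ℂ E] [SMul A E] [CStarModule A E]

/-! The Fock space splits into the fibres `ℓ²{w | t(w) = v}`, and `⟨p_v | x p_v⟩` is the scalar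
`vacState v x` times `p_v`. At a vertex that is not an endpoint of `ε` this state sees only the
`C₀(V)` part of an element of `𝓢_ε`, so the theorem rests on the law of `T = T_ε` in the vacuum
states of the endpoints.

For a loop the vectors `L₊(ε)ⁿ p_α` form a chain on which `T` is the free Jacobi matrix `s + s*`,
and the law is the semicircle. For a non-loop let `V`, `W` be the two creation operators and `X = aV
+ a⁻¹W*`, so that `T = X + X*` is off-diagonal for `p_α`, `p_β`. On the words `(WV)ⁿ p_β` the
operator `T² - (a² + a⁻²)` is `s + s* - a⁻² e₀e₀*`; at the other endpoint the perturbation is `a²`.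
Orient `ε` so that `a ≥ 1` and put `b = a⁻²`. The law for `b` has a density (`jacobi_law`); the law
for `b⁻¹` is `b²` times the same density plus an atom of mass `1 - b²`, which sits at `T = 0`
(`jacobi_law_inv`). Since `b² = μ(β)/μ(α)`, the weights `μ(α)`, `μ(β)` give the two continuous parts
equal mass. This is the trace property, and the atom carries the remaining `μ(α) - μ(β)`.

For the algebra, sums of squares confine the spectrum of `T` to a set `gapSet` symmetric about `0`,
with `0` isolated if `a > 1` (`EdgeRel.spectrum_comb`). Conjugation by `1 - 2p` reverses the sign of
`T`, so even functions of `T` commute with `p_α`, `p_β` and odd ones exchange them. Hence 2×2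
matrices with even diagonal and odd off-diagonal functions are represented by operators
(`Grading.gradedHom`). Parametrizing `|T|` by the distribution function of the law turns the law
into Lebesgue measure on `[0, 1]`. If `a > 1` the sign of `T` is a continuous function and all of
`M₂ ⊗ C[0, 1]` is represented, next to the null projection of `T` at `α`; if `a = 1` the
off-diagonal entries must vanish at `0`, which gives `𝓓`.

Each model is injective because the vacuum states restrict to integrals that are faithful on
continuous functions. An injective *-homomorphism of C*-algebras has closed range, and the range
lies in `𝓢_ε` and contains its generators, so it is `𝓢_ε` (`exists_equiv_of_model`). The statements
on the weight are then read off from the models through `TracialData`. -/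

lemma adjOp_norm_mul_self_le (T : AdjOp A E) : ‖T‖ * ‖T‖ ≤ ‖star T * T‖ := by
  rw [← sq]
  have h : ‖T‖ ≤ Real.sqrt ‖star T * T‖ := by
    change ‖T.1‖ ≤ _
    refine ContinuousLinearMap.opNorm_le_bound _ (Real.sqrt_nonneg _) fun x => ?_
    rw [← Real.sqrt_sq (norm_nonneg x), ← Real.sqrt_mul (norm_nonneg _)]
    refine Real.le_sqrt_of_sq_le ?_
    rw [CStarModule.norm_sq_eq A, adjOp_inner]
    calc ‖inner A x ((star T).1 (T.1 x))‖ ≤ ‖x‖ * ‖(star T).1 (T.1 x)‖ :=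
          CStarModule.norm_inner_le E
      _ ≤ ‖x‖ * (‖star T * T‖ * ‖x‖) := by
          gcongr
          exact (star T * T).1.le_opNorm x
      _ = _ := by ring
  calc ‖T‖ ^ 2 ≤ Real.sqrt ‖star T * T‖ ^ 2 := by gcongr
    _ = _ := Real.sq_sqrt (norm_nonneg _)

instance adjOpCStarRing : CStarRing (AdjOp A E) where
  norm_mul_self_le := adjOp_norm_mul_self_le

/-- The star is isometric, so the adjoints of a Cauchy sequence are Cauchy too, and the adjunction
identity passes to the limit by continuity of the inner product. -/
instance adjOpCompleteSpace [CompleteSpace E] : CompleteSpace (AdjOp A E) := by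
  have hiso : Isometry (fun T : AdjOp A E => (T.1 : E →L[ℂ] E)) := fun _ _ => rfl
  refine Metric.complete_of_cauchySeq_tendsto fun u hu => ?_
  have h1 : CauchySeq fun n => (u n).1 := hiso.uniformContinuous.comp_cauchySeq hu
  have h2 : CauchySeq fun n => (star (u n)).1 :=
    (hiso.comp (starₗᵢ ℂ : AdjOp A E ≃ₗᵢ⋆[ℂ] AdjOp A E).isometry).uniformContinuous.comp_cauchySeq hu
  obtain ⟨T, hT⟩ := cauchySeq_tendsto_of_complete h1
  obtain ⟨S, hS⟩ := cauchySeq_tendsto_of_complete h2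
  have hTS : ∀ x y, inner A (T x) y = inner A x (S y) := by
    intro x y
    have hT' : Tendsto (fun n => (u n).1 x) atTop (𝓝 (T x)) :=
      ((ContinuousLinearMap.apply ℂ E x).continuous.tendsto T).comp hT
    have hS' : Tendsto (fun n => (star (u n)).1 y) atTop (𝓝 (S y)) :=
      ((ContinuousLinearMap.apply ℂ E y).continuous.tendsto S).comp hS
    have h3 : Tendsto (fun n => inner A ((u n).1 x) y) atTop (𝓝 (inner A (T x) y)) :=
      ((CStarModule.continuous_inner (A := A) (E := E)).tendsto (T x, y)).comp
        (hT'.prodMk_nhds tendsto_const_nhds)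
    have h4 : Tendsto (fun n => inner A x ((star (u n)).1 y)) atTop (𝓝 (inner A x (S y))) :=
      ((CStarModule.continuous_inner (A := A) (E := E)).tendsto (x, S y)).comp
        (tendsto_const_nhds.prodMk_nhds hS')
    refine tendsto_nhds_unique h3 (h4.congr fun n => ?_)
    rw [adjOp_inner]
  refine ⟨⟨T, S, hTS⟩, ?_⟩
  exact hiso.isEmbedding.tendsto_nhds_iff.2 hT

instance adjOpCStarAlgebra [CompleteSpace E] : CStarAlgebra (AdjOp A E) where

end AdjointableComplete

/-! ### Completeness of the Fock space. -/

namespace FreeGraph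

variable {V E : Type*} {Λ : Graph V E}

/-- Vanishing at infinity survives uniform limits, so the Fock space is closed in the `ℓ^∞` sum of
the fibres. -/
instance fockCompleteSpace : CompleteSpace (Fock Λ) := by
  refine IsClosed.completeSpace_coe (hs := ?_)
  refine isClosed_of_closure_subset fun f hf => ?_
  change Tendsto (fun v => ‖f v‖) cofinite (𝓝 0)
  rw [Metric.tendsto_nhds]
  intro ε hε
  obtain ⟨g, hg, hfg⟩ := Metric.mem_closure_iff.1 hf (ε / 2) (half_pos hε)
  have hg' : Tendsto (fun v => ‖g v‖) cofinite (𝓝 0) := hg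
  filter_upwards [(Metric.tendsto_nhds.1 hg') (ε / 2) (half_pos hε)] with v hv
  simp only [dist_zero_right, norm_norm] at hv ⊢
  calc ‖f v‖ = ‖(f - g) v + g v‖ := by simp
    _ ≤ ‖(f - g) v‖ + ‖g v‖ := norm_add_le _ _
    _ ≤ ‖f - g‖ + ‖g v‖ := by gcongr; exact lp.norm_apply_le_norm (by simp) _ _
    _ < ε / 2 + ε / 2 := by rw [← dist_eq_norm]; gcongr
    _ = ε := by ring

end FreeGraph

end

noncomputable section

/-! ## Creation operators and the left action -/

namespace FreeGraph

section Relations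

variable {V E : Type*} {Λ : Graph V E}

/-- The value of an element of the Fock space at a path with target `v`. -/
def coord (v : Λ.vertexSet) (w : PathTo Λ v) : Fock Λ →ₗ[ℂ] ℂ where
  toFun f := f.1 v w
  map_add' _ _ := rfl
  map_smul' _ _ := rfl

lemma fock_ext {f g : Fock Λ} (h : ∀ v w, coord v w f = coord v w g) : f = g :=
  Subtype.ext (lp.ext (funext fun v => lp.ext (funext fun w => h v w)))

/-- The path `d w`. -/
def PathTo.cons {v : Λ.vertexSet} (d : DirEdge Λ) (w : PathTo Λ v) (h : d.tgt = w.start) :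
    PathTo Λ v := ⟨d :: w.1, h, w.2⟩

lemma PathTo.eq_nil_or_cons {v : Λ.vertexSet} (w : PathTo Λ v) :
    w = PathTo.nil v ∨ ∃ d w' h, w = PathTo.cons d w' h := by
  obtain ⟨_ | ⟨d, l⟩, h⟩ := w
  · exact Or.inl rfl
  · exact Or.inr ⟨d, ⟨l, h.2⟩, h.1, rfl⟩

open Classical in
lemma pequivOp_single {ι : Type*} (σ : ι ≃. ι) (i : ι) (a : ℂ) :
    pequivOp σ (lp.single 2 i a) = (σ i).elim 0 (fun j => lp.single 2 j a) := by
  refine lp.ext (funext fun k => ?_)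
  change (σ.symm k).elim 0 (fun j => (lp.single 2 i a : lp (fun _ : ι => ℂ) 2) j) = _
  have hk : ∀ j, σ.symm k = some j ↔ σ j = some k := fun j => by
    have := σ.eq_some_iff (a := j) (b := k)
    tauto
  rcases h1 : σ i with _ | j <;> rcases h2 : σ.symm k with _ | l
  · simp
  · have hl : l ≠ i := by rintro rfl; rw [hk, h1] at h2; simp at h2
    simp [Pi.single_eq_of_ne hl]
  · have hj : k ≠ j := by rintro rfl; rw [(hk i).2 h1] at h2; simp at h2
    simp [Pi.single_eq_of_ne hj]
  · by_cases hjk : k = j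
    · subst hjk
      have hl : i = l := Option.some.inj (((hk i).2 h1).symm.trans h2)
      simp [hl]
    · have hl : l ≠ i := by
        rintro rfl; rw [hk, h1] at h2; exact hjk (Option.some.inj h2).symm
      simp [Pi.single_eq_of_ne hl, Pi.single_eq_of_ne hjk]

/-- The coordinate of the adjoint at `i` is tested against the basis vector `δ_i`, which the
operator sends to `δ_{σ(i)}` or to `0`. -/
lemma adjoint_pequivOp {ι : Type*} (σ : ι ≃. ι) :
    ContinuousLinearMap.adjoint (pequivOp σ) = pequivOp σ.symm := by
  classical
  ext f i
  have h1 : inner ℂ (lp.single 2 i (1 : ℂ)) (ContinuousLinearMap.adjoint (pequivOp σ) f) =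
      ContinuousLinearMap.adjoint (pequivOp σ) f i := by
    rw [lp.inner_single_left]; simp
  rw [← h1, ContinuousLinearMap.adjoint_inner_right, pequivOp_single]
  change _ = (σ i).elim 0 (fun j => f j)
  rcases σ i with _ | j
  · simp
  · simp [lp.inner_single_left]

open Classical in
lemma vacuum_fiber (α : Λ.vertexSet) :
    (vacuum α : Fock Λ).1 α = lp.single 2 (PathTo.nil α) (1 : ℂ) :=
  lp.single_apply_self _ _ _

open Classical in
lemma vacuum_fiber_of_ne {α v : Λ.vertexSet} (h : v ≠ α) : (vacuum α : Fock Λ).1 v = 0 :=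
  lp.single_apply_ne _ _ _ h

lemma coord_cons_vacuum (α v : Λ.vertexSet) (d : DirEdge Λ) (w : PathTo Λ v)
    (h : d.tgt = w.start) : coord v (PathTo.cons d w h) (vacuum α) = 0 := by
  classical
  change (vacuum α : Fock Λ).1 v _ = 0
  by_cases hv : v = α
  · subst hv
    rw [vacuum_fiber]
    refine lp.single_apply_ne (E := fun _ : PathTo Λ v => ℂ) _ _ _ fun h3 => ?_
    exact List.cons_ne_nil _ _ (congrArg Subtype.val h3)
  · rw [vacuum_fiber_of_ne hv]; rfl

lemma coord_nil_vacuum (v : Λ.vertexSet) : coord v (PathTo.nil v) (vacuum v) = 1 := by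
  classical
  change (vacuum v : Fock Λ).1 v _ = 1
  rw [vacuum_fiber]
  exact lp.single_apply_self (E := fun _ : PathTo Λ v => ℂ) _ _ _

variable [TopologicalSpace V] [DiscreteTopology V]

lemma fockOp_ext {x y : FockOp Λ} (h : ∀ f v w, coord v w (x.1 f) = coord v w (y.1 f)) :
    x = y :=
  Subtype.ext (ContinuousLinearMap.ext fun f => fock_ext (h f))

lemma fockOp_mul_apply (x y : FockOp Λ) (f : Fock Λ) : (x * y).1 f = x.1 (y.1 f) := rfl

lemma fockOp_add_apply (x y : FockOp Λ) (f : Fock Λ) : (x + y).1 f = x.1 f + y.1 f := rfl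

lemma fockOp_sub_apply (x y : FockOp Λ) (f : Fock Λ) : (x - y).1 f = x.1 f - y.1 f := rfl

lemma fockOp_smul_apply (a : ℂ) (x : FockOp Λ) (f : Fock Λ) : (a • x).1 f = a • x.1 f := rfl

lemma fockOp_one_apply (f : Fock Λ) : (1 : FockOp Λ).1 f = f := rfl

lemma coord_leftAct (c : C₀(Λ.vertexSet, ℂ)) (f : Fock Λ) (v : Λ.vertexSet) (w : PathTo Λ v) :
    coord v w ((leftAct c).1 f) = c w.start * coord v w f := rfl

lemma coord_nil_create (d : DirEdge Λ) (f : Fock Λ) (v : Λ.vertexSet) :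
    coord v (PathTo.nil v) ((create d).1 f) = 0 := rfl

open Classical in
lemma coord_cons_create (d d' : DirEdge Λ) (f : Fock Λ) (v : Λ.vertexSet) (w : PathTo Λ v)
    (h : d'.tgt = w.start) :
    coord v (PathTo.cons d' w h) ((create d).1 f) = if d' = d then coord v w f else 0 := by
  change Option.elim (if d' = d then some w else none) 0 (fun j => f.1 v j) = _
  split_ifs <;> rfl

open Classical in
lemma coord_star_create (d : DirEdge Λ) (f : Fock Λ) (v : Λ.vertexSet) (w : PathTo Λ v) :
    coord v w ((star (create d)).1 f) =
      if h : d.tgt = w.start then coord v (PathTo.cons d w h) f else 0 := by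
  -- The star is defined by choice, so it is identified through uniqueness of adjoints: on each
  -- fibre it is the operator of the inverse partial injection.
  have h1 : star (create d) = fiberOp (fun v => pequivOp (prepend d v).symm) 1
      (fun v => norm_pequivOp_le _) := by
    refine adjOp_star_eq fun f g => ?_
    ext v
    rw [fock_inner_apply, fock_inner_apply]
    change inner ℂ (pequivOp (prepend d v) (f.1 v)) (g.1 v) =
      inner ℂ (f.1 v) (pequivOp (prepend d v).symm (g.1 v))
    rw [← adjoint_pequivOp, ContinuousLinearMap.adjoint_inner_right]
  rw [h1]
  change Option.elim (if h : d.tgt = w.start then some (PathTo.cons d w h) else none)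
    0 (fun j => f.1 v j) = _
  split_ifs <;> rfl

open Classical in
lemma vertexProj_apply (α v : Λ.vertexSet) :
    (vertexProj α : C₀(Λ.vertexSet, ℂ)) v = if v = α then 1 else 0 := by
  change Pi.single (M := fun _ : Λ.vertexSet => ℂ) α (1 : ℂ) v = _
  rw [Pi.single_apply]

variable (Λ) in
/-- The left action of `C₀(V)` on the Fock space, as a *-homomorphism. -/
def leftHom : C₀(Λ.vertexSet, ℂ) →⋆ₙₐ[ℂ] FockOp Λ where
  toFun := leftAct
  map_smul' c f := fockOp_ext fun g v w => by
    change (c * f w.start) * g.1 v w = c * (f w.start * g.1 v w)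
    ring
  map_zero' := fockOp_ext fun g v w => zero_mul _
  map_add' f f' := fockOp_ext fun g v w => add_mul _ _ _
  map_mul' f f' := fockOp_ext fun g v w => mul_assoc _ _ _
  map_star' f := by
    refine (adjOp_star_eq fun g g' => ?_).symm
    ext v
    rw [fock_inner_apply, fock_inner_apply, lp.inner_eq_tsum, lp.inner_eq_tsum]
    refine tsum_congr fun w => ?_
    change g'.1 v w * star (f w.start * g.1 v w) = (star (f w.start) * g'.1 v w) * star (g.1 v w)
    rw [star_mul]
    ring

lemma leftHom_apply (c : C₀(Λ.vertexSet, ℂ)) : leftHom Λ c = leftAct c := rfl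

/-- The projection `p_α` as an operator on the Fock space. -/
abbrev vproj (α : Λ.vertexSet) : FockOp Λ := leftHom Λ (vertexProj α)

open Classical in
lemma coord_vproj (α : Λ.vertexSet) (f : Fock Λ) (v : Λ.vertexSet) (w : PathTo Λ v) :
    coord v w ((vproj α).1 f) = if w.start = α then coord v w f else 0 := by
  change vertexProj α w.start * coord v w f = _
  rw [vertexProj_apply]
  split_ifs <;> simp

lemma czero_mul_vertexProj (c : C₀(Λ.vertexSet, ℂ)) (α : Λ.vertexSet) :
    c * vertexProj α = c α • vertexProj α := by
  ext v
  change c v * vertexProj α v = c α * vertexProj α v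
  rw [vertexProj_apply]
  split_ifs with h <;> simp [h]

lemma leftHom_mul_vproj (c : C₀(Λ.vertexSet, ℂ)) (α : Λ.vertexSet) :
    leftHom Λ c * vproj α = c α • vproj α := by
  rw [← map_mul, czero_mul_vertexProj, map_smul]

lemma vproj_mul_leftHom (c : C₀(Λ.vertexSet, ℂ)) (α : Λ.vertexSet) :
    vproj α * leftHom Λ c = c α • vproj α := by
  rw [← map_mul, mul_comm, czero_mul_vertexProj, map_smul]

lemma vproj_mul_self (α : Λ.vertexSet) : vproj α * vproj α = vproj α := by
  rw [leftHom_mul_vproj, vertexProj_apply]; simp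

lemma vproj_mul_vproj_of_ne {α β : Λ.vertexSet} (h : α ≠ β) : vproj α * vproj β = 0 := by
  rw [leftHom_mul_vproj, vertexProj_apply]; simp [h.symm]

lemma star_vproj (α : Λ.vertexSet) : star (vproj α) = vproj α := by
  rw [← map_star]
  congr 1
  ext v
  change star (vertexProj α v) = vertexProj α v
  rw [vertexProj_apply]
  split_ifs <;> simp

lemma isStarProjection_vproj (α : Λ.vertexSet) : IsStarProjection (vproj α) :=
  ⟨vproj_mul_self α, star_vproj α⟩

/-- Prepending `d` and deleting it again restores exactly the paths that start at `d.tgt` and kills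
the others. -/
lemma star_create_mul_create (d : DirEdge Λ) : star (create d) * create d = vproj d.tgt := by
  classical
  refine fockOp_ext fun f v w => ?_
  rw [coord_vproj, fockOp_mul_apply, coord_star_create]
  by_cases h : d.tgt = w.start
  · rw [dif_pos h, if_pos h.symm, coord_cons_create, if_pos rfl]
  · rw [dif_neg h, if_neg (Ne.symm h)]

lemma create_mul_vproj (d : DirEdge Λ) : create d * vproj d.tgt = create d := by
  classical
  refine fockOp_ext fun f v w => ?_
  rw [fockOp_mul_apply]
  obtain rfl | ⟨d', w', h, rfl⟩ := w.eq_nil_or_cons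
  · rfl
  · rw [coord_cons_create, coord_cons_create]
    split_ifs with hd
    · subst hd
      rw [coord_vproj, if_pos h.symm]
    · rfl

lemma vproj_mul_create (d : DirEdge Λ) : vproj d.src * create d = create d := by
  classical
  refine fockOp_ext fun f v w => ?_
  rw [fockOp_mul_apply, coord_vproj]
  obtain rfl | ⟨d', w', h, rfl⟩ := w.eq_nil_or_cons
  · rw [coord_nil_create, ite_self]
  · rw [coord_cons_create]
    by_cases hd : d' = d
    · subst hd
      exact if_pos rfl
    · rw [if_neg hd, ite_self]

/-- The vacuum has no component on paths of positive length. This is the origin of the rank-one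
perturbation in the Jacobi matrices below. -/
lemma star_create_vacuum (d : DirEdge Λ) (α : Λ.vertexSet) :
    (star (create d)).1 (vacuum α) = 0 := by
  classical
  refine fock_ext fun v w => ?_
  rw [coord_star_create]
  split_ifs
  · rw [coord_cons_vacuum, map_zero]
  · rfl

lemma leftHom_vacuum (c : C₀(Λ.vertexSet, ℂ)) (α : Λ.vertexSet) :
    (leftHom Λ c).1 (vacuum α) = c α • vacuum α := by
  refine fock_ext fun v w => ?_
  rw [leftHom_apply, coord_leftAct, map_smul, smul_eq_mul]
  obtain rfl | ⟨d', w', h, rfl⟩ := w.eq_nil_or_cons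
  · by_cases hv : v = α
    · subst hv; rfl
    · have : coord v (PathTo.nil v) (vacuum α) = 0 := by
        change (vacuum α : Fock Λ).1 v _ = 0
        rw [vacuum_fiber_of_ne hv]; rfl
      rw [this, mul_zero, mul_zero]
  · rw [coord_cons_vacuum, mul_zero, mul_zero]

/-- The vector state of `p_v`. -/
def vacState (v : Λ.vertexSet) : FockOp Λ →L[ℂ] ℂ :=
  LinearMap.mkContinuous
    { toFun := fun x => coord v (PathTo.nil v) (x.1 (vacuum v))
      map_add' := fun _ _ => rfl
      map_smul' := fun _ _ => rfl } ‖(vacuum v : Fock Λ)‖ fun x => by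
    calc ‖(x.1 (vacuum v)).1 v (PathTo.nil v)‖ ≤ ‖(x.1 (vacuum v)).1 v‖ :=
          lp.norm_apply_le_norm (by simp) _ _
      _ ≤ ‖(x.1 (vacuum v)).1‖ := lp.norm_apply_le_norm (by simp) _ _
      _ ≤ ‖x‖ * ‖(vacuum v : Fock Λ)‖ := x.1.le_opNorm _
      _ = _ := mul_comm _ _

lemma vacState_apply (v : Λ.vertexSet) (x : FockOp Λ) :
    vacState v x = coord v (PathTo.nil v) (x.1 (vacuum v)) := rfl

lemma vacState_eq_inner (v : Λ.vertexSet) (x : FockOp Λ) :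
    vacState v x = inner C₀(Λ.vertexSet, ℂ) (vacuum v) (x.1 (vacuum v)) v := by
  classical
  rw [fock_inner_apply, vacuum_fiber, lp.inner_single_left]
  simp only [RCLike.inner_apply, map_one, mul_one]
  rfl

/-- The vacuum at `v` lives in the fibre over `v` only, so the inner product is supported at `v`.
The expectation `E(x)` is thus the function `v ↦ vacState v x` once that function vanishes at
infinity. -/
lemma inner_vacuum (v : Λ.vertexSet) (x : FockOp Λ) :
    inner C₀(Λ.vertexSet, ℂ) (vacuum v) (x.1 (vacuum v)) = vacState v x • vertexProj v := by
  classical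
  ext u
  change _ = vacState v x * vertexProj v u
  rw [vertexProj_apply]
  split_ifs with h
  · subst h; rw [mul_one, vacState_eq_inner]
  · rw [fock_inner_apply, mul_zero, vacuum_fiber_of_ne h, inner_zero_left]

lemma vacState_mul_leftHom (v : Λ.vertexSet) (x : FockOp Λ) (c : C₀(Λ.vertexSet, ℂ)) :
    vacState v (x * leftHom Λ c) = c v * vacState v x := by
  rw [vacState_apply, fockOp_mul_apply, leftHom_vacuum, map_smul]
  rfl

lemma vacState_leftHom_mul (v : Λ.vertexSet) (x : FockOp Λ) (c : C₀(Λ.vertexSet, ℂ)) :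
    vacState v (leftHom Λ c * x) = c v * vacState v x := rfl

lemma vacState_one (v : Λ.vertexSet) : vacState v (1 : FockOp Λ) = 1 := by
  rw [vacState_apply, fockOp_one_apply, coord_nil_vacuum]

lemma vacState_leftHom (v : Λ.vertexSet) (c : C₀(Λ.vertexSet, ℂ)) :
    vacState v (leftHom Λ c) = c v := by
  rw [← mul_one (leftHom Λ c), vacState_leftHom_mul, vacState_one, mul_one]

lemma vacState_star_mul_self_nonneg (v : Λ.vertexSet) (x : FockOp Λ) :
    0 ≤ vacState v (star x * x) := by
  rw [vacState_eq_inner, fockOp_mul_apply, ← adjOp_inner]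
  exact CStarModule.inner_self_nonneg (A := C₀(Λ.vertexSet, ℂ)) (x := x.1 (vacuum v)) v

end Relations

end FreeGraph

end

noncomputable section

/-! ## The spectral measure of the perturbed free Jacobi matrix -/

namespace FreeGraph

open Polynomial in
/-- The orthogonal polynomials of the Jacobi matrix `s + s* - c e₀e₀*`. -/
def jacobiPoly (c : ℂ) : ℕ → ℂ[X]
  | 0 => 1
  | 1 => X + C c
  | n + 2 => X * jacobiPoly c (n + 1) - jacobiPoly c n

open Polynomial in
-- The polynomials satisfy the three-term recursion of the chain `e`, solved for the next vector, so
-- both sides grow in the same way from `e 0`.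
lemma jacobiPoly_aeval {M : Type*} [AddCommGroup M] [Module ℂ M] (c : ℂ) (Y : M →ₗ[ℂ] M)
    (e : ℕ → M) (h0 : Y (e 0) = e 1 - c • e 0) (h : ∀ n, Y (e (n + 1)) = e (n + 2) + e n) :
    ∀ n, aeval Y (jacobiPoly c n) (e 0) = e n
  | 0 => by simp [jacobiPoly]
  | 1 => by simp [jacobiPoly, h0]
  | n + 2 => by
      have h1 := jacobiPoly_aeval c Y e h0 h (n + 1)
      have h2 := jacobiPoly_aeval c Y e h0 h n
      simp [jacobiPoly, h1, h2, h]

open Polynomial in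
-- This lets a functional on polynomials be identified by its values on the orthogonal polynomials.
-- The recursion shows that their span is stable under multiplication by `X`, and it contains `1`.
lemma span_jacobiPoly (c : ℂ) : Submodule.span ℂ (Set.range (jacobiPoly c)) = ⊤ := by
  set S := Submodule.span ℂ (Set.range (jacobiPoly c))
  have hm : ∀ n, jacobiPoly c n ∈ S := fun n => Submodule.subset_span ⟨n, rfl⟩
  have hX : ∀ p ∈ S, X * p ∈ S := by
    intro p hp
    refine Submodule.span_induction (p := fun p _ => X * p ∈ S) ?_ (by simp) ?_ ?_ hp
    · rintro _ ⟨n, rfl⟩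
      rcases n with _ | n
      · have : X * jacobiPoly c 0 = jacobiPoly c 1 - c • jacobiPoly c 0 := by
          simp [jacobiPoly, smul_eq_C_mul]
        rw [this]
        exact S.sub_mem (hm 1) (S.smul_mem _ (hm 0))
      · have : X * jacobiPoly c (n + 1) = jacobiPoly c (n + 2) + jacobiPoly c n := by
          simp [jacobiPoly]
        rw [this]
        exact S.add_mem (hm _) (hm _)
    · intro p q _ _ hp hq
      rw [mul_add]; exact S.add_mem hp hq
    · intro a p _ hp
      rw [mul_smul_comm]; exact S.smul_mem _ hp
  rw [eq_top_iff]
  rintro p -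
  induction p using Polynomial.induction_on' with
  | add p q hp hq => exact S.add_mem hp hq
  | monomial n a =>
    rw [← smul_X_eq_monomial]
    refine S.smul_mem _ ?_
    induction n with
    | zero => simpa [jacobiPoly] using hm 0
    | succ n ih => rw [pow_succ']; exact hX _ ih

/-- The density on `[0, π]` of the spectral measure of `s + s* - b e₀e₀*` at `e₀` in the variable
`φ`, where the spectral parameter is `-2 cos φ`. -/
def jacobiDensity (b φ : ℝ) : ℝ :=
  2 / Real.pi * (Real.sin φ ^ 2 / (1 - 2 * b * Real.cos φ + b ^ 2))

section Density

variable {b : ℝ}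

/-- The difference of the two sides is `(b - cos φ)²`. This one bound keeps the density below `2/π`
even at `b = 1`, where the denominator vanishes at `φ = 0`. -/
lemma sin_sq_le_denom (b φ : ℝ) : Real.sin φ ^ 2 ≤ 1 - 2 * b * Real.cos φ + b ^ 2 := by
  have := Real.sin_sq_add_cos_sq φ
  nlinarith [sq_nonneg (b - Real.cos φ)]

lemma jacobiDensity_nonneg (b φ : ℝ) : 0 ≤ jacobiDensity b φ := by
  have := (sq_nonneg (Real.sin φ)).trans (sin_sq_le_denom b φ)
  unfold jacobiDensity
  positivity

lemma jacobiDensity_le (b φ : ℝ) : jacobiDensity b φ ≤ 2 / Real.pi := by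
  unfold jacobiDensity
  refine mul_le_of_le_one_right (by positivity) ?_
  exact div_le_one_of_le₀ (sin_sq_le_denom b φ)
    ((sq_nonneg (Real.sin φ)).trans (sin_sq_le_denom b φ))

lemma denom_mul_jacobiDensity (b φ : ℝ) :
    (1 - 2 * b * Real.cos φ + b ^ 2) * jacobiDensity b φ = 2 / Real.pi * Real.sin φ ^ 2 := by
  unfold jacobiDensity
  -- Where the denominator vanishes so does the sine, hence the default value of division by zero is
  -- the right one.
  by_cases h : 1 - 2 * b * Real.cos φ + b ^ 2 = 0
  · have h1 := sin_sq_le_denom b φ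
    rw [h] at h1
    have : Real.sin φ ^ 2 = 0 := le_antisymm h1 (sq_nonneg _)
    rw [h, this]; simp
  · field_simp

lemma measurable_jacobiDensity (b : ℝ) : Measurable (jacobiDensity b) := by
  unfold jacobiDensity
  fun_prop

lemma jacobiDensity_pos {φ : ℝ} (h : φ ∈ Set.Ioo 0 Real.pi) : 0 < jacobiDensity b φ := by
  have h1 : 0 < Real.sin φ := Real.sin_pos_of_mem_Ioo h
  have h2 := (pow_pos h1 2).trans_le (sin_sq_le_denom b φ)
  have := Real.pi_pos
  unfold jacobiDensity
  positivity

lemma continuousAt_jacobiDensity {φ : ℝ} (h : φ ∈ Set.Ioo 0 Real.pi) :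
    ContinuousAt (jacobiDensity b) φ := by
  have h1 : 0 < Real.sin φ := Real.sin_pos_of_mem_Ioo h
  have h2 := (pow_pos h1 2).trans_le (sin_sq_le_denom b φ)
  unfold jacobiDensity
  refine ContinuousAt.mul continuousAt_const (ContinuousAt.div (by fun_prop) (by fun_prop) h2.ne')

lemma intervalIntegrable_jacobiDensity (b x y : ℝ) :
    IntervalIntegrable (jacobiDensity b) volume x y := by
  refine (intervalIntegrable_const (c := 2 / Real.pi)).mono_fun
    (measurable_jacobiDensity b).aestronglyMeasurable (ae_of_all _ fun φ => ?_)
  beta_reduce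
  rw [Real.norm_of_nonneg (jacobiDensity_nonneg b φ), Real.norm_of_nonneg (by positivity)]
  exact jacobiDensity_le b φ

lemma intervalIntegrable_smul_jacobiDensity {F : Type*} [NormedAddCommGroup F] [NormedSpace ℝ F]
    (b : ℝ) {f : ℝ → F} (hf : Continuous f) (x y : ℝ) :
    IntervalIntegrable (fun φ => jacobiDensity b φ • f φ) volume x y :=
  (intervalIntegrable_jacobiDensity b x y).smul_continuousOn hf.continuousOn

/-- The moments of the density with respect to the Chebyshev polynomials. -/
def jacobiMoment (b : ℝ) (n : ℤ) : ℝ :=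
  ∫ φ in 0..Real.pi, (Polynomial.Chebyshev.U ℝ n).eval (Real.cos φ) * jacobiDensity b φ

lemma continuous_eval_cos (p : Polynomial ℝ) : Continuous fun φ => p.eval (Real.cos φ) :=
  p.continuous.comp Real.continuous_cos

lemma intervalIntegrable_eval_cos_mul (b : ℝ) (p : Polynomial ℝ) (x y : ℝ) :
    IntervalIntegrable (fun φ => p.eval (Real.cos φ) * jacobiDensity b φ) volume x y := by
  simpa [mul_comm] using intervalIntegrable_smul_jacobiDensity b (continuous_eval_cos p) x y

lemma integral_cos_int_mul (n : ℤ) :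
    ∫ φ in 0..Real.pi, Real.cos (n * φ) = if n = 0 then Real.pi else 0 := by
  split_ifs with h
  · simp [h]
  · have hn : (n : ℝ) ≠ 0 := by exact_mod_cast h
    rw [intervalIntegral.integral_comp_mul_left (fun x => Real.cos x) hn, integral_cos]
    simp [Real.sin_int_mul_pi]

/-- Since `Uₙ(cos φ) sin φ = sin((n+1)φ)`, the integrand is half of `cos(nφ) - cos((n+2)φ)`. The
assumption `0 ≤ n` excludes `n = -2`, where the second cosine would contribute. -/
lemma integral_chebyshevU_mul_sin_sq (n : ℤ) (hn : 0 ≤ n) :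
    ∫ φ in 0..Real.pi, (Polynomial.Chebyshev.U ℝ n).eval (Real.cos φ) * Real.sin φ ^ 2 =
      if n = 0 then Real.pi / 2 else 0 := by
  have h1 : ∀ φ : ℝ, (Polynomial.Chebyshev.U ℝ n).eval (Real.cos φ) * Real.sin φ ^ 2 =
      (1 / 2) * (Real.cos ((n : ℤ) * φ) - Real.cos ((n + 2 : ℤ) * φ)) := by
    intro φ
    rw [sq, ← mul_assoc, Polynomial.Chebyshev.U_real_cos]
    have e1 : ((n : ℤ) : ℝ) * φ = (n + 1) * φ - φ := by ring
    have e2 : ((n + 2 : ℤ) : ℝ) * φ = (n + 1) * φ + φ := by push_cast; ring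
    rw [e1, e2, Real.cos_sub, Real.cos_add]
    ring
  simp_rw [h1]
  rw [intervalIntegral.integral_const_mul, intervalIntegral.integral_sub
    (Continuous.intervalIntegrable (by fun_prop) _ _)
    (Continuous.intervalIntegrable (by fun_prop) _ _), integral_cos_int_mul, integral_cos_int_mul,
    if_neg (show n + 2 ≠ 0 by omega)]
  split_ifs <;> ring

/-- The coefficient combination is integration against the denominator `1 - 2b cos φ + b²`, because
`2 cos φ Uₙ = Uₙ₊₁ + Uₙ₋₁`. It cancels the denominator of the density and leaves the orthogonality
integral against `sin²`. -/
lemma jacobiMoment_rec (b : ℝ) (n : ℤ) (hn : 0 ≤ n) :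
    (1 + b ^ 2) * jacobiMoment b n - b * (jacobiMoment b (n + 1) + jacobiMoment b (n - 1)) =
      if n = 0 then 1 else 0 := by
  unfold jacobiMoment
  rw [← intervalIntegral.integral_add (intervalIntegrable_eval_cos_mul _ _ _ _)
    (intervalIntegrable_eval_cos_mul _ _ _ _), ← intervalIntegral.integral_const_mul,
    ← intervalIntegral.integral_const_mul, ← intervalIntegral.integral_sub
    ((intervalIntegrable_eval_cos_mul _ _ _ _).const_mul _)
    (((intervalIntegrable_eval_cos_mul _ _ _ _).add
      (intervalIntegrable_eval_cos_mul _ _ _ _)).const_mul _)]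
  have h1 : ∀ φ : ℝ, (1 + b ^ 2) * ((Polynomial.Chebyshev.U ℝ n).eval (Real.cos φ) *
      jacobiDensity b φ) - b * ((Polynomial.Chebyshev.U ℝ (n + 1)).eval (Real.cos φ) *
      jacobiDensity b φ + (Polynomial.Chebyshev.U ℝ (n - 1)).eval (Real.cos φ) *
      jacobiDensity b φ) =
      2 / Real.pi * ((Polynomial.Chebyshev.U ℝ n).eval (Real.cos φ) * Real.sin φ ^ 2) := by
    intro φ
    have h2 := denom_mul_jacobiDensity b φ
    have h3 : (Polynomial.Chebyshev.U ℝ (n + 1)).eval (Real.cos φ) =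
        2 * Real.cos φ * (Polynomial.Chebyshev.U ℝ n).eval (Real.cos φ) -
        (Polynomial.Chebyshev.U ℝ (n - 1)).eval (Real.cos φ) := by
      rw [Polynomial.Chebyshev.U_add_one]; simp
    rw [h3]
    linear_combination (Polynomial.Chebyshev.U ℝ n).eval (Real.cos φ) * h2
  simp_rw [h1]
  rw [intervalIntegral.integral_const_mul, integral_chebyshevU_mul_sin_sq n hn]
  have := Real.pi_pos
  split_ifs
  · field_simp
  · simp

lemma jacobiMoment_neg_one (b : ℝ) : jacobiMoment b (-1) = 0 := by
  simp [jacobiMoment]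

/-- The point is uniformity in `n`: one factor `sin φ` of the density turns `Uₙ(cos φ)` into
`sin((n+1)φ)`, and the denominator is at least `(1-b)²`. -/
lemma abs_jacobiMoment_le (hb0 : 0 ≤ b) (hb1 : b < 1) (n : ℤ) :
    |jacobiMoment b n| ≤ 2 / (1 - b) ^ 2 := by
  have h1 : ∀ φ ∈ Set.uIoc 0 Real.pi, ‖(Polynomial.Chebyshev.U ℝ n).eval (Real.cos φ) *
      jacobiDensity b φ‖ ≤ 2 / Real.pi / (1 - b) ^ 2 := by
    intro φ _
    have h2 : (Polynomial.Chebyshev.U ℝ n).eval (Real.cos φ) * jacobiDensity b φ =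
        2 / Real.pi * (Real.sin ((n + 1) * φ) * Real.sin φ) / (1 - 2 * b * Real.cos φ + b ^ 2) := by
      rw [← Polynomial.Chebyshev.U_real_cos]
      unfold jacobiDensity
      ring
    have h3 : (1 - b) ^ 2 ≤ 1 - 2 * b * Real.cos φ + b ^ 2 := by
      nlinarith [Real.cos_le_one φ]
    have h4 : 0 < (1 - b) ^ 2 := pow_pos (by linarith) 2
    have h5 : |Real.sin ((n + 1) * φ) * Real.sin φ| ≤ 1 := by
      rw [abs_mul]
      exact mul_le_one₀ (Real.abs_sin_le_one _) (abs_nonneg _) (Real.abs_sin_le_one _)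
    have := Real.pi_pos
    rw [h2, Real.norm_eq_abs, abs_div, abs_mul, abs_of_pos (h4.trans_le h3),
      abs_of_pos (by positivity : 0 < 2 / Real.pi)]
    calc _ ≤ 2 / Real.pi * 1 / (1 - b) ^ 2 := by gcongr
      _ = _ := by ring
  have h := intervalIntegral.norm_integral_le_of_norm_le_const h1
  have := Real.pi_pos
  rw [sub_zero, abs_of_pos Real.pi_pos] at h
  calc _ ≤ _ := h
    _ = _ := by field_simp

/-- With `mₙ` the moments and `Nₙ = mₙ - b mₙ₋₁`, the second-order recursion factors as `Nₙ - b Nₙ₊₁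
= δₙ₀`. For `b < 1` iteration and boundedness force `Nₙ = 0` for `n ≥ 1`. For `b = 1` nothing
contracts, and the integral is computed directly. -/
lemma jacobiMoment_sub (hb0 : 0 ≤ b) (hb1 : b ≤ 1) (n : ℕ) :
    jacobiMoment b n - b * jacobiMoment b ((n : ℤ) - 1) = if n = 0 then 1 else 0 := by
  rcases hb1.lt_or_eq with hb1 | rfl
  · set N : ℕ → ℝ := fun n => jacobiMoment b n - b * jacobiMoment b ((n : ℤ) - 1) with hN
    have hrec : ∀ n : ℕ, N n = b * N (n + 1) + if n = 0 then 1 else 0 := by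
      intro n
      have h := jacobiMoment_rec b n (by positivity)
      simp only [hN]
      push_cast
      rw [show ((n : ℤ) + 1 - 1) = n by ring]
      simp only [Nat.cast_eq_zero] at h
      linarith
    have hbound : ∀ n, |N n| ≤ 2 * (2 / (1 - b) ^ 2) := by
      intro n
      have h1 := abs_jacobiMoment_le hb0 hb1 n
      have h2 := abs_jacobiMoment_le hb0 hb1 ((n : ℤ) - 1)
      calc |N n| ≤ |jacobiMoment b n| + |b * jacobiMoment b ((n : ℤ) - 1)| := abs_sub _ _
        _ ≤ |jacobiMoment b n| + 1 * |jacobiMoment b ((n : ℤ) - 1)| := by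
            rw [abs_mul, abs_of_nonneg hb0]; gcongr
        _ ≤ _ := by linarith
    have hzero : ∀ n, N (n + 1) = 0 := by
      intro n
      have h1 : ∀ k, N (n + 1) = b ^ k * N (n + 1 + k) := by
        intro k
        induction k with
        | zero => simp
        | succ k ih =>
          rw [ih, hrec (n + 1 + k), if_neg (by omega)]
          rw [add_assoc (n + 1) k 1]; ring
      have h2 : Tendsto (fun k => b ^ k * N (n + 1 + k)) atTop (𝓝 0) :=
        bdd_le_mul_tendsto_zero' (2 * (2 / (1 - b) ^ 2))
          (Eventually.of_forall fun k => hbound _) (tendsto_pow_atTop_nhds_zero_of_lt_one hb0 hb1)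
          |>.congr fun k => mul_comm _ _
      exact tendsto_nhds_unique tendsto_const_nhds (h2.congr fun k => (h1 k).symm)
    change N n = _
    rcases n with _ | n
    · rw [hrec 0, hzero 0]; simp
    · rw [hzero n]; simp
  · unfold jacobiMoment
    rw [one_mul, ← intervalIntegral.integral_sub (intervalIntegrable_eval_cos_mul _ _ _ _)
      (intervalIntegrable_eval_cos_mul _ _ _ _)]
    -- At `b = 1` the denominator is `2(1 - cos φ)`, and it divides `(Uₙ - Uₙ₋₁)(cos φ) sin²φ` to
    -- leave a sum of two cosines. The endpoints, where the denominator may vanish, are a null set.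
    have h1 : ∀ φ ∈ Set.Ioo 0 Real.pi,
        (Polynomial.Chebyshev.U ℝ (n : ℤ)).eval (Real.cos φ) * jacobiDensity 1 φ -
        (Polynomial.Chebyshev.U ℝ ((n : ℤ) - 1)).eval (Real.cos φ) * jacobiDensity 1 φ =
        1 / Real.pi * (Real.cos ((n : ℤ) * φ) + Real.cos ((n + 1 : ℤ) * φ)) := by
      intro φ hφ
      have hs : 0 < Real.sin φ := Real.sin_pos_of_mem_Ioo hφ
      have hc : 0 < 1 - 2 * 1 * Real.cos φ + 1 ^ 2 :=
        (pow_pos hs 2).trans_le (sin_sq_le_denom 1 φ)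
      have e1 := Polynomial.Chebyshev.U_real_cos φ (n : ℤ)
      have e2 := Polynomial.Chebyshev.U_real_cos φ ((n : ℤ) - 1)
      push_cast at e1 e2 ⊢
      rw [add_mul, one_mul, Real.sin_add] at e1
      rw [sub_add_cancel] at e2
      rw [add_mul, one_mul, Real.cos_add]
      have e3 := Real.sin_sq_add_cos_sq φ
      have e5 := denom_mul_jacobiDensity 1 φ
      have e4 : (Polynomial.eval (Real.cos φ) (Polynomial.Chebyshev.U ℝ (n : ℤ)) -
        Polynomial.eval (Real.cos φ) (Polynomial.Chebyshev.U ℝ ((n : ℤ) - 1))) * Real.sin φ =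
        Real.sin (n * φ) * Real.cos φ + Real.cos (n * φ) * Real.sin φ - Real.sin (n * φ) := by
        rw [sub_mul, e1, e2]
      refine mul_left_cancel₀ hc.ne' ?_
      linear_combination (Polynomial.eval (Real.cos φ) (Polynomial.Chebyshev.U ℝ (n : ℤ)) -
        Polynomial.eval (Real.cos φ) (Polynomial.Chebyshev.U ℝ ((n : ℤ) - 1))) * e5 +
        (2 / Real.pi * Real.sin φ) * e4 + 2 / Real.pi * Real.cos (n * φ) * e3
    rw [intervalIntegral.integral_of_le Real.pi_pos.le,
      integral_Ioc_eq_integral_Ioo, setIntegral_congr_fun measurableSet_Ioo h1,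
      ← integral_Ioc_eq_integral_Ioo, ← intervalIntegral.integral_of_le Real.pi_pos.le,
      intervalIntegral.integral_const_mul, intervalIntegral.integral_add
      (Continuous.intervalIntegrable (by fun_prop) _ _)
      (Continuous.intervalIntegrable (by fun_prop) _ _), integral_cos_int_mul,
      integral_cos_int_mul, if_neg (show (n : ℤ) + 1 ≠ 0 by omega)]
    have := Real.pi_pos
    simp only [Nat.cast_eq_zero]
    split_ifs
    · field_simp; simp
    · simp

lemma jacobiMoment_eq (hb0 : 0 ≤ b) (hb1 : b ≤ 1) (n : ℕ) : jacobiMoment b n = b ^ n := by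
  induction n with
  | zero =>
    have := jacobiMoment_sub hb0 hb1 0
    simpa [jacobiMoment_neg_one] using this
  | succ n ih =>
    have := jacobiMoment_sub hb0 hb1 (n + 1)
    push_cast at this ⊢
    rw [show (n : ℤ) + 1 - 1 = n by ring, ih] at this
    rw [pow_succ]; linarith

end Density

end FreeGraph

end

noncomputable section

namespace FreeGraph

/-! ### Orthogonality of the polynomials and the spectral laws of the Jacobi matrices. -/

section Law

variable {b : ℝ}

open Polynomial in
-- Both sides satisfy the same recursion in `n`, the sign `(-1)ⁿ` absorbing the sign of the spectral
-- parameter `-2 cos φ`. At `n = 0` the second term is `U₋₁ = 0`.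
lemma eval_jacobiPoly (c : ℂ) (φ : ℝ) : ∀ n : ℕ,
    (jacobiPoly c n).eval (-2 * Real.cos φ : ℂ) =
      (-1) ^ n * (((Chebyshev.U ℝ n).eval (Real.cos φ) : ℝ) -
        c * ((Chebyshev.U ℝ ((n : ℤ) - 1)).eval (Real.cos φ) : ℝ))
  | 0 => by simp [jacobiPoly]
  | 1 => by simp [jacobiPoly]; ring
  | n + 2 => by
      have h1 := eval_jacobiPoly c φ (n + 1)
      have h2 := eval_jacobiPoly c φ n
      have h3 : ∀ m : ℤ, (((Chebyshev.U ℝ (m + 1)).eval (Real.cos φ) : ℝ) : ℂ) =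
        2 * (Real.cos φ : ℂ) * ((Chebyshev.U ℝ m).eval (Real.cos φ) : ℝ) -
          ((Chebyshev.U ℝ (m - 1)).eval (Real.cos φ) : ℝ) := by
        intro m; rw [Chebyshev.U_add_one]; simp
      have h4 := h3 (n + 1)
      have h5 := h3 n
      simp only [jacobiPoly, eval_sub, eval_mul, eval_X, h1, h2]
      push_cast at *
      rw [show (n : ℤ) + 2 - 1 = n + 1 by ring, show (n : ℤ) + 2 = n + 1 + 1 by ring, h4]
      rw [show (n : ℤ) + 1 - 1 = n by ring, h5]
      ring

open Polynomial in
lemma integral_jacobiPoly (hb0 : 0 ≤ b) (hb1 : b ≤ 1) (c : ℂ) (n : ℕ) :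
    ∫ φ in 0..Real.pi, jacobiDensity b φ • (jacobiPoly c n).eval (-2 * Real.cos φ : ℂ) =
      (-1) ^ n * (b ^ n - c * jacobiMoment b ((n : ℤ) - 1)) := by
  have h1 : ∀ φ : ℝ, jacobiDensity b φ • (jacobiPoly c n).eval (-2 * Real.cos φ : ℂ) =
      (-1) ^ n * ((((Chebyshev.U ℝ n).eval (Real.cos φ) * jacobiDensity b φ : ℝ) : ℂ) -
        c * (((Chebyshev.U ℝ ((n : ℤ) - 1)).eval (Real.cos φ) * jacobiDensity b φ : ℝ) : ℂ)) := by
    intro φ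
    rw [eval_jacobiPoly, Complex.real_smul]
    push_cast
    ring
  have h2 : ∀ m : ℤ, IntervalIntegrable (fun φ => (((Chebyshev.U ℝ m).eval (Real.cos φ) *
      jacobiDensity b φ : ℝ) : ℂ)) volume 0 Real.pi := fun m =>
    ⟨(intervalIntegrable_eval_cos_mul b _ _ _).1.ofReal,
      (intervalIntegrable_eval_cos_mul b _ _ _).2.ofReal⟩
  simp_rw [h1]
  rw [intervalIntegral.integral_const_mul, intervalIntegral.integral_sub (h2 _)
    ((h2 _).const_mul _), intervalIntegral.integral_const_mul, intervalIntegral.integral_ofReal,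
    intervalIntegral.integral_ofReal]
  rw [← Complex.ofReal_pow, ← jacobiMoment_eq hb0 hb1]
  rfl

open Polynomial in
lemma integral_jacobiPoly_self (hb0 : 0 ≤ b) (hb1 : b ≤ 1) (n : ℕ) :
    ∫ φ in 0..Real.pi, jacobiDensity b φ • (jacobiPoly b n).eval (-2 * Real.cos φ : ℂ) =
      if n = 0 then 1 else 0 := by
  rw [integral_jacobiPoly hb0 hb1]
  have := jacobiMoment_sub hb0 hb1 n
  rw [← Complex.ofReal_pow, ← jacobiMoment_eq hb0 hb1, ← Complex.ofReal_mul, ← Complex.ofReal_sub,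
    this]
  split_ifs with h
  · simp [h]
  · simp

open Polynomial in
-- At the atom `-(b + b⁻¹)` the recursion has a geometric solution. For `b < 1` it is the
-- square-summable eigenvector, of squared norm `1/(1 - b²)`, which explains the mass `1 - b²` of
-- the atom.
lemma eval_jacobiPoly_inv (hb0 : b ≠ 0) : ∀ n : ℕ,
    (jacobiPoly ((b⁻¹ : ℝ) : ℂ) n).eval (((-(b + b⁻¹) : ℝ)) : ℂ) = (-b : ℂ) ^ n
  | 0 => by simp [jacobiPoly]
  | 1 => by simp [jacobiPoly]
  | n + 2 => by
      have h1 := eval_jacobiPoly_inv hb0 (n + 1)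
      have h2 := eval_jacobiPoly_inv hb0 n
      have hb : (b : ℂ) ≠ 0 := by exact_mod_cast hb0
      simp only [jacobiPoly, eval_sub, eval_mul, eval_X, h1, h2]
      push_cast
      field_simp
      ring

open Polynomial in
-- For `n ≥ 1` the integral equals `(-1)ⁿ(bⁿ - bⁿ⁻²)` by the moment formula, and `b²` times it
-- cancels the contribution `(1 - b²)(-b)ⁿ` of the atom.
lemma integral_jacobiPoly_inv (hb0 : 0 < b) (hb1 : b ≤ 1) (n : ℕ) :
    ((1 - b ^ 2 : ℝ) : ℂ) * (jacobiPoly ((b⁻¹ : ℝ) : ℂ) n).eval (((-(b + b⁻¹) : ℝ)) : ℂ) +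
    ((b ^ 2 : ℝ) : ℂ) * ∫ φ in 0..Real.pi, jacobiDensity b φ •
        (jacobiPoly ((b⁻¹ : ℝ) : ℂ) n).eval (-2 * Real.cos φ : ℂ) =
      if n = 0 then 1 else 0 := by
  rw [integral_jacobiPoly hb0.le hb1, eval_jacobiPoly_inv hb0.ne']
  have hb : (b : ℂ) ≠ 0 := by exact_mod_cast hb0.ne'
  rcases n with _ | n
  · simp [jacobiMoment_neg_one]
  · push_cast
    rw [show (n : ℤ) + 1 - 1 = n by ring, jacobiMoment_eq hb0.le hb1]
    push_cast
    field_simp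
    ring

/-- The integral of a polynomial in `-2 cos φ` against the density, as a linear functional. -/
def polyIntegral (b : ℝ) : Polynomial ℂ →ₗ[ℂ] ℂ where
  toFun p := ∫ φ in 0..Real.pi, jacobiDensity b φ • p.eval (-2 * Real.cos φ : ℂ)
  map_add' p q := by
    simp only [Polynomial.eval_add, smul_add]
    exact intervalIntegral.integral_add
      (intervalIntegrable_smul_jacobiDensity b (p.continuous.comp (by fun_prop)) _ _)
      (intervalIntegrable_smul_jacobiDensity b (q.continuous.comp (by fun_prop)) _ _)
  map_smul' a p := by
    simp only [Polynomial.eval_smul, RingHom.id_apply]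
    rw [← intervalIntegral.integral_smul]
    congr 1
    ext φ
    rw [smul_comm]

section Jacobi

variable {M : Type*} [AddCommGroup M] [Module ℂ M] {Y : M →ₗ[ℂ] M} {e : ℕ → M} {l : M →ₗ[ℂ] ℂ}

open Polynomial in
/-- The spectral measure at `e₀` of the Jacobi matrix `s + s* - b e₀e₀*`, `0 ≤ b ≤ 1`. -/
lemma jacobi_law (hb0 : 0 ≤ b) (hb1 : b ≤ 1) (h0 : Y (e 0) = e 1 - (b : ℂ) • e 0)
    (h : ∀ n, Y (e (n + 1)) = e (n + 2) + e n) (hl0 : l (e 0) = 1) (hl : ∀ n, l (e (n + 1)) = 0)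
    (p : ℂ[X]) :
    l (aeval Y p (e 0)) =
      ∫ φ in 0..Real.pi, jacobiDensity b φ • p.eval (-2 * Real.cos φ : ℂ) := by
  -- Both functionals send the `n`-th orthogonal polynomial to `δₙ₀`: the left one because the
  -- polynomial maps `e 0` to `e n`, the right one by orthogonality.
  have key : l ∘ₗ LinearMap.applyₗ (e 0) ∘ₗ (aeval Y).toLinearMap = polyIntegral b := by
    refine LinearMap.ext_on (span_jacobiPoly (b : ℂ)) ?_
    rintro _ ⟨n, rfl⟩
    change l (aeval Y (jacobiPoly b n) (e 0)) = ∫ φ in 0..Real.pi, jacobiDensity b φ •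
      (jacobiPoly b n).eval (-2 * Real.cos φ : ℂ)
    rw [jacobiPoly_aeval _ Y e h0 h, integral_jacobiPoly_self hb0 hb1]
    rcases n with _ | n <;> simp [hl0, hl]
  exact LinearMap.congr_fun key p

open Polynomial in
/-- The spectral measure at `e₀` of the Jacobi matrix `s + s* - b⁻¹ e₀e₀*`, `0 < b ≤ 1`. -/
lemma jacobi_law_inv (hb0 : 0 < b) (hb1 : b ≤ 1)
    (h0 : Y (e 0) = e 1 - ((b⁻¹ : ℝ) : ℂ) • e 0)
    (h : ∀ n, Y (e (n + 1)) = e (n + 2) + e n) (hl0 : l (e 0) = 1) (hl : ∀ n, l (e (n + 1)) = 0)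
    (p : ℂ[X]) :
    l (aeval Y p (e 0)) = ((1 - b ^ 2 : ℝ) : ℂ) * p.eval (((-(b + b⁻¹) : ℝ)) : ℂ) +
      ((b ^ 2 : ℝ) : ℂ) *
        ∫ φ in 0..Real.pi, jacobiDensity b φ • p.eval (-2 * Real.cos φ : ℂ) := by
  have key : l ∘ₗ LinearMap.applyₗ (e 0) ∘ₗ (aeval Y).toLinearMap =
      ((1 - b ^ 2 : ℝ) : ℂ) • (Polynomial.leval (((-(b + b⁻¹) : ℝ)) : ℂ)) +
      ((b ^ 2 : ℝ) : ℂ) • polyIntegral b := by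
    refine LinearMap.ext_on (span_jacobiPoly ((b⁻¹ : ℝ) : ℂ)) ?_
    rintro _ ⟨n, rfl⟩
    refine Eq.trans ?_ (integral_jacobiPoly_inv hb0 hb1 n).symm
    change l (aeval Y (jacobiPoly _ n) (e 0)) = _
    rw [jacobiPoly_aeval _ Y e h0 h]
    rcases n with _ | n <;> simp [hl0, hl]
  exact LinearMap.congr_fun key p

end Jacobi

end Law

/-! ## The distribution function -/

section Cdf

variable {b : ℝ}

/-- The distribution function of the spectral measure, in the variable `φ`. -/
def jacobiCdf (b x : ℝ) : ℝ := ∫ φ in 0..x, jacobiDensity b φ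

lemma continuous_jacobiCdf (b : ℝ) : Continuous (jacobiCdf b) :=
  intervalIntegral.continuous_primitive (fun _ _ => intervalIntegrable_jacobiDensity b _ _) 0

lemma jacobiCdf_zero (b : ℝ) : jacobiCdf b 0 = 0 := intervalIntegral.integral_same

lemma jacobiCdf_pi (hb0 : 0 ≤ b) (hb1 : b ≤ 1) : jacobiCdf b Real.pi = 1 := by
  have := jacobiMoment_eq hb0 hb1 0
  simpa [jacobiMoment, jacobiCdf] using this

lemma hasDerivAt_jacobiCdf {x : ℝ} (hx : x ∈ Set.Ioo 0 Real.pi) :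
    HasDerivAt (jacobiCdf b) (jacobiDensity b x) x :=
  intervalIntegral.integral_hasDerivAt_right (intervalIntegrable_jacobiDensity b _ _)
    (measurable_jacobiDensity b).stronglyMeasurable.stronglyMeasurableAtFilter
    (continuousAt_jacobiDensity hx)

lemma strictMonoOn_jacobiCdf (b : ℝ) : StrictMonoOn (jacobiCdf b) (Set.Icc 0 Real.pi) := by
  refine strictMonoOn_of_deriv_pos (convex_Icc _ _) (continuous_jacobiCdf b).continuousOn ?_
  intro x hx
  rw [interior_Icc] at hx
  rw [(hasDerivAt_jacobiCdf hx).deriv]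
  exact jacobiDensity_pos hx

lemma jacobiCdf_mem (hb0 : 0 ≤ b) (hb1 : b ≤ 1) {x : ℝ} (hx : x ∈ Set.Icc 0 Real.pi) :
    jacobiCdf b x ∈ unitInterval := by
  have hm := (strictMonoOn_jacobiCdf b).monotoneOn
  refine ⟨?_, ?_⟩
  · rw [← jacobiCdf_zero b]; exact hm ⟨le_rfl, Real.pi_pos.le⟩ hx hx.1
  · rw [← jacobiCdf_pi hb0 hb1]; exact hm hx ⟨Real.pi_pos.le, le_rfl⟩ hx.2

/-- The distribution function as a homeomorphism `[0, π] ≃ [0, 1]`. -/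
def cdfHomeo (hb0 : 0 ≤ b) (hb1 : b ≤ 1) : Set.Icc 0 Real.pi ≃ₜ unitInterval :=
  Continuous.homeoOfEquivCompactToT2
    (f := Equiv.ofBijective (fun x : Set.Icc 0 Real.pi =>
      (⟨jacobiCdf b x, jacobiCdf_mem hb0 hb1 x.2⟩ : unitInterval)) (by
        refine ⟨fun x y hxy => ?_, fun y => ?_⟩
        · exact Subtype.ext ((strictMonoOn_jacobiCdf b).injOn x.2 y.2 (congrArg Subtype.val hxy))
        · have h := intermediate_value_Icc Real.pi_pos.le
            (continuous_jacobiCdf b).continuousOn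
          rw [jacobiCdf_zero, jacobiCdf_pi hb0 hb1] at h
          obtain ⟨x, hx, hxy⟩ := h y.2
          exact ⟨⟨x, hx⟩, Subtype.ext hxy⟩))
    (by
      refine Continuous.subtype_mk ?_ _
      exact (continuous_jacobiCdf b).comp continuous_subtype_val)

lemma cdfHomeo_zero (hb0 : 0 ≤ b) (hb1 : b ≤ 1) :
    cdfHomeo hb0 hb1 ⟨0, le_rfl, Real.pi_pos.le⟩ = 0 :=
  Subtype.ext (jacobiCdf_zero b)

/-- The substitution `u = jacobiCdf b φ` pushes the density forward to Lebesgue measure. The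
derivative is needed only in the open interval, since the density may fail to be continuous at an
endpoint when `b = 1`. -/
lemma integral_unitInterval_eq (hb0 : 0 ≤ b) (hb1 : b ≤ 1) {F : Type*} [NormedAddCommGroup F]
    [NormedSpace ℝ F] (f : C(unitInterval, F)) :
    ∫ t, f t = ∫ φ in 0..Real.pi, jacobiDensity b φ •
      f (cdfHomeo hb0 hb1 (Set.projIcc 0 Real.pi Real.pi_pos.le φ)) := by
  set g : ℝ → F := Set.IccExtend zero_le_one f with hg
  have hgc : Continuous g := f.continuous.Icc_extend'
  have h1 : ∫ t, f t = ∫ u in 0..1, g u := by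
    rw [intervalIntegral.integral_of_le zero_le_one, ← integral_Icc_eq_integral_Ioc]
    rw [← integral_subtype measurableSet_Icc]
    refine integral_congr_ae (ae_of_all _ fun t => ?_)
    change f t = g t
    rw [hg, Set.IccExtend_val]
  have h2 : ∫ φ in 0..Real.pi, jacobiDensity b φ • (g ∘ jacobiCdf b) φ =
      ∫ u in jacobiCdf b 0..jacobiCdf b Real.pi, g u := by
    refine intervalIntegral.integral_deriv_smul_comp''' (continuous_jacobiCdf b).continuousOn ?_
      hgc.continuousOn ?_ ?_
    · intro x hx
      rw [min_eq_left Real.pi_pos.le, max_eq_right Real.pi_pos.le] at hx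
      exact (hasDerivAt_jacobiCdf hx).hasDerivWithinAt
    · exact hgc.continuousOn.integrableOn_compact
        (isCompact_uIcc.image (continuous_jacobiCdf b))
    · have := intervalIntegrable_smul_jacobiDensity b (hgc.comp (continuous_jacobiCdf b)) 0 Real.pi
      rw [Set.uIcc_of_le Real.pi_pos.le, integrableOn_Icc_iff_integrableOn_Ioc]
      exact (intervalIntegrable_iff_integrableOn_Ioc_of_le Real.pi_pos.le).1 this
  rw [jacobiCdf_zero, jacobiCdf_pi hb0 hb1] at h2
  rw [h1, ← h2]
  refine intervalIntegral.integral_congr fun φ hφ => ?_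
  rw [Set.uIcc_of_le Real.pi_pos.le] at hφ
  simp only [Function.comp, hg]
  rw [Set.IccExtend_of_mem _ _ (jacobiCdf_mem hb0 hb1 hφ), Set.projIcc_of_mem _ hφ]
  rfl

/-- Faithfulness of the Lebesgue integral on continuous functions; the injectivity of all three
models comes from it. -/
lemma eq_zero_of_integral_unitInterval {f : C(unitInterval, ℝ)} (h0 : ∀ t, 0 ≤ f t)
    (h : ∫ t, f t = 0) : f = 0 := by
  set g : ℝ → ℝ := Set.IccExtend zero_le_one f with hg
  have hgc : Continuous g := f.continuous.Icc_extend'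
  have h1 : ∫ t, f t = ∫ u in 0..1, g u := by
    rw [intervalIntegral.integral_of_le zero_le_one, ← integral_Icc_eq_integral_Ioc]
    rw [← integral_subtype measurableSet_Icc]
    refine integral_congr_ae (ae_of_all _ fun t => ?_)
    change f t = g t
    rw [hg, Set.IccExtend_val]
  ext t
  by_contra ht
  have h2 : 0 < ∫ u in (0 : ℝ)..1, g u :=
    intervalIntegral.integral_pos one_pos hgc.continuousOn (fun x _ => h0 _)
      ⟨t, t.2, by
        rw [hg, Set.IccExtend_val]
        exact lt_of_le_of_ne (h0 t) (fun h => ht h.symm)⟩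
  rw [← h1, h] at h2
  exact lt_irrefl _ h2

end Cdf

end FreeGraph

end

noncomputable section

/-! ## Continuous functions of a self-adjoint element with a symmetric spectrum -/

namespace FreeGraph

/-- The real numbers `t` with `t = 0` or `k₀ ≤ |t|`, and `|t| ≤ k₁`, as a subset of `ℂ`. -/
def gapSet (k₀ k₁ : ℝ) : Set ℂ := {z | z.im = 0 ∧ (z.re = 0 ∨ k₀ ≤ |z.re|) ∧ |z.re| ≤ k₁}

variable {k₀ k₁ : ℝ}

instance : CompactSpace (gapSet k₀ k₁) := by
  refine isCompact_iff_compactSpace.1 (Metric.isCompact_of_isClosed_isBounded ?_ ?_)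
  · have h1 : IsClosed {z : ℂ | z.im = 0} := isClosed_eq Complex.continuous_im continuous_const
    have h2 : IsClosed {z : ℂ | z.re = 0} := isClosed_eq Complex.continuous_re continuous_const
    have h3 : IsClosed {z : ℂ | k₀ ≤ |z.re|} :=
      isClosed_le continuous_const (continuous_abs.comp Complex.continuous_re)
    have h4 : IsClosed {z : ℂ | |z.re| ≤ k₁} :=
      isClosed_le (continuous_abs.comp Complex.continuous_re) continuous_const
    exact h1.inter ((h2.union h3).inter h4)
  · refine Metric.isBounded_closedBall (x := (0 : ℂ)) (r := k₁) |>.subset fun z hz => ?_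
    rw [mem_closedBall_zero_iff]
    calc ‖z‖ ≤ |z.re| + |z.im| := Complex.norm_le_abs_re_add_abs_im z
      _ ≤ k₁ := by rw [hz.1]; simpa using hz.2.2

lemma gapSet_eq_re (z : gapSet k₀ k₁) : (z : ℂ) = ((z : ℂ).re : ℂ) :=
  Complex.ext rfl (by simp [z.2.1])

/-- The coordinate function. -/
def gapId (k₀ k₁ : ℝ) : C(gapSet k₀ k₁, ℂ) := (ContinuousMap.id ℂ).restrict (gapSet k₀ k₁)

lemma gapId_apply (z : gapSet k₀ k₁) : gapId k₀ k₁ z = z := rfl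

/-- The reflection `z ↦ -z`. -/
def gapNeg (k₀ k₁ : ℝ) : C(gapSet k₀ k₁, gapSet k₀ k₁) where
  toFun z := ⟨-z, by
    obtain ⟨h1, h2, h3⟩ := z.2
    refine ⟨?_, ?_, ?_⟩ <;> simp [h1, h2, h3]⟩
  continuous_toFun := by fun_prop

lemma coe_gapNeg (z : gapSet k₀ k₁) : (gapNeg k₀ k₁ z : ℂ) = -z := rfl

/-- Stone-Weierstrass. The gap set is real, so the coordinate function is self-adjoint and the
polynomials in it already form a *-algebra that separates points. -/
lemma closure_span_gapId_pow :
    (Submodule.span ℂ (Set.range fun n : ℕ => gapId k₀ k₁ ^ n)).topologicalClosure = ⊤ := by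
  set S : StarSubalgebra ℂ C(gapSet k₀ k₁, ℂ) :=
    { Algebra.adjoin ℂ {gapId k₀ k₁} with
      star_mem' := by
        intro f hf
        change star f ∈ Algebra.adjoin ℂ {gapId k₀ k₁}
        have hs : star (gapId k₀ k₁) = gapId k₀ k₁ := by
          ext z
          change star (z : ℂ) = z
          rw [gapSet_eq_re z]
          simp
        induction hf using Algebra.adjoin_induction with
        | mem x hx =>
          rw [Set.mem_singleton_iff] at hx
          rw [hx, hs]
          exact Algebra.subset_adjoin rfl
        | algebraMap r =>
          rw [← algebraMap_star_comm]
          exact Subalgebra.algebraMap_mem _ _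
        | add x y _ _ hx hy => rw [star_add]; exact add_mem hx hy
        | mul x y _ _ hx hy => rw [star_mul]; exact mul_mem hy hx } with hS
  have hsep : S.SeparatesPoints := by
    intro x y hxy
    refine ⟨gapId k₀ k₁, ⟨gapId k₀ k₁, Algebra.subset_adjoin rfl, rfl⟩, ?_⟩
    exact fun h => hxy (Subtype.ext h)
  have htop := ContinuousMap.starSubalgebra_topologicalClosure_eq_top_of_separatesPoints S hsep
  rw [eq_top_iff]
  intro f _
  have hf : f ∈ S.topologicalClosure := by rw [htop]; trivial
  refine closure_mono ?_ hf
  intro g hg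
  change g ∈ Algebra.adjoin ℂ {gapId k₀ k₁} at hg
  have h : g ∈ Subalgebra.toSubmodule (Algebra.adjoin ℂ {gapId k₀ k₁}) := hg
  rw [Algebra.adjoin_eq_span, Submonoid.closure_singleton_eq] at h
  exact h

/-- This reduces identities about the functional calculus of `T` to identities about the powers of
`T`, that is, to moments. -/
lemma gap_ext {F : Type*} [NormedAddCommGroup F] [NormedSpace ℂ F]
    {L L' : C(gapSet k₀ k₁, ℂ) →L[ℂ] F} (h : ∀ n, L (gapId k₀ k₁ ^ n) = L' (gapId k₀ k₁ ^ n)) :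
    L = L' := by
  refine ContinuousLinearMap.ext fun f => ?_
  have hf : f ∈ (Submodule.span ℂ (Set.range fun n : ℕ => gapId k₀ k₁ ^ n)).topologicalClosure := by
    rw [closure_span_gapId_pow]; trivial
  refine closure_minimal (s := (Submodule.span ℂ (Set.range fun n : ℕ => gapId k₀ k₁ ^ n) :
    Set C(gapSet k₀ k₁, ℂ))) (t := {f | L f = L' f}) ?_ (isClosed_eq L.continuous L'.continuous) hf
  intro g hg
  refine Submodule.span_induction (p := fun g _ => L g = L' g) ?_ ?_ ?_ ?_ hg
  · rintro _ ⟨n, rfl⟩; exact h n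
  · simp
  · intro x y _ _ hx hy; simp [hx, hy]
  · intro c x _ hx; simp [hx]

/-! ### Functional calculus and parity. -/

section Calculus

variable {A : Type*} [CStarAlgebra A] {T : A} (hT : IsSelfAdjoint T)
  (hs : spectrum ℂ T ⊆ gapSet k₀ k₁)

/-- The functional calculus for `T` with functions on a gap set. -/
def gapCalc : C(gapSet k₀ k₁, ℂ) →⋆ₐ[ℂ] A := cfcHomSuperset hT.isStarNormal hs

lemma continuous_gapCalc : Continuous (gapCalc hT hs) :=
  cfcHomSuperset_continuous hT.isStarNormal hs

lemma gapCalc_id : gapCalc hT hs (gapId k₀ k₁) = T :=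
  cfcHomSuperset_id hT.isStarNormal hs

/-- The functional calculus as a continuous linear map. -/
def gapCalcCLM : C(gapSet k₀ k₁, ℂ) →L[ℂ] A :=
  ⟨(gapCalc hT hs).toAlgHom.toLinearMap, continuous_gapCalc hT hs⟩

lemma gapCalc_pow (n : ℕ) : gapCalc hT hs (gapId k₀ k₁ ^ n) = T ^ n := by
  rw [map_pow, gapCalc_id]

/-- Since `u * u = 1`, conjugation by `u` is multiplicative, so it sends `Tⁿ` to `(-T)ⁿ`; powers
suffice by density. -/
lemma conj_gapCalc {u : A} (huu : u * u = 1) (hu : u * T * u = -T) (g : C(gapSet k₀ k₁, ℂ)) :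
    u * gapCalc hT hs g * u = gapCalc hT hs (g.comp (gapNeg k₀ k₁)) := by
  have key : ((ContinuousLinearMap.mul ℂ A u).comp
      ((ContinuousLinearMap.mul ℂ A).flip u)).comp (gapCalcCLM hT hs) =
      (gapCalcCLM hT hs).comp ⟨(ContinuousMap.compRightAlgHom ℂ ℂ (gapNeg k₀ k₁)).toLinearMap,
        ContinuousMap.continuous_precomp (gapNeg k₀ k₁)⟩ := by
    refine gap_ext fun n => ?_
    change u * (gapCalc hT hs (gapId k₀ k₁ ^ n) * u) =
      gapCalc hT hs ((gapId k₀ k₁ ^ n).comp (gapNeg k₀ k₁))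
    have h1 : (gapId k₀ k₁ ^ n).comp (gapNeg k₀ k₁) = (-gapId k₀ k₁) ^ n := by
      ext z; simp [coe_gapNeg, gapId_apply]
    rw [h1, map_pow, map_pow, map_neg, gapCalc_id, ← hu, ← mul_assoc]
    clear h1
    induction n with
    | zero => simpa using huu
    | succ n ih =>
      rw [pow_succ, pow_succ, ← ih]
      simp only [mul_assoc]
      rw [← mul_assoc u u (T * u), huu, one_mul]
  have := DFunLike.congr_fun key g
  rw [mul_assoc]
  exact this

section Parity

variable {p : A} (hp : p * p = p) (hpT : p * T + T * p = T)
include hp hpT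

/-- The hypothesis `hpT` forces the corner `p T p` to vanish, so `T` is off-diagonal for `p`, and
the reflection `1 - 2p` reverses its sign. -/
lemma reflection_conj : (1 - 2 * p) * (1 - 2 * p) = 1 ∧ (1 - 2 * p) * T * (1 - 2 * p) = -T := by
  have h1 : p * T * p = 0 := by
    have h2 : p * (p * T + T * p) = p * T := by rw [hpT]
    rw [mul_add, ← mul_assoc, hp, ← mul_assoc] at h2
    simpa using h2
  constructor
  · have : (1 - 2 * p) * (1 - 2 * p) = 1 - 4 * p + 4 * (p * p) := by noncomm_ring
    rw [this, hp]; noncomm_ring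
  · have : (1 - 2 * p) * T * (1 - 2 * p) = T - 2 * (p * T + T * p) + 4 * (p * T * p) := by
      noncomm_ring
    rw [this, hpT, h1]; noncomm_ring

lemma commute_gapCalc_of_even {g : C(gapSet k₀ k₁, ℂ)} (hg : g.comp (gapNeg k₀ k₁) = g) :
    p * gapCalc hT hs g = gapCalc hT hs g * p := by
  obtain ⟨h1, h2⟩ := reflection_conj hp hpT
  have h3 := conj_gapCalc hT hs h1 h2 g
  rw [hg] at h3
  have h4 : (1 - 2 * p) * gapCalc hT hs g = gapCalc hT hs g * (1 - 2 * p) := by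
    calc _ = (1 - 2 * p) * gapCalc hT hs g * ((1 - 2 * p) * (1 - 2 * p)) := by rw [h1, mul_one]
      _ = ((1 - 2 * p) * gapCalc hT hs g * (1 - 2 * p)) * (1 - 2 * p) := by noncomm_ring
      _ = _ := by rw [h3]
  have h5 : (2 : ℂ) • (p * gapCalc hT hs g) = (2 : ℂ) • (gapCalc hT hs g * p) := by
    have e1 : (1 - 2 * p) * gapCalc hT hs g = gapCalc hT hs g - (p + p) * gapCalc hT hs g := by
      noncomm_ring
    have e2 : gapCalc hT hs g * (1 - 2 * p) = gapCalc hT hs g - gapCalc hT hs g * (p + p) := by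
      noncomm_ring
    rw [e1, e2] at h4
    rw [two_smul, two_smul, ← add_mul, ← mul_add]
    exact sub_right_injective h4
  exact smul_right_injective A (two_ne_zero' ℂ) h5

/-- An odd function of `T` anticommutes with the reflection `1 - 2p`, which says that it is
off-diagonal for `p`, like `T` itself. -/
lemma add_gapCalc_of_odd {g : C(gapSet k₀ k₁, ℂ)} (hg : g.comp (gapNeg k₀ k₁) = -g) :
    p * gapCalc hT hs g + gapCalc hT hs g * p = gapCalc hT hs g := by
  obtain ⟨h1, h2⟩ := reflection_conj hp hpT
  have h3 := conj_gapCalc hT hs h1 h2 g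
  rw [hg, map_neg] at h3
  have h4 : (1 - 2 * p) * gapCalc hT hs g = -(gapCalc hT hs g * (1 - 2 * p)) := by
    calc _ = (1 - 2 * p) * gapCalc hT hs g * ((1 - 2 * p) * (1 - 2 * p)) := by rw [h1, mul_one]
      _ = ((1 - 2 * p) * gapCalc hT hs g * (1 - 2 * p)) * (1 - 2 * p) := by noncomm_ring
      _ = _ := by rw [h3]; noncomm_ring
  have h5 : (2 : ℂ) • (p * gapCalc hT hs g + gapCalc hT hs g * p) =
      (2 : ℂ) • gapCalc hT hs g := by
    have e1 : (2 : ℂ) • (p * gapCalc hT hs g + gapCalc hT hs g * p) =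
        gapCalc hT hs g - (1 - 2 * p) * gapCalc hT hs g +
        (gapCalc hT hs g - gapCalc hT hs g * (1 - 2 * p)) := by
      rw [two_smul]; noncomm_ring
    rw [e1, h4, two_smul]; noncomm_ring
  exact smul_right_injective A (two_ne_zero' ℂ) h5

end Parity

/-- The factor `p` is essential: `S` need not be unital, and the functional calculus sends constants
to multiples of `1`. -/
lemma mul_gapCalc_mem {S : NonUnitalStarSubalgebra ℂ A} (hS : IsClosed (S : Set A)) {p : A}
    (hp : p ∈ S) (hTS : T ∈ S) (g : C(gapSet k₀ k₁, ℂ)) : p * gapCalc hT hs g ∈ S := by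
  have hf : g ∈ (Submodule.span ℂ (Set.range fun n : ℕ => gapId k₀ k₁ ^ n)).topologicalClosure := by
    rw [closure_span_gapId_pow]; trivial
  refine closure_minimal (s := (Submodule.span ℂ (Set.range fun n : ℕ => gapId k₀ k₁ ^ n) :
    Set C(gapSet k₀ k₁, ℂ))) (t := {g | p * gapCalc hT hs g ∈ S}) ?_
    (hS.preimage (continuous_const.mul (continuous_gapCalc hT hs))) hf
  intro g hg
  refine Submodule.span_induction (p := fun g _ => p * gapCalc hT hs g ∈ S) ?_ ?_ ?_ ?_ hg
  · rintro _ ⟨n, rfl⟩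
    rw [gapCalc_pow]
    induction n with
    | zero => simpa using hp
    | succ n ih => rw [pow_succ, ← mul_assoc]; exact mul_mem ih hTS
  · simp [zero_mem]
  · intro x y _ _ hx hy; rw [map_add, mul_add]; exact add_mem hx hy
  · intro c x _ hx; rw [map_smul, mul_smul_comm]; exact SMulMemClass.smul_mem c hx

end Calculus

end FreeGraph

end

noncomputable section

/-! ## The relations of the two directed edges over a non-loop -/

namespace FreeGraph

/-- The relations between `p_α`, `p_β` and the creation operators `V`, `W` of the two directed edges
`α → β` and `β → α`. -/
structure EdgeRel {A : Type*} [Ring A] [StarRing A] (p q V W : A) : Prop where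
  isStarProjection_left : IsStarProjection p
  isStarProjection_right : IsStarProjection q
  left_mul_right : p * q = 0
  star_V_mul_V : star V * V = q
  left_mul_V : p * V = V
  V_mul_right : V * q = V
  star_W_mul_W : star W * W = p
  right_mul_W : q * W = W
  W_mul_left : W * p = W

/-- The operator `T_ε` in terms of the creation operators `V` and `W`. -/
def edgeComb {A : Type*} [Ring A] [StarRing A] [Algebra ℂ A] (a : ℝ) (V W : A) : A :=
  (a : ℂ) • V + (a : ℂ)⁻¹ • star W + (a : ℂ)⁻¹ • W + (a : ℂ) • star V

/-- The corner of `T_ε`. -/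
def edgeCorner {A : Type*} [Ring A] [StarRing A] [Algebra ℂ A] (a : ℝ) (V W : A) : A :=
  (a : ℂ) • V + (a : ℂ)⁻¹ • star W

section Algebra

variable {A : Type*} [Ring A] [StarRing A] [Algebra ℂ A] [StarModule ℂ A] {p q V W : A} {a : ℝ}

omit [StarModule ℂ A] in
-- Exchanging the two directions inverts `a` and leaves `T` fixed, so facts about one endpoint
-- transfer to the other.
lemma edgeComb_swap (a : ℝ) (V W : A) : edgeComb a⁻¹ W V = edgeComb a V W := by
  simp only [edgeComb, Complex.ofReal_inv, inv_inv]
  abel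

lemma star_edgeCorner (a : ℝ) (V W : A) :
    star (edgeCorner a V W) = (a : ℂ) • star V + (a : ℂ)⁻¹ • W := by
  simp [edgeCorner, star_smul]

lemma edgeComb_eq (a : ℝ) (V W : A) :
    edgeComb a V W = edgeCorner a V W + star (edgeCorner a V W) := by
  rw [star_edgeCorner, edgeComb, edgeCorner]
  abel

lemma isSelfAdjoint_edgeComb (a : ℝ) (V W : A) : IsSelfAdjoint (edgeComb a V W) := by
  rw [edgeComb_eq]
  exact IsSelfAdjoint.add_star_self _

namespace EdgeRel

variable (h : EdgeRel p q V W)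
include h

omit [StarModule ℂ A] [Algebra ℂ A]

lemma swap : EdgeRel q p W V where
  isStarProjection_left := h.isStarProjection_right
  isStarProjection_right := h.isStarProjection_left
  left_mul_right := by
    have := congrArg star h.left_mul_right
    rwa [star_mul, h.isStarProjection_left.isSelfAdjoint.star_eq,
      h.isStarProjection_right.isSelfAdjoint.star_eq, star_zero] at this
  star_V_mul_V := h.star_W_mul_W
  left_mul_V := h.right_mul_W
  V_mul_right := h.W_mul_left
  star_W_mul_W := h.star_V_mul_V
  right_mul_W := h.left_mul_V
  W_mul_left := h.V_mul_right

lemma right_mul_star_V : q * star V = star V := by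
  have := congrArg star h.V_mul_right
  rwa [star_mul, h.isStarProjection_right.isSelfAdjoint.star_eq] at this

lemma star_V_mul_left : star V * p = star V := by
  have := congrArg star h.left_mul_V
  rwa [star_mul, h.isStarProjection_left.isSelfAdjoint.star_eq] at this

lemma left_mul_star_W : p * star W = star W := h.swap.right_mul_star_V

lemma star_W_mul_right : star W * q = star W := h.swap.star_V_mul_left

lemma isStarProjection_V_mul_star_V : IsStarProjection (V * star V) := by
  refine ⟨?_, by simp [IsSelfAdjoint]⟩
  change V * star V * (V * star V) = V * star V
  rw [mul_assoc, ← mul_assoc (star V), h.star_V_mul_V, h.right_mul_star_V]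

/-- `W W*` is a subprojection of `q`. The difference is the positive defect in the sum-of-squares
identities for the spectral bounds. -/
lemma isStarProjection_right_sub : IsStarProjection (q - W * star W) := by
  have h1 : q * (W * star W) = W * star W := by rw [← mul_assoc, h.right_mul_W]
  have h2 : W * star W * q = W * star W := by rw [mul_assoc, h.star_W_mul_right]
  have h3 := h.swap.isStarProjection_V_mul_star_V
  refine ⟨?_, h.isStarProjection_right.isSelfAdjoint.sub h3.isSelfAdjoint⟩
  change (q - W * star W) * (q - W * star W) = q - W * star W
  rw [sub_mul, mul_sub, mul_sub, h1, h2, h.isStarProjection_right.isIdempotentElem.eq,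
    h3.isIdempotentElem.eq]
  abel

lemma isStarProjection_compl : IsStarProjection (1 - p - q) := by
  have h1 := h.left_mul_right
  have h2 := h.swap.left_mul_right
  refine ⟨?_, ?_⟩
  · change (1 - p - q) * (1 - p - q) = 1 - p - q
    have : (1 - p - q) * (1 - p - q) = 1 - p - p - q - q + p * p + q * q + p * q + q * p := by
      noncomm_ring
    rw [this, h1, h2, h.isStarProjection_left.isIdempotentElem.eq,
      h.isStarProjection_right.isIdempotentElem.eq]
    abel
  · exact ((IsSelfAdjoint.one A).sub h.isStarProjection_left.isSelfAdjoint).sub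
      h.isStarProjection_right.isSelfAdjoint

end EdgeRel

namespace EdgeRel

variable (h : EdgeRel p q V W)
include h

omit [StarModule ℂ A] in
lemma left_mul_corner : p * edgeCorner a V W = edgeCorner a V W := by
  simp [edgeCorner, mul_add, h.left_mul_V, h.left_mul_star_W]

omit [StarModule ℂ A] in
lemma corner_mul_right : edgeCorner a V W * q = edgeCorner a V W := by
  simp [edgeCorner, add_mul, h.V_mul_right, h.star_W_mul_right]

omit [StarModule ℂ A] in
lemma star_corner_mul_left : star (edgeCorner a V W) * p = star (edgeCorner a V W) := by
  have := congrArg star (h.left_mul_corner (a := a))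
  rwa [star_mul, h.isStarProjection_left.isSelfAdjoint.star_eq] at this

omit [StarModule ℂ A] in
lemma right_mul_star_corner : q * star (edgeCorner a V W) = star (edgeCorner a V W) := by
  have := congrArg star (h.corner_mul_right (a := a))
  rwa [star_mul, h.isStarProjection_right.isSelfAdjoint.star_eq] at this

omit [StarModule ℂ A] in
lemma right_mul_corner : q * edgeCorner a V W = 0 := by
  rw [← h.left_mul_corner, ← mul_assoc, h.swap.left_mul_right, zero_mul]

omit [StarModule ℂ A] in
lemma corner_mul_left : edgeCorner a V W * p = 0 := by
  rw [← h.corner_mul_right, mul_assoc, h.swap.left_mul_right, mul_zero]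

omit [StarModule ℂ A] in
lemma left_mul_star_corner : p * star (edgeCorner a V W) = 0 := by
  rw [← h.right_mul_star_corner, ← mul_assoc, h.left_mul_right, zero_mul]

omit [StarModule ℂ A] in
lemma star_corner_mul_right : star (edgeCorner a V W) * q = 0 := by
  rw [← h.star_corner_mul_left, mul_assoc, h.left_mul_right, mul_zero]

lemma left_mul_comb : p * edgeComb a V W = edgeCorner a V W := by
  rw [edgeComb_eq, mul_add, h.left_mul_corner, h.left_mul_star_corner, add_zero]

lemma comb_mul_right : edgeComb a V W * q = edgeCorner a V W := by
  rw [edgeComb_eq, add_mul, h.corner_mul_right, h.star_corner_mul_right, add_zero]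

lemma right_mul_comb : q * edgeComb a V W = star (edgeCorner a V W) := by
  rw [edgeComb_eq, mul_add, h.right_mul_corner, h.right_mul_star_corner, zero_add]

lemma comb_mul_left : edgeComb a V W * p = star (edgeCorner a V W) := by
  rw [edgeComb_eq, add_mul, h.corner_mul_left, h.star_corner_mul_left, zero_add]

lemma left_comb_add : p * edgeComb a V W + edgeComb a V W * p = edgeComb a V W := by
  rw [h.left_mul_comb, h.comb_mul_left, ← edgeComb_eq]

lemma right_comb_add : q * edgeComb a V W + edgeComb a V W * q = edgeComb a V W := by
  rw [h.right_mul_comb, h.comb_mul_right, edgeComb_eq, add_comm]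

/-- The mixed terms `W V` and `V* W*` get coefficient one because the weights `a` and `a⁻¹` cancel;
this is what makes the Jacobi matrix free off the first entry. -/
lemma star_corner_mul_corner (ha : a ≠ 0) : star (edgeCorner a V W) * edgeCorner a V W =
    ((a : ℂ) ^ 2) • q + star V * star W + W * V + ((a : ℂ)⁻¹ ^ 2) • (W * star W) := by
  have ha' : (a : ℂ) ≠ 0 := by exact_mod_cast ha
  rw [star_edgeCorner, edgeCorner]
  simp only [mul_add, add_mul, smul_mul_assoc, mul_smul_comm, h.star_V_mul_V, smul_add]
  rw [smul_smul _ _ (W * V), smul_smul _ _ (star V * star W), mul_inv_cancel₀ ha',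
    inv_mul_cancel₀ ha']
  module

omit [StarModule ℂ A] in
lemma corner_mul_corner : edgeCorner a V W * edgeCorner a V W = 0 := by
  nth_rw 1 [← h.corner_mul_right]
  rw [mul_assoc, h.right_mul_corner, mul_zero]

omit [StarModule ℂ A] in
lemma star_corner_mul_star_corner :
    star (edgeCorner a V W) * star (edgeCorner a V W) = 0 := by
  rw [← star_mul, h.corner_mul_corner, star_zero]

lemma comb_mul_comb : edgeComb a V W * edgeComb a V W =
    star (edgeCorner a V W) * edgeCorner a V W + edgeCorner a V W * star (edgeCorner a V W) := by
  rw [edgeComb_eq, mul_add, add_mul, add_mul, h.corner_mul_corner, h.star_corner_mul_star_corner]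
  abel

omit h in
lemma edgeCorner_swap : edgeCorner a⁻¹ W V = star (edgeCorner a V W) := by
  rw [star_edgeCorner, edgeCorner]; simp [add_comm]

/-- `T² - (a² + a⁻²)` acts as a Jacobi matrix on the words in `W V`. -/
lemma jacobi_zero (ha : a ≠ 0) :
    (edgeComb a V W * edgeComb a V W - ((a : ℂ) ^ 2 + (a : ℂ)⁻¹ ^ 2) • 1) * q =
      W * V - ((a : ℂ)⁻¹ ^ 2) • q + (star V + ((a : ℂ)⁻¹ ^ 2) • W) * star W := by
  have hqq := h.isStarProjection_right.isIdempotentElem.eq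
  rw [h.comb_mul_comb, sub_mul, add_mul, mul_assoc (edgeCorner a V W), h.star_corner_mul_right,
    mul_assoc, h.corner_mul_right, h.star_corner_mul_corner ha, smul_mul_assoc, one_mul, mul_zero,
    add_mul, smul_mul_assoc]
  module

/-- On a word of positive length `W*` strips a letter instead of killing it: the term `a⁻² W W*`
restores the word and cancels the perturbation `-a⁻² q`, while `V* W*` shortens the word by one
factor `W V`. -/
lemma jacobi_succ (ha : a ≠ 0) (n : ℕ) :
    (edgeComb a V W * edgeComb a V W - ((a : ℂ) ^ 2 + (a : ℂ)⁻¹ ^ 2) • 1) * ((W * V) ^ (n + 1) * q) =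
      (W * V) ^ (n + 2) * q + (W * V) ^ n * q := by
  have h1 : q * ((W * V) ^ (n + 1) * q) = (W * V) ^ (n + 1) * q := by
    rw [pow_succ', ← mul_assoc, ← mul_assoc, ← mul_assoc, h.right_mul_W]
  have h4 : ∀ m, q * ((W * V) ^ m * q) = (W * V) ^ m * q := by
    intro m
    cases m with
    | zero => simpa using h.isStarProjection_right.isIdempotentElem.eq
    | succ m => rw [pow_succ', ← mul_assoc, ← mul_assoc, ← mul_assoc, h.right_mul_W]
  have h2 : star W * ((W * V) ^ (n + 1) * q) = V * ((W * V) ^ n * q) := by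
    rw [pow_succ', mul_assoc (W * V), mul_assoc W V, ← mul_assoc (star W), h.star_W_mul_W,
      ← mul_assoc p, h.left_mul_V]
  have h3 : star V * (V * ((W * V) ^ n * q)) = (W * V) ^ n * q := by
    rw [← mul_assoc, h.star_V_mul_V, h4]
  rw [← h1, ← mul_assoc, h.jacobi_zero ha, add_mul, sub_mul, mul_assoc _ (star W), h2, add_mul, h3,
    smul_mul_assoc, smul_mul_assoc, h1, pow_succ' _ (n + 1), mul_assoc (W * V)]
  rw [pow_succ' _ n]
  simp only [mul_assoc]
  module

end EdgeRel

end Algebra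

/-! ### The spectrum of `T_ε`. -/

section Spectrum

variable {A : Type*} [CStarAlgebra A] {p q V W : A} {a : ℝ}

section Order

variable [PartialOrder A] [StarOrderedRing A]

lemma EdgeRel.star_corner_mul_corner_sub_nonneg (h : EdgeRel p q V W) (ha : 1 ≤ a) :
    0 ≤ star (edgeCorner a V W) * edgeCorner a V W - (((a - a⁻¹) ^ 2 : ℝ) : ℂ) • q := by
  have ha0 : a ≠ 0 := by positivity
  have ha' : (a : ℂ) ≠ 0 := by exact_mod_cast ha0
  -- The square `|V + W*|²` is chosen to reproduce the mixed terms `W V + V* W*`. What remains is a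
  -- multiple of `q - W W*`, with a coefficient that is nonnegative exactly because `a ≥ 1`.
  have h1 : star (edgeCorner a V W) * edgeCorner a V W - (((a - a⁻¹) ^ 2 : ℝ) : ℂ) • q =
      star (V + star W) * (V + star W) + ((1 - a⁻¹ ^ 2 : ℝ) : ℂ) • (q - W * star W) := by
    rw [h.star_corner_mul_corner ha0, star_add, star_star, mul_add, add_mul, add_mul,
      h.star_V_mul_V, smul_sub]
    have e : (((a - a⁻¹) ^ 2 : ℝ) : ℂ) = (a : ℂ) ^ 2 - 2 + (a : ℂ)⁻¹ ^ 2 := by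
      push_cast; field_simp; ring
    rw [e]
    push_cast
    module
  rw [h1]
  refine add_nonneg (star_mul_self_nonneg _) (smul_nonneg ?_ h.isStarProjection_right_sub.nonneg)
  rw [Complex.zero_le_real, sub_nonneg]
  exact pow_le_one₀ (by positivity) (inv_le_one_of_one_le₀ ha)

lemma EdgeRel.sub_star_corner_mul_corner_nonneg (h : EdgeRel p q V W) (ha : a ≠ 0) :
    0 ≤ (((a + a⁻¹) ^ 2 : ℝ) : ℂ) • q - star (edgeCorner a V W) * edgeCorner a V W := by
  have ha' : (a : ℂ) ≠ 0 := by exact_mod_cast ha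
  -- The opposite sign in `|V - W*|²` matches the mixed terms; here the coefficient of the defect is
  -- positive for every `a`.
  have h1 : (((a + a⁻¹) ^ 2 : ℝ) : ℂ) • q - star (edgeCorner a V W) * edgeCorner a V W =
      star (V - star W) * (V - star W) + ((1 + a⁻¹ ^ 2 : ℝ) : ℂ) • (q - W * star W) := by
    rw [h.star_corner_mul_corner ha, star_sub, star_star, mul_sub, sub_mul, sub_mul,
      h.star_V_mul_V, smul_sub]
    have e : (((a + a⁻¹) ^ 2 : ℝ) : ℂ) = (a : ℂ) ^ 2 + 2 + (a : ℂ)⁻¹ ^ 2 := by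
      push_cast; field_simp; ring
    rw [e]
    push_cast
    module
  rw [h1]
  refine add_nonneg (star_mul_self_nonneg _) (smul_nonneg ?_ h.isStarProjection_right_sub.nonneg)
  rw [Complex.zero_le_real]
  positivity

/-- `T²` is block diagonal with blocks `X*X` under `q`, `XX*` under `p`, and `0` elsewhere. The
bound `(a + a⁻¹)²` is invariant under `a ↦ a⁻¹`, so the same estimate serves both blocks. -/
lemma EdgeRel.comb_sq_le (h : EdgeRel p q V W) (ha : a ≠ 0) :
    0 ≤ (((a + a⁻¹) ^ 2 : ℝ) : ℂ) • 1 - edgeComb a V W ^ 2 := by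
  have h1 := h.sub_star_corner_mul_corner_nonneg ha
  have h2 := h.swap.sub_star_corner_mul_corner_nonneg (inv_ne_zero ha)
  rw [EdgeRel.edgeCorner_swap, star_star, inv_inv, add_comm a⁻¹] at h2
  have h3 : 0 ≤ (((a + a⁻¹) ^ 2 : ℝ) : ℂ) • (1 - p - q) :=
    smul_nonneg (by rw [Complex.zero_le_real]; positivity) h.isStarProjection_compl.nonneg
  have h4 := add_nonneg (add_nonneg h1 h2) h3
  rw [sq (edgeComb a V W), h.comb_mul_comb]
  convert h4 using 1
  module

/-- A lower bound for `T²` itself is available only under `q`, since `XX*` may have a kernel under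
`p`. Multiplied by `T²` the bound does transfer: with `m = (a - a⁻¹)²` and `n = X*X - mq ≥ 0`, one
has `T⁴ - mT² = X n X* + n² + m n`. -/
lemma EdgeRel.comb_sq_gap (h : EdgeRel p q V W) (ha : 1 ≤ a) :
    0 ≤ edgeComb a V W ^ 4 - (((a - a⁻¹) ^ 2 : ℝ) : ℂ) • edgeComb a V W ^ 2 := by
  have hn := h.star_corner_mul_corner_sub_nonneg ha
  set X := edgeCorner a V W with hX
  set m : ℂ := (((a - a⁻¹) ^ 2 : ℝ) : ℂ) with hm
  set n := star X * X - m • q with hnn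
  have hm0 : 0 ≤ m := by rw [hm, Complex.zero_le_real]; positivity
  have hXX : X * X = 0 := h.corner_mul_corner
  have hXX' : star X * star X = 0 := h.star_corner_mul_star_corner
  have hqX : q * star X = star X := h.right_mul_star_corner
  have hXq : X * q = X := h.corner_mul_right
  have hqq := h.isStarProjection_right.isIdempotentElem.eq
  have h1 : 0 ≤ X * n * star X := star_right_conjugate_nonneg hn X
  have h2 : 0 ≤ n * n := by
    have := star_mul_self_nonneg n
    rwa [(IsSelfAdjoint.of_nonneg hn).star_eq] at this
  have h3 : 0 ≤ m • n := smul_nonneg hm0 hn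
  have h4 := add_nonneg (add_nonneg h1 h2) h3
  have e2 : edgeComb a V W ^ 2 = star X * X + X * star X := by rw [sq, h.comb_mul_comb]
  have e4 : edgeComb a V W ^ 4 =
      star X * X * (star X * X) + X * star X * (X * star X) := by
    rw [show 4 = 2 * 2 by norm_num, pow_mul, e2, sq, add_mul, mul_add, mul_add,
      mul_assoc (star X) X (X * star X), ← mul_assoc X X, hXX, zero_mul, mul_zero,
      mul_assoc X (star X) (star X * X), ← mul_assoc (star X) (star X), hXX', zero_mul, mul_zero]
    abel
  have f1 : X * n * star X = X * star X * (X * star X) - m • (X * star X) := by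
    rw [hnn, mul_sub, sub_mul, mul_smul_comm, smul_mul_assoc, hXq]
    simp only [mul_assoc]
  have f2 : n * n = star X * X * (star X * X) - m • (star X * X) - m • (star X * X)
      + (m * m) • q := by
    rw [hnn, mul_sub, sub_mul, sub_mul, mul_smul_comm, smul_mul_assoc, smul_mul_assoc,
      mul_smul_comm, hqq, mul_assoc (star X) X q, hXq, ← mul_assoc q, hqX, smul_smul]
    abel
  rw [e2, e4]
  convert h4 using 1
  rw [f1, f2, hnn]
  module

end Order

open Polynomial in
-- Spectral mapping turns the two operator inequalities into inequalities for real spectral values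
-- `z`: `z² ≤ (a + a⁻¹)²`, and `z⁴ ≥ (a - a⁻¹)² z²`, which allows `z = 0` and otherwise gives the
-- gap.
lemma EdgeRel.spectrum_comb (h : EdgeRel p q V W) (ha : 1 ≤ a) :
    spectrum ℂ (edgeComb a V W) ⊆ gapSet (a - a⁻¹) (a + a⁻¹) := by
  let _ := CStarAlgebra.spectralOrder A
  have _ := CStarAlgebra.spectralOrderedRing A
  intro z hz
  have ha0 : a ≠ 0 := by positivity
  have hsa := isSelfAdjoint_edgeComb a V W
  have hzr : z = (z.re : ℂ) := hsa.mem_spectrum_eq_re hz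
  have hinv : a⁻¹ ≤ 1 := inv_le_one_of_one_le₀ ha
  have hinv0 : 0 ≤ a⁻¹ := by positivity
  have k1 : ((a + a⁻¹) ^ 2 - z.re ^ 2) ≥ 0 := by
    have h1 := spectrum.subset_polynomial_aeval (edgeComb a V W)
      (C (((a + a⁻¹) ^ 2 : ℝ) : ℂ) - X ^ 2) ⟨z, hz, rfl⟩
    simp only [eval_sub, eval_C, eval_pow, eval_X, map_sub, aeval_C, map_pow, aeval_X,
      Algebra.algebraMap_eq_smul_one] at h1
    have h2 := spectrum_nonneg_of_nonneg (h.comb_sq_le ha0) h1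
    rw [hzr, ← Complex.ofReal_pow, ← Complex.ofReal_sub, Complex.zero_le_real] at h2
    exact h2
  have k2 : z.re ^ 4 - (a - a⁻¹) ^ 2 * z.re ^ 2 ≥ 0 := by
    have h1 := spectrum.subset_polynomial_aeval (edgeComb a V W)
      (X ^ 4 - (((a - a⁻¹) ^ 2 : ℝ) : ℂ) • X ^ 2) ⟨z, hz, rfl⟩
    simp only [eval_sub, eval_smul, eval_pow, eval_X, map_sub, map_smul, map_pow, aeval_X,
      smul_eq_mul] at h1
    have h2 := spectrum_nonneg_of_nonneg (h.comb_sq_gap ha) h1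
    rw [hzr, ← Complex.ofReal_pow, ← Complex.ofReal_pow, ← Complex.ofReal_mul,
      ← Complex.ofReal_sub, Complex.zero_le_real] at h2
    exact h2
  refine ⟨hsa.im_eq_zero_of_mem_spectrum hz, ?_, ?_⟩
  · by_cases hz0 : z.re = 0
    · exact Or.inl hz0
    · right
      have h3 : 0 < z.re ^ 2 := by positivity
      have h4 : (a - a⁻¹) ^ 2 ≤ z.re ^ 2 := by nlinarith
      rw [← abs_of_nonneg (show 0 ≤ a - a⁻¹ by linarith)]
      exact sq_le_sq.1 h4
  · rw [← abs_of_nonneg (show 0 ≤ a + a⁻¹ by linarith)]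
    exact sq_le_sq.1 (by linarith)

end Spectrum

end FreeGraph

end

noncomputable section

/-! ## The vacuum distributions of `T_ε` -/

namespace FreeGraph

section Points

/-- The integral over `[0, 1]` along a path in a compact space, as a functional. -/
def pathIntegral {K : Type*} [TopologicalSpace K] [CompactSpace K] (r : C(unitInterval, K)) :
    C(K, ℂ) →L[ℂ] ℂ :=
  LinearMap.mkContinuous
    { toFun := fun g => ∫ s, g (r s)
      map_add' := fun g g' => integral_add
        ((g.comp r).continuous.integrable_of_hasCompactSupport (HasCompactSupport.of_compactSpace _))
        ((g'.comp r).continuous.integrable_of_hasCompactSupport (HasCompactSupport.of_compactSpace _))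
      map_smul' := fun c g => integral_const_mul c _ } 1 fun g => by
    have := norm_integral_le_of_norm_le_const (μ := (volume : Measure unitInterval))
      (f := fun s => g (r s)) (C := ‖g‖) (ae_of_all _ fun s => g.norm_coe_le_norm _)
    simpa using this

/-- `0` as a point of the gap set. -/
def gapZero {k₀ k₁ : ℝ} (hk : 0 ≤ k₁) : gapSet k₀ k₁ := ⟨0, by simp [gapSet, hk]⟩

variable {a : ℝ}

lemma inv_sq_mem (ha : 1 ≤ a) : 0 ≤ a⁻¹ ^ 2 ∧ a⁻¹ ^ 2 ≤ 1 :=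
  ⟨by positivity, pow_le_one₀ (by positivity) (inv_le_one_of_one_le₀ ha)⟩

lemma gap_sq_lower (ha : 1 ≤ a) (x : ℝ) (hx : x ≤ 1) :
    (a - a⁻¹) ^ 2 ≤ a ^ 2 + a⁻¹ ^ 2 - 2 * x := by
  have : a * a⁻¹ = 1 := mul_inv_cancel₀ (by positivity)
  nlinarith

lemma gap_sq_upper (ha : 1 ≤ a) (x : ℝ) (hx : -1 ≤ x) :
    a ^ 2 + a⁻¹ ^ 2 - 2 * x ≤ (a + a⁻¹) ^ 2 := by
  have : a * a⁻¹ = 1 := mul_inv_cancel₀ (by positivity)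
  nlinarith

lemma gap_nonneg (ha : 1 ≤ a) : 0 ≤ a - a⁻¹ := by
  have := inv_le_one_of_one_le₀ ha
  linarith

lemma top_nonneg (ha : 1 ≤ a) : 0 ≤ a + a⁻¹ := by positivity

/-- The distribution function for the weight `b = a⁻²`. -/
abbrev edgeCdf (ha : 1 ≤ a) : Set.Icc 0 Real.pi ≃ₜ unitInterval :=
  cdfHomeo (inv_sq_mem ha).1 (inv_sq_mem ha).2

/-- The positive part of the spectrum of `T_ε`, parametrized by the distribution function. -/
def edgeRadReal (ha : 1 ≤ a) (s : unitInterval) : ℝ :=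
  Real.sqrt (a ^ 2 + a⁻¹ ^ 2 - 2 * Real.cos ((edgeCdf ha).symm s))

lemma edgeRadReal_nonneg (ha : 1 ≤ a) (s : unitInterval) : 0 ≤ edgeRadReal ha s :=
  Real.sqrt_nonneg _

lemma edgeRadReal_sq (ha : 1 ≤ a) (s : unitInterval) :
    edgeRadReal ha s ^ 2 = a ^ 2 + a⁻¹ ^ 2 - 2 * Real.cos ((edgeCdf ha).symm s) :=
  Real.sq_sqrt ((sq_nonneg _).trans (gap_sq_lower ha _ (Real.cos_le_one _)))

lemma le_edgeRadReal (ha : 1 ≤ a) (s : unitInterval) : a - a⁻¹ ≤ edgeRadReal ha s :=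
  Real.le_sqrt_of_sq_le (gap_sq_lower ha _ (Real.cos_le_one _))

lemma edgeRadReal_le (ha : 1 ≤ a) (s : unitInterval) : edgeRadReal ha s ≤ a + a⁻¹ :=
  Real.sqrt_le_iff.2 ⟨by positivity, gap_sq_upper ha _ (Real.neg_one_le_cos _)⟩

/-- The positive part of the spectrum of `T_ε` as a path in the gap set. -/
def edgeRad (ha : 1 ≤ a) : C(unitInterval, gapSet (a - a⁻¹) (a + a⁻¹)) where
  toFun s := ⟨(edgeRadReal ha s : ℂ), by
    have h0 := edgeRadReal_nonneg ha s
    refine ⟨Complex.ofReal_im _, Or.inr ?_, ?_⟩ <;> rw [Complex.ofReal_re, abs_of_nonneg h0]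
    · exact le_edgeRadReal ha s
    · exact edgeRadReal_le ha s⟩
  continuous_toFun := by
    refine Continuous.subtype_mk ?_ _
    unfold edgeRadReal
    have h1 : Continuous fun s => ((edgeCdf ha).symm s : ℝ) :=
      continuous_subtype_val.comp (edgeCdf ha).symm.continuous
    exact Complex.continuous_ofReal.comp (Real.continuous_sqrt.comp
      (continuous_const.sub (continuous_const.mul (Real.continuous_cos.comp h1))))

lemma coe_edgeRad (ha : 1 ≤ a) (s : unitInterval) : (edgeRad ha s : ℂ) = edgeRadReal ha s := rfl

/-- The inverse parametrization. -/
def edgeParam (ha : 1 ≤ a) : C(gapSet (a - a⁻¹) (a + a⁻¹), unitInterval) where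
  toFun z := edgeCdf ha ⟨Real.arccos ((a ^ 2 + a⁻¹ ^ 2 - (z : ℂ).re ^ 2) / 2),
    Real.arccos_nonneg _, Real.arccos_le_pi _⟩
  continuous_toFun := by
    refine (edgeCdf ha).continuous.comp (Continuous.subtype_mk (Real.continuous_arccos.comp ?_) _)
    have : Continuous fun z : gapSet (a - a⁻¹) (a + a⁻¹) => (z : ℂ).re :=
      Complex.continuous_re.comp continuous_subtype_val
    fun_prop

lemma edgeParam_neg (ha : 1 ≤ a) (z) : edgeParam ha (gapNeg _ _ z) = edgeParam ha z := by
  simp [edgeParam, coe_gapNeg]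

lemma edgeParam_edgeRad (ha : 1 ≤ a) (s : unitInterval) : edgeParam ha (edgeRad ha s) = s := by
  have h1 : (a ^ 2 + a⁻¹ ^ 2 - (edgeRad ha s : ℂ).re ^ 2) / 2 =
      Real.cos ((edgeCdf ha).symm s) := by
    rw [coe_edgeRad, Complex.ofReal_re, edgeRadReal_sq]; ring
  change edgeCdf ha ⟨Real.arccos _, _⟩ = s
  have h2 : (⟨Real.arccos ((a ^ 2 + a⁻¹ ^ 2 - (edgeRad ha s : ℂ).re ^ 2) / 2),
      Real.arccos_nonneg _, Real.arccos_le_pi _⟩ : Set.Icc 0 Real.pi) = (edgeCdf ha).symm s := by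
    refine Subtype.ext ?_
    change Real.arccos _ = _
    rw [h1, Real.arccos_cos ((edgeCdf ha).symm s).2.1 ((edgeCdf ha).symm s).2.2]
  rw [h2, Homeomorph.apply_symm_apply]

/-- The assumption `hz` is needed because at an isolated `0` the argument of `Real.arccos` exceeds
one and is truncated, so the parameter no longer recovers the point. -/
lemma edgeRadReal_edgeParam (ha : 1 ≤ a) (z : gapSet (a - a⁻¹) (a + a⁻¹))
    (hz : a - a⁻¹ ≤ |(z : ℂ).re|) : edgeRadReal ha (edgeParam ha z) = |(z : ℂ).re| := by
  have h1 : (a - a⁻¹) ^ 2 ≤ (z : ℂ).re ^ 2 := by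
    rw [← sq_abs (z : ℂ).re]; exact pow_le_pow_left₀ (gap_nonneg ha) hz 2
  have h2 : (z : ℂ).re ^ 2 ≤ (a + a⁻¹) ^ 2 := by
    rw [← sq_abs (z : ℂ).re]; exact pow_le_pow_left₀ (abs_nonneg _) z.2.2.2 2
  have h3 : a * a⁻¹ = 1 := mul_inv_cancel₀ (by positivity)
  have h4 : (edgeCdf ha).symm (edgeParam ha z) =
      ⟨Real.arccos ((a ^ 2 + a⁻¹ ^ 2 - (z : ℂ).re ^ 2) / 2),
        Real.arccos_nonneg _, Real.arccos_le_pi _⟩ := Homeomorph.symm_apply_apply _ _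
  have h5 : edgeRadReal ha (edgeParam ha z) = Real.sqrt ((z : ℂ).re ^ 2) := by
    unfold edgeRadReal
    rw [h4]
    change Real.sqrt (_ - 2 * Real.cos (Real.arccos _)) = _
    rw [Real.cos_arccos (by nlinarith) (by nlinarith)]
    congr 1; ring
  rw [h5, Real.sqrt_sq_eq_abs]

/-- The variable `-2 cos φ` is the spectral parameter of `T² - (a² + a⁻²)`, so an even power of `T`
is a power of the shifted variable. -/
lemma integral_edgeRad_pow (ha : 1 ≤ a) (k : ℕ) :
    ∫ s, ((edgeRad ha s : ℂ)) ^ (2 * k) = ∫ φ in 0..Real.pi, jacobiDensity (a⁻¹ ^ 2) φ •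
      (((Polynomial.X + Polynomial.C ((a : ℂ) ^ 2 + (a : ℂ)⁻¹ ^ 2)) ^ k).eval
        (-2 * Real.cos φ : ℂ)) := by
  have h := integral_unitInterval_eq (inv_sq_mem ha).1 (inv_sq_mem ha).2
    (((gapId (a - a⁻¹) (a + a⁻¹)) ^ (2 * k)).comp (edgeRad ha))
  refine h.trans (intervalIntegral.integral_congr fun φ hφ => ?_)
  rw [Set.uIcc_of_le Real.pi_pos.le] at hφ
  simp only [ContinuousMap.comp_apply, ContinuousMap.pow_apply, gapId_apply, coe_edgeRad]
  congr 1
  rw [pow_mul, ← Complex.ofReal_pow, edgeRadReal_sq, Homeomorph.symm_apply_apply,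
    Set.projIcc_of_mem _ hφ]
  simp only [Polynomial.eval_pow, Polynomial.eval_add, Polynomial.eval_X, Polynomial.eval_C]
  congr 1
  push_cast
  ring

/-- The spectrum of `T_ε` for a loop, parametrized by the distribution function. -/
def loopPoint : C(unitInterval, gapSet 0 2) where
  toFun s := ⟨((-2 * Real.cos ((cdfHomeo le_rfl zero_le_one).symm s) : ℝ) : ℂ), by
    refine ⟨Complex.ofReal_im _, Or.inr (abs_nonneg _), ?_⟩
    rw [Complex.ofReal_re, abs_mul]
    have := Real.abs_cos_le_one ((cdfHomeo le_rfl zero_le_one).symm s)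
    norm_num
    linarith⟩
  continuous_toFun := by
    refine Continuous.subtype_mk ?_ _
    have h1 : Continuous fun s => ((cdfHomeo (le_refl (0 : ℝ)) zero_le_one).symm s : ℝ) :=
      continuous_subtype_val.comp (Homeomorph.continuous _)
    exact Complex.continuous_ofReal.comp (continuous_const.mul (Real.continuous_cos.comp h1))

lemma coe_loopPoint (s : unitInterval) : (loopPoint s : ℂ) =
    ((-2 * Real.cos ((cdfHomeo le_rfl zero_le_one).symm s) : ℝ) : ℂ) := rfl

/-- The inverse parametrization. -/
def loopParam : C(gapSet 0 2, unitInterval) where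
  toFun z := cdfHomeo (le_refl (0 : ℝ)) zero_le_one ⟨Real.arccos (-(z : ℂ).re / 2),
    Real.arccos_nonneg _, Real.arccos_le_pi _⟩
  continuous_toFun := by
    refine (Homeomorph.continuous _).comp
      (Continuous.subtype_mk (Real.continuous_arccos.comp ?_) _)
    have : Continuous fun z : gapSet 0 2 => (z : ℂ).re :=
      Complex.continuous_re.comp continuous_subtype_val
    fun_prop

lemma loopParam_loopPoint (s : unitInterval) : loopParam (loopPoint s) = s := by
  have h1 : -(loopPoint s : ℂ).re / 2 =
      Real.cos ((cdfHomeo (le_refl (0 : ℝ)) zero_le_one).symm s) := by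
    rw [coe_loopPoint, Complex.ofReal_re]; ring
  have h2 : (⟨Real.arccos (-(loopPoint s : ℂ).re / 2),
      Real.arccos_nonneg _, Real.arccos_le_pi _⟩ : Set.Icc 0 Real.pi) =
      (cdfHomeo (le_refl (0 : ℝ)) zero_le_one).symm s := by
    refine Subtype.ext ?_
    change Real.arccos _ = _
    have hm := ((cdfHomeo (le_refl (0 : ℝ)) zero_le_one).symm s).2
    rw [h1, Real.arccos_cos hm.1 hm.2]
  change cdfHomeo (le_refl (0 : ℝ)) zero_le_one ⟨Real.arccos _, _⟩ = s
  rw [h2, Homeomorph.apply_symm_apply]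

lemma loopPoint_loopParam (z : gapSet 0 2) : loopPoint (loopParam z) = z := by
  have h3 := abs_le.1 z.2.2.2
  have h4 : (cdfHomeo (le_refl (0 : ℝ)) zero_le_one).symm (loopParam z) =
      ⟨Real.arccos (-(z : ℂ).re / 2), Real.arccos_nonneg _, Real.arccos_le_pi _⟩ :=
    Homeomorph.symm_apply_apply _ _
  refine Subtype.ext ?_
  rw [coe_loopPoint, h4]
  change ((-2 * Real.cos (Real.arccos _) : ℝ) : ℂ) = z
  rw [Real.cos_arccos (by linarith) (by linarith), gapSet_eq_re z]
  congr 1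
  rw [Complex.ofReal_re]; ring

lemma integral_loopPoint_pow (n : ℕ) :
    ∫ s, ((loopPoint s : ℂ)) ^ n = ∫ φ in 0..Real.pi, jacobiDensity 0 φ •
      ((Polynomial.X ^ n : Polynomial ℂ).eval (-2 * Real.cos φ : ℂ)) := by
  have h := integral_unitInterval_eq le_rfl zero_le_one
    (((gapId 0 2) ^ n).comp loopPoint)
  refine h.trans (intervalIntegral.integral_congr fun φ hφ => ?_)
  rw [Set.uIcc_of_le Real.pi_pos.le] at hφ
  simp only [ContinuousMap.comp_apply, ContinuousMap.pow_apply, gapId_apply, coe_loopPoint]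
  rw [Homeomorph.symm_apply_apply, Set.projIcc_of_mem _ hφ]
  simp

end Points

end FreeGraph

end

noncomputable section

namespace FreeGraph

/-! ### Moments of `T_ε` in the vacuum states. -/

section Law

variable {V E : Type*} {Λ : Graph V E} [TopologicalSpace V] [DiscreteTopology V]

variable (Λ) in
/-- The action on the Fock space as an algebra homomorphism. -/
def actHom : FockOp Λ →ₐ[ℂ] Module.End ℂ (Fock Λ) where
  toFun x := (x.1 : Fock Λ →ₗ[ℂ] Fock Λ)
  map_one' := rfl
  map_mul' _ _ := rfl
  map_zero' := rfl
  map_add' _ _ := rfl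
  commutes' _ := rfl

lemma actHom_apply (x : FockOp Λ) (f : Fock Λ) : actHom Λ x f = x.1 f := rfl

lemma coord_aeval (v : Λ.vertexSet) (y : FockOp Λ) (p : Polynomial ℂ) :
    coord v (PathTo.nil v) (Polynomial.aeval (actHom Λ y) p (vacuum v)) =
      vacState v (Polynomial.aeval y p) := by
  rw [Polynomial.aeval_algHom_apply]
  rfl

lemma vproj_vacuum (v : Λ.vertexSet) : (vproj v).1 (vacuum v) = vacuum v := by
  rw [leftHom_vacuum, vertexProj_apply, if_pos rfl, one_smul]

lemma vacState_vproj_mul_mul_vproj (v : Λ.vertexSet) (x : FockOp Λ) :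
    vacState v (vproj v * x * vproj v) = vacState v x := by
  rw [vacState_mul_leftHom, vacState_leftHom_mul, vertexProj_apply, if_pos rfl, one_mul, one_mul]

lemma vacState_vproj_mul (v : Λ.vertexSet) (x : FockOp Λ) :
    vacState v (vproj v * x) = vacState v x := by
  rw [vacState_leftHom_mul, vertexProj_apply, if_pos rfl, one_mul]

lemma vacState_vproj_mul_of_ne {v w : Λ.vertexSet} (h : v ≠ w) (x : FockOp Λ) :
    vacState v (vproj w * x) = 0 := by
  rw [vacState_leftHom_mul, vertexProj_apply, if_neg h, zero_mul]

lemma vacState_mul_vproj_of_ne {v w : Λ.vertexSet} (h : v ≠ w) (x : FockOp Λ) :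
    vacState v (x * vproj w) = 0 := by
  rw [vacState_mul_leftHom, vertexProj_apply, if_neg h, zero_mul]

lemma edgeRel_create {d : DirEdge Λ} (hd : d.src ≠ d.tgt) :
    EdgeRel (vproj d.src) (vproj d.tgt) (create d) (create d.op) where
  isStarProjection_left := isStarProjection_vproj _
  isStarProjection_right := isStarProjection_vproj _
  left_mul_right := vproj_mul_vproj_of_ne hd
  star_V_mul_V := star_create_mul_create d
  left_mul_V := vproj_mul_create d
  V_mul_right := create_mul_vproj d
  star_W_mul_W := star_create_mul_create d.op
  right_mul_W := vproj_mul_create d.op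
  W_mul_left := create_mul_vproj d.op

section Edge

variable {α β : Λ.vertexSet} {X : FockOp Λ} {e : DirEdge Λ} {a : ℝ}

/-- The words in `W V` applied to the vacuum. -/
def edgeWord (β : Λ.vertexSet) (X W : FockOp Λ) (n : ℕ) : Fock Λ :=
  ((W * X) ^ n * vproj β).1 (vacuum β)

lemma edgeWord_zero (β : Λ.vertexSet) (X W : FockOp Λ) : edgeWord β X W 0 = vacuum β := by
  rw [edgeWord, pow_zero, one_mul, vproj_vacuum]

lemma coord_edgeWord_zero (β : Λ.vertexSet) (X W : FockOp Λ) :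
    coord β (PathTo.nil β) (edgeWord β X W 0) = 1 := by
  rw [edgeWord_zero, coord_nil_vacuum]

/-- A nonempty word begins with a creation operator, whose range has no component on the path of
length zero. -/
lemma coord_edgeWord_succ (β : Λ.vertexSet) (X : FockOp Λ) (e : DirEdge Λ) (n : ℕ) :
    coord β (PathTo.nil β) (edgeWord β X (create e) (n + 1)) = 0 := by
  rw [edgeWord, pow_succ', mul_assoc, mul_assoc]
  exact coord_nil_create _ _ _

/-- `T² - (a² + a⁻²)`. -/
def edgeJacobi (a : ℝ) (X W : FockOp Λ) : FockOp Λ :=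
  edgeComb a X W * edgeComb a X W - ((a : ℂ) ^ 2 + (a : ℂ)⁻¹ ^ 2) • 1

lemma edgeWord_one (h : EdgeRel (vproj α) (vproj β) X (create e)) :
    edgeWord β X (create e) 1 = (create e * X).1 (vacuum β) := by
  rw [edgeWord, pow_one, mul_assoc, h.V_mul_right]

/-- A term ending in an annihilation operator disappears on the vacuum, which turns the operator
identity for the corner into the first row of a Jacobi matrix. -/
lemma apply_vacuum_of_eq {M J R : FockOp Λ} {c : ℂ}
    (h : J * vproj β = R - c • vproj β + M * star (create e)) :
    J.1 (vacuum β) = R.1 (vacuum β) - c • vacuum β := by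
  have h1 := congrArg (fun x : FockOp Λ => x.1 (vacuum β)) h
  simpa only [fockOp_add_apply, fockOp_sub_apply, fockOp_smul_apply, fockOp_mul_apply,
    vproj_vacuum, star_create_vacuum, map_zero, add_zero] using h1

lemma edgeJacobi_mul_vproj (h : EdgeRel (vproj α) (vproj β) X (create e)) (ha : a ≠ 0) :
    edgeJacobi a X (create e) * vproj β = create e * X - ((a : ℂ)⁻¹ ^ 2) • vproj β +
      (star X + ((a : ℂ)⁻¹ ^ 2) • create e) * star (create e) := h.jacobi_zero ha

lemma edgeJacobi_word_zero (h : EdgeRel (vproj α) (vproj β) X (create e)) (ha : a ≠ 0) :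
    actHom Λ (edgeJacobi a X (create e)) (edgeWord β X (create e) 0) =
      edgeWord β X (create e) 1 - ((a⁻¹ ^ 2 : ℝ) : ℂ) • edgeWord β X (create e) 0 := by
  rw [edgeWord_one h, edgeWord_zero, actHom_apply, Complex.ofReal_pow, Complex.ofReal_inv]
  exact apply_vacuum_of_eq (edgeJacobi_mul_vproj h ha)

lemma edgeJacobi_word_succ (h : EdgeRel (vproj α) (vproj β) X (create e)) (ha : a ≠ 0) (n : ℕ) :
    actHom Λ (edgeJacobi a X (create e)) (edgeWord β X (create e) (n + 1)) =
      edgeWord β X (create e) (n + 2) + edgeWord β X (create e) n :=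
  congrArg (fun x : FockOp Λ => x.1 (vacuum β)) (h.jacobi_succ ha n)

open Polynomial in
lemma aeval_edgeJacobi (a : ℝ) (X W : FockOp Λ) (k : ℕ) :
    aeval (edgeJacobi a X W) ((Polynomial.X + C ((a : ℂ) ^ 2 + (a : ℂ)⁻¹ ^ 2)) ^ k) =
      edgeComb a X W ^ (2 * k) := by
  rw [map_pow, map_add, aeval_X, aeval_C, Algebra.algebraMap_eq_smul_one, edgeJacobi,
    sub_add_cancel, pow_mul, sq]

lemma vacState_pow_even (h : EdgeRel (vproj α) (vproj β) X (create e)) (ha : 1 ≤ a) (k : ℕ) :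
    vacState β (edgeComb a X (create e) ^ (2 * k)) = ∫ s, (edgeRad ha s : ℂ) ^ (2 * k) := by
  have ha0 : a ≠ 0 := by positivity
  rw [integral_edgeRad_pow, ← aeval_edgeJacobi, ← coord_aeval, ← edgeWord_zero β X (create e)]
  exact jacobi_law (inv_sq_mem ha).1 (inv_sq_mem ha).2 (edgeJacobi_word_zero h ha0)
    (edgeJacobi_word_succ h ha0) (coord_edgeWord_zero _ _ _) (coord_edgeWord_succ _ _ _) _

lemma vacState_pow_even' (h : EdgeRel (vproj α) (vproj β) X (create e)) (ha : 1 ≤ a) (k : ℕ) :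
    vacState β (edgeComb a⁻¹ X (create e) ^ (2 * k)) =
      ((1 - (a⁻¹ ^ 2) ^ 2 : ℝ) : ℂ) * 0 ^ (2 * k) +
      (((a⁻¹ ^ 2) ^ 2 : ℝ) : ℂ) * ∫ s, (edgeRad ha s : ℂ) ^ (2 * k) := by
  have ha0 : a⁻¹ ≠ 0 := by positivity
  have hb : 0 < a⁻¹ ^ 2 := by positivity
  rw [integral_edgeRad_pow, ← aeval_edgeJacobi, ← coord_aeval, ← edgeWord_zero β X (create e)]
  have h0 := edgeJacobi_word_zero h ha0
  -- With `a⁻¹` in place of `a` the perturbation is `a² = b⁻¹` for `b = a⁻²`. The atom `-(b + b⁻¹)`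
  -- of the shifted operator corresponds to `T² = 0`, whence the term `0 ^ (2 * k)`.
  rw [inv_pow a⁻¹] at h0
  refine (jacobi_law_inv hb (inv_sq_mem ha).2 h0
    (edgeJacobi_word_succ h ha0) (coord_edgeWord_zero _ _ _) (coord_edgeWord_succ _ _ _) _).trans ?_
  have e1 : ((a⁻¹ : ℝ) : ℂ) ^ 2 + ((a⁻¹ : ℝ) : ℂ)⁻¹ ^ 2 = (a : ℂ) ^ 2 + (a : ℂ)⁻¹ ^ 2 := by
    push_cast; rw [inv_inv, add_comm]
  rw [e1]
  congr 2
  simp only [Polynomial.eval_pow, Polynomial.eval_add, Polynomial.eval_X, Polynomial.eval_C]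
  rw [pow_mul]
  congr 1
  push_cast
  simp only [inv_pow, inv_inv]
  ring

/-- The average over `±` the positive part of the spectrum. -/
def edgeMean (ha : 1 ≤ a) : C(gapSet (a - a⁻¹) (a + a⁻¹), ℂ) →L[ℂ] ℂ :=
  (1 / 2 : ℂ) • (pathIntegral (edgeRad ha) + pathIntegral ((gapNeg _ _).comp (edgeRad ha)))

lemma edgeMean_pow_even (ha : 1 ≤ a) (k : ℕ) :
    edgeMean ha (gapId _ _ ^ (2 * k)) = ∫ s, (edgeRad ha s : ℂ) ^ (2 * k) := by
  change (1 / 2 : ℂ) * ((∫ s, (edgeRad ha s : ℂ) ^ (2 * k)) +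
    ∫ s, (-(edgeRad ha s : ℂ)) ^ (2 * k)) = _
  simp only [(even_two_mul k).neg_pow]
  ring

lemma edgeMean_pow_odd (ha : 1 ≤ a) (k : ℕ) :
    edgeMean ha (gapId _ _ ^ (2 * k + 1)) = 0 := by
  change (1 / 2 : ℂ) * ((∫ s, (edgeRad ha s : ℂ) ^ (2 * k + 1)) +
    ∫ s, (-(edgeRad ha s : ℂ)) ^ (2 * k + 1)) = _
  have : Odd (2 * k + 1) := ⟨k, rfl⟩
  simp only [this.neg_pow]
  rw [integral_neg]
  ring

lemma edgeMean_of_even (ha : 1 ≤ a) {g : C(gapSet (a - a⁻¹) (a + a⁻¹), ℂ)}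
    (hg : g.comp (gapNeg _ _) = g) : edgeMean ha g = ∫ s, g (edgeRad ha s) := by
  change (1 / 2 : ℂ) * ((∫ s, g (edgeRad ha s)) + ∫ s, (g.comp (gapNeg _ _)) (edgeRad ha s)) = _
  rw [hg]; ring

/-- `T` is off-diagonal for `p_v`, so `T²` commutes with `p_v` and the corner of an odd power
contains the factor `p_v T p_v = 0`. -/
lemma vproj_mul_mul_vproj_odd {T : FockOp Λ} {v : Λ.vertexSet}
    (hT : vproj v * T + T * vproj v = T) (k : ℕ) : vacState v (T ^ (2 * k + 1)) = 0 := by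
  have h0 : vproj v * T * vproj v = 0 := by
    have h2 : vproj v * (vproj v * T + T * vproj v) = vproj v * T := by rw [hT]
    rw [mul_add, ← mul_assoc, vproj_mul_self, ← mul_assoc] at h2
    simpa using h2
  have h1 : Commute (vproj v) (T ^ 2) := by
    change vproj v * T ^ 2 = T ^ 2 * vproj v
    have e1 : vproj v * T ^ 2 = vproj v * T * (vproj v * T + T * vproj v) := by
      rw [hT]; noncomm_ring
    have e2 : T ^ 2 * vproj v = (vproj v * T + T * vproj v) * T * vproj v := by
      rw [hT]; noncomm_ring
    rw [e1, e2, mul_add, ← mul_assoc, h0, add_mul, add_mul]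
    have : T * vproj v * T * vproj v = T * (vproj v * T * vproj v) := by noncomm_ring
    rw [this, h0]
    noncomm_ring
  rw [← vacState_vproj_mul_mul_vproj, pow_succ, pow_mul, ← mul_assoc, (h1.pow_right k).eq,
    mul_assoc, mul_assoc, ← mul_assoc (vproj v), h0, mul_zero, map_zero]

variable (hs : spectrum ℂ (edgeComb a X (create e)) ⊆ gapSet (a - a⁻¹) (a + a⁻¹))

/-- The distribution of `T_ε` at the endpoint with the smaller weight. -/
lemma vacState_gapCalc_tgt (h : EdgeRel (vproj α) (vproj β) X (create e)) (ha : 1 ≤ a)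
    (g : C(gapSet (a - a⁻¹) (a + a⁻¹), ℂ)) :
    vacState β (gapCalc (isSelfAdjoint_edgeComb a X (create e)) hs g) = edgeMean ha g := by
  have key : (vacState β).comp (gapCalcCLM (isSelfAdjoint_edgeComb a X (create e)) hs) =
      edgeMean ha := by
    refine gap_ext fun n => ?_
    change vacState β (gapCalc (isSelfAdjoint_edgeComb a X (create e)) hs (gapId _ _ ^ n)) = _
    rw [gapCalc_pow]
    obtain ⟨k, rfl | rfl⟩ := n.even_or_odd'
    · rw [vacState_pow_even h ha, edgeMean_pow_even]
    · rw [vproj_mul_mul_vproj_odd h.right_comb_add, edgeMean_pow_odd]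
  exact DFunLike.congr_fun key g

end Edge

section EdgeSrc

variable {α β : Λ.vertexSet} {W : FockOp Λ} {e : DirEdge Λ} {a : ℝ}
  (hs : spectrum ℂ (edgeComb a (create e) W) ⊆ gapSet (a - a⁻¹) (a + a⁻¹))

/-- The distribution of `T_ε` at the endpoint with the larger weight. -/
lemma vacState_gapCalc_src (h : EdgeRel (vproj α) (vproj β) (create e) W) (ha : 1 ≤ a)
    (g : C(gapSet (a - a⁻¹) (a + a⁻¹), ℂ)) :
    vacState α (gapCalc (isSelfAdjoint_edgeComb a (create e) W) hs g) =
      ((1 - (a⁻¹ ^ 2) ^ 2 : ℝ) : ℂ) * g (gapZero (top_nonneg ha)) +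
      (((a⁻¹ ^ 2) ^ 2 : ℝ) : ℂ) * edgeMean ha g := by
  have key : (vacState α).comp (gapCalcCLM (isSelfAdjoint_edgeComb a (create e) W) hs) =
      ((1 - (a⁻¹ ^ 2) ^ 2 : ℝ) : ℂ) • ContinuousMap.evalCLM ℂ (gapZero (top_nonneg ha)) +
      (((a⁻¹ ^ 2) ^ 2 : ℝ) : ℂ) • edgeMean ha := by
    refine gap_ext fun n => ?_
    change vacState α (gapCalc (isSelfAdjoint_edgeComb a (create e) W) hs (gapId _ _ ^ n)) =
      ((1 - (a⁻¹ ^ 2) ^ 2 : ℝ) : ℂ) * (0 : ℂ) ^ n + _ * edgeMean ha (gapId _ _ ^ n)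
    rw [gapCalc_pow]
    obtain ⟨k, rfl | rfl⟩ := n.even_or_odd'
    · rw [← edgeComb_swap, vacState_pow_even' h.swap ha, edgeMean_pow_even]
    · rw [vproj_mul_mul_vproj_odd h.left_comb_add, edgeMean_pow_odd]
      simp
  exact DFunLike.congr_fun key g

end EdgeSrc

section Loop

variable {d : DirEdge Λ}

lemma norm_create_le (d : DirEdge Λ) : ‖create d‖ ≤ 1 := by
  have h1 : ‖create d‖ * ‖create d‖ = ‖vproj d.tgt‖ := by
    rw [← CStarRing.norm_star_mul_self, star_create_mul_create]
  have h2 : ‖vproj d.tgt‖ ≤ 1 := (isStarProjection_vproj d.tgt).norm_le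
  nlinarith [norm_nonneg (create d)]

lemma isSelfAdjoint_create_add (d : DirEdge Λ) : IsSelfAdjoint (create d + star (create d)) :=
  IsSelfAdjoint.add_star_self _

/-- Here `k₀ = 0`, so only reality and the bound by `‖create d‖ + ‖star (create d)‖ ≤ 2` are at
stake. -/
lemma spectrum_loop (d : DirEdge Λ) :
    spectrum ℂ (create d + star (create d)) ⊆ gapSet 0 2 := by
  intro z hz
  have hnt : Nontrivial (FockOp Λ) := ⟨1, 0, fun h => by
    have := vacState_one (Λ := Λ) d.src
    rw [h, map_zero] at this
    exact zero_ne_one this⟩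
  refine ⟨(isSelfAdjoint_create_add d).im_eq_zero_of_mem_spectrum hz, Or.inr (abs_nonneg _), ?_⟩
  calc |z.re| ≤ ‖z‖ := Complex.abs_re_le_norm z
    _ ≤ ‖create d + star (create d)‖ := spectrum.norm_le_norm_of_mem hz
    _ ≤ ‖create d‖ + ‖star (create d)‖ := norm_add_le _ _
    _ ≤ 1 + 1 := by rw [norm_star]; gcongr <;> exact norm_create_le d
    _ = 2 := by norm_num

lemma vacState_loop_pow (hd : d.src = d.tgt) (n : ℕ) :
    vacState d.src ((create d + star (create d)) ^ n) = ∫ s, (loopPoint s : ℂ) ^ n := by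
  -- The chain of powers of the creation operator on the vacuum carries an unperturbed Jacobi
  -- matrix, that is, the case `b = 0` and the semicircle law.
  set e : ℕ → Fock Λ := fun n => (create d ^ n).1 (vacuum d.src) with he
  have h0 : actHom Λ (create d + star (create d)) (e 0) = e 1 - ((0 : ℝ) : ℂ) • e 0 := by
    change (create d).1 (vacuum d.src) + (star (create d)).1 (vacuum d.src) = _
    rw [star_create_vacuum, add_zero, Complex.ofReal_zero, zero_smul, sub_zero, he]
    simp only [pow_one]
  have h1 : ∀ n, actHom Λ (create d + star (create d)) (e (n + 1)) = e (n + 2) + e n := by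
    intro n
    have h2 : star (create d) * create d ^ (n + 1) * vproj d.src = create d ^ n * vproj d.src := by
      rw [pow_succ', ← mul_assoc, star_create_mul_create, ← hd]
      cases n with
      | zero => simp [vproj_mul_self]
      | succ n => rw [pow_succ', ← mul_assoc, vproj_mul_create]
    have h3 := congrArg (fun x : FockOp Λ => x.1 (vacuum d.src)) h2
    simp only [fockOp_mul_apply _ (vproj d.src), vproj_vacuum] at h3
    change (create d).1 (e (n + 1)) + (star (create d)).1 (e (n + 1)) = _
    have h4 : (star (create d)).1 (e (n + 1)) = e n := h3
    rw [h4]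
    congr 1
    change (create d * create d ^ (n + 1)).1 _ = (create d ^ (n + 2)).1 _
    rw [← pow_succ']
  have hl0 : coord d.src (PathTo.nil d.src) (e 0) = 1 := by
    change coord d.src (PathTo.nil d.src) ((create d ^ 0).1 _) = 1
    rw [pow_zero, fockOp_one_apply, coord_nil_vacuum]
  have hl : ∀ n, coord d.src (PathTo.nil d.src) (e (n + 1)) = 0 := by
    intro n
    change coord d.src (PathTo.nil d.src) ((create d ^ (n + 1)).1 _) = 0
    rw [pow_succ']
    exact coord_nil_create _ _ _
  have key := jacobi_law le_rfl zero_le_one h0 h1 hl0 hl (Polynomial.X ^ n)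
  rw [integral_loopPoint_pow, ← key]
  have e0 : e 0 = vacuum d.src := by rw [he]; simp only [pow_zero, fockOp_one_apply]
  rw [e0, coord_aeval, map_pow (Polynomial.aeval _), Polynomial.aeval_X]

lemma vacState_loop (hd : d.src = d.tgt) (g : C(gapSet 0 2, ℂ)) :
    vacState d.src (gapCalc (isSelfAdjoint_create_add d) (spectrum_loop d) g) =
      ∫ s, g (loopPoint s) := by
  have key : (vacState d.src).comp (gapCalcCLM (isSelfAdjoint_create_add d) (spectrum_loop d)) =
      pathIntegral loopPoint := by
    refine gap_ext fun n => ?_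
    change vacState d.src (gapCalc (isSelfAdjoint_create_add d) (spectrum_loop d) (gapId _ _ ^ n)) = _
    rw [gapCalc_pow, vacState_loop_pow hd]
    rfl
  exact DFunLike.congr_fun key g

end Loop

end Law

end FreeGraph

end

noncomputable section

/-! ## Extension by zero, and the isomorphism theorem -/

namespace FreeGraph

section ExtZero

variable {X : Type*} [TopologicalSpace X] [DiscreteTopology X] (P : X → Prop)

open Classical in
/-- Extension by zero, as a *-homomorphism. -/
def extZero : C₀({x // P x}, ℂ) →⋆ₙₐ[ℂ] C₀(X, ℂ) where
  toFun c :=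
    { toFun := fun x => if h : P x then c ⟨x, h⟩ else 0
      continuous_toFun := continuous_of_discreteTopology
      zero_at_infty' := by
        have h := zero_at_infty c
        rw [cocompact_eq_cofinite] at h ⊢
        rw [Metric.tendsto_nhds] at h ⊢
        intro ε hε
        have h1 := h ε hε
        rw [eventually_cofinite] at h1 ⊢
        refine (h1.image Subtype.val).subset fun x hx => ?_
        by_cases hP : P x
        · exact ⟨⟨x, hP⟩, by simpa [hP] using hx, rfl⟩
        · exact absurd hx (by simp [hP, hε]) }
  map_smul' a c := by
    ext x
    change (if h : P x then a * c ⟨x, h⟩ else 0) = a * (if h : P x then c ⟨x, h⟩ else 0)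
    split_ifs <;> simp
  map_zero' := by
    ext x
    change (if h : P x then (0 : ℂ) else 0) = 0
    split_ifs <;> rfl
  map_add' c c' := by
    ext x
    change (if h : P x then c ⟨x, h⟩ + c' ⟨x, h⟩ else 0) =
      (if h : P x then c ⟨x, h⟩ else 0) + (if h : P x then c' ⟨x, h⟩ else 0)
    split_ifs <;> simp
  map_mul' c c' := by
    ext x
    change (if h : P x then c ⟨x, h⟩ * c' ⟨x, h⟩ else 0) =
      (if h : P x then c ⟨x, h⟩ else 0) * (if h : P x then c' ⟨x, h⟩ else 0)
    split_ifs <;> simp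
  map_star' c := by
    ext x
    change (if h : P x then star (c ⟨x, h⟩) else 0) = star (if h : P x then c ⟨x, h⟩ else 0)
    split_ifs <;> simp

variable {P}

lemma extZero_apply_of_pos {x : X} (h : P x) (c : C₀({x // P x}, ℂ)) :
    extZero P c x = c ⟨x, h⟩ := dif_pos h

lemma extZero_apply_of_neg {x : X} (h : ¬ P x) (c : C₀({x // P x}, ℂ)) :
    extZero P c x = 0 := dif_neg h

variable (P) in
/-- Restriction to a subset. -/
def restrictZero (c : C₀(X, ℂ)) : C₀({x // P x}, ℂ) where
  toFun x := c x
  continuous_toFun := continuous_of_discreteTopology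
  zero_at_infty' := by
    have h := zero_at_infty c
    rw [cocompact_eq_cofinite] at h ⊢
    exact h.comp Subtype.val_injective.tendsto_cofinite

lemma restrictZero_apply (c : C₀(X, ℂ)) (x : {x // P x}) : restrictZero P c x = c x := rfl

end ExtZero

/-! ### Recognizing `𝓢_ε` as the range of a model. -/

section Iso

variable {V E : Type*} {Λ : Graph V E} [TopologicalSpace V] [DiscreteTopology V]
  {μ : Λ.vertexSet → ℝ} {d : DirEdge Λ}

lemma leftHom_mem (c : C₀(Λ.vertexSet, ℂ)) : leftHom Λ c ∈ edgeAlg μ d := (incl μ d c).2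

lemma edgeOp_mem : edgeOp μ d ∈ edgeAlg μ d :=
  NonUnitalStarSubalgebra.le_topologicalClosure _
    (NonUnitalStarAlgebra.subset_adjoin ℂ _ (Or.inr rfl))

lemma isClosed_edgeAlg : IsClosed (edgeAlg μ d : Set (FockOp Λ)) :=
  NonUnitalStarSubalgebra.isClosed_topologicalClosure _

/-- The range of `ψ` is a closed *-subalgebra that contains the generators, hence all of `edgeAlg μ
d`; the reverse inclusion is `hmem`. -/
lemma exists_equiv {B : Type*} [NonUnitalNonAssocSemiring B] [Module ℂ B] [Star B]
    (ψ : B →⋆ₙₐ[ℂ] FockOp Λ) (hinj : Function.Injective ψ) (hcl : IsClosed (Set.range ψ))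
    (hmem : ∀ b, ψ b ∈ edgeAlg μ d) (hc : ∀ c, ∃ b, ψ b = leftHom Λ c)
    (hT : ∃ b, ψ b = edgeOp μ d) :
    ∃ φ : edgeAlg μ d ≃⋆ₐ[ℂ] B, (∀ b, ((φ.symm b : edgeAlg μ d) : FockOp Λ) = ψ b) ∧
      ∀ x : edgeAlg μ d, ψ (φ x) = x := by
  let ψ' : B →⋆ₙₐ[ℂ] edgeAlg μ d := NonUnitalStarAlgHom.codRestrict ψ (edgeAlg μ d) hmem
  have hle : edgeAlg μ d ≤ NonUnitalStarAlgHom.range ψ := by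
    refine NonUnitalStarSubalgebra.topologicalClosure_minimal _ ?_ hcl
    refine NonUnitalStarAlgebra.adjoin_le ?_
    rintro _ (⟨c, rfl⟩ | h)
    · exact hc c
    · rw [Set.mem_singleton_iff] at h
      rw [h]; exact hT
  have hbij : Function.Bijective ψ' := by
    refine ⟨fun b b' h => hinj (congrArg Subtype.val h), fun x => ?_⟩
    obtain ⟨b, hb⟩ := hle x.2
    exact ⟨b, Subtype.ext hb⟩
  refine ⟨(StarAlgEquiv.ofBijective ψ' hbij).symm, fun b => rfl, fun x => ?_⟩
  have := (StarAlgEquiv.ofBijective ψ' hbij).apply_symm_apply x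
  exact congrArg Subtype.val this

lemma equiv_incl {B : Type*} [NonUnitalNonAssocSemiring B] [Module ℂ B] [Star B]
    (φ : edgeAlg μ d ≃⋆ₐ[ℂ] B) (ψ : B →⋆ₙₐ[ℂ] FockOp Λ) (κ : C₀(Λ.vertexSet, ℂ) → B)
    (h : ∀ b, ((φ.symm b : edgeAlg μ d) : FockOp Λ) = ψ b)
    (hc : ∀ c, ψ (κ c) = leftHom Λ c) (c : C₀(Λ.vertexSet, ℂ)) : φ (incl μ d c) = κ c := by
  rw [← φ.apply_symm_apply (κ c)]
  congr 1
  refine Subtype.ext ?_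
  rw [h, hc]
  rfl

lemma exists_equiv_incl {B : Type*} [NonUnitalNonAssocSemiring B] [Module ℂ B] [Star B]
    (ψ : B →⋆ₙₐ[ℂ] FockOp Λ) (κ : C₀(Λ.vertexSet, ℂ) → B)
    (hc : ∀ c, ψ (κ c) = leftHom Λ c)
    (h : ∃ φ : edgeAlg μ d ≃⋆ₐ[ℂ] B, (∀ b, ((φ.symm b : edgeAlg μ d) : FockOp Λ) = ψ b) ∧
      ∀ x : edgeAlg μ d, ψ (φ x) = x) :
    ∃ φ : edgeAlg μ d ≃⋆ₐ[ℂ] B, (∀ c, φ (incl μ d c) = κ c) ∧ ∀ x : edgeAlg μ d, ψ (φ x) = x :=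
  h.imp fun φ h => ⟨equiv_incl φ ψ κ h.1 hc, h.2⟩
lemma exists_equiv_of_model {B : Type*} [NonUnitalNonAssocSemiring B] [Module ℂ B] [Star B]
    (ψ : B →⋆ₙₐ[ℂ] FockOp Λ) (hinj : Function.Injective ψ) (hcl : IsClosed (Set.range ψ))
    (hmem : ∀ b, ψ b ∈ edgeAlg μ d) (κ : C₀(Λ.vertexSet, ℂ) → B)
    (hc : ∀ c, ψ (κ c) = leftHom Λ c) (hT : ∃ t, ψ t = edgeOp μ d) :
    ∃ φ : edgeAlg μ d ≃⋆ₐ[ℂ] B, (∀ c, φ (incl μ d c) = κ c) ∧ ∀ x : edgeAlg μ d, ψ (φ x) = x :=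
  exists_equiv_incl ψ κ hc (exists_equiv ψ hinj hcl hmem (fun c => ⟨_, hc c⟩) hT)

lemma isClosed_range_of_injective {A B : Type*} [NonUnitalCStarAlgebra A] [NonUnitalCStarAlgebra B]
    (ψ : B →⋆ₙₐ[ℂ] A) (hinj : Function.Injective ψ) : IsClosed (Set.range ψ) :=
  (NonUnitalStarAlgHom.isometry ψ hinj).isClosedEmbedding.isClosed_range

open scoped Matrix.Norms.L2Operator in
-- The operator norm on matrices enters only to make the domain a C*-algebra; the conclusion does
-- not depend on a norm on the domain.
lemma isClosed_range_matrix {A B : Type*} [NonUnitalCStarAlgebra A] [NonUnitalCStarAlgebra B]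
    (ψ : C(unitInterval, Matrix (Fin 2) (Fin 2) ℂ) × B →⋆ₙₐ[ℂ] A) (hinj : Function.Injective ψ) :
    IsClosed (Set.range ψ) :=
  isClosed_range_of_injective ψ hinj

lemma isClosed_diagAtZero :
    IsClosed (diagAtZero : Set C(unitInterval, Matrix (Fin 2) (Fin 2) ℂ)) := by
  have : (diagAtZero : Set C(unitInterval, Matrix (Fin 2) (Fin 2) ℂ)) =
      ⋂ (i : Fin 2) (j : Fin 2) (_ : i ≠ j), {f | f 0 i j = 0} := by
    ext f
    simp only [Set.mem_iInter, Set.mem_ofPred_eq]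
    exact ⟨fun h i j hij => h hij, fun h i j hij => h i j hij⟩
  rw [this]
  refine isClosed_iInter fun i => isClosed_iInter fun j => isClosed_iInter fun _ => ?_
  refine isClosed_eq ?_ continuous_const
  exact (continuous_apply_apply i j).comp (continuous_eval_const (0 : unitInterval))

open scoped Matrix.Norms.L2Operator in
lemma isClosed_range_diagAtZero {A B : Type*} [NonUnitalCStarAlgebra A] [NonUnitalCStarAlgebra B]
    (ψ : diagAtZero × B →⋆ₙₐ[ℂ] A) (hinj : Function.Injective ψ) :
    IsClosed (Set.range ψ) := by
  have : CompleteSpace diagAtZero := isClosed_diagAtZero.completeSpace_coe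
  have : IsClosed (diagAtZero : Set C(unitInterval, Matrix (Fin 2) (Fin 2) ℂ)) :=
    isClosed_diagAtZero
  exact (NonUnitalStarAlgHom.isometry ψ hinj).isClosedEmbedding.isClosed_range

end Iso

end FreeGraph

end

noncomputable section

/-! ## The expectation and the weight -/

namespace FreeGraph

section Weight

variable {V E : Type*} {Λ : Graph V E} [TopologicalSpace V] [DiscreteTopology V]

/-- Unconditional convergence in the sup norm is vanishing at infinity: past the finite set where
`|c| ≥ ε/2`, every partial sum is within `ε/2` of `c`. -/
lemma hasSum_smul_vertexProj (c : C₀(Λ.vertexSet, ℂ)) :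
    HasSum (fun v => c v • vertexProj v) c := by
  classical
  rw [HasSum, SummationFilter.unconditional_filter, Metric.tendsto_nhds]
  intro ε hε
  have h1 : {v | ¬ ‖c v‖ < ε / 2}.Finite := by
    have := (tendsto_czero c).eventually_lt_const (half_pos hε)
    rwa [eventually_cofinite] at this
  filter_upwards [eventually_ge_atTop h1.toFinset] with s hs
  rw [dist_eq_norm, ← ZeroAtInftyContinuousMap.norm_toBCF_eq_norm]
  refine lt_of_le_of_lt ?_ (half_lt_self hε)
  rw [BoundedContinuousFunction.norm_le (half_pos hε).le]
  intro v
  change ‖(∑ w ∈ s, c w • vertexProj w - c) v‖ ≤ _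
  have h2 : (∑ w ∈ s, c w • vertexProj w) v = if v ∈ s then c v else 0 := by
    have h3 : (∑ w ∈ s, c w • vertexProj w) v = ∑ w ∈ s, c w * vertexProj w v := by
      clear hs
      induction s using Finset.induction_on with
      | empty => rfl
      | insert a t ha ih =>
        rw [Finset.sum_insert ha, Finset.sum_insert ha, ← ih]
        rfl
    simp [h3, vertexProj_apply]
  rw [ZeroAtInftyContinuousMap.sub_apply, h2]
  split_ifs with hv
  · simpa using (half_pos hε).le
  · have : v ∉ h1.toFinset := fun h => hv (hs h)
    simp only [Set.Finite.mem_toFinset, Set.mem_ofPred_eq, not_not] at this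
    simpa using this.le

lemma hasSum_inner_vacuum {x : FockOp Λ} (hx : Tendsto (fun v => vacState v x) cofinite (𝓝 0)) :
    HasSum (fun v => inner C₀(Λ.vertexSet, ℂ) (vacuum v) (x.1 (vacuum v))) (mkCZero _ hx) := by
  simpa only [inner_vacuum, mkCZero_apply] using hasSum_smul_vertexProj (mkCZero _ hx)

lemma condExp_apply {x : FockOp Λ} (hx : Tendsto (fun v => vacState v x) cofinite (𝓝 0))
    (v : Λ.vertexSet) : condExp x v = vacState v x := by
  rw [condExp, (hasSum_inner_vacuum hx).tsum_eq, mkCZero_apply]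

lemma Tr_eq {x : FockOp Λ} (hx : Tendsto (fun v => vacState v x) cofinite (𝓝 0))
    (μ : Λ.vertexSet → ℝ) :
    Tr μ x = ∑' v, ENNReal.ofReal (μ v) * ENNReal.ofReal (vacState v x).re := by
  simp only [Tr, tauWeight, condExp_apply hx]

omit [TopologicalSpace V] [DiscreteTopology V] in
/-- A `C₀`-function whose square is not summable against a given non-summable weight. -/
lemma exists_czero_sq_not_summable {μ : Λ.vertexSet → ℝ} (hμ : ∀ v, 0 < μ v)
    (h : ¬ Summable μ) :
    ∃ s : Λ.vertexSet → ℝ, (∀ v, 0 ≤ s v) ∧ Tendsto s cofinite (𝓝 0) ∧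
      ¬ Summable fun v => μ v * s v ^ 2 := by
  classical
  -- Finite sets of mass above `8ⁿ` are given height at least `2⁻ⁿ`; the squares `4⁻ⁿ` still leave
  -- mass above `2ⁿ`, while the heights have a summable bound and so tend to zero at infinity.
  have h1 : ∀ n : ℕ, ∃ F : Finset Λ.vertexSet, (8 : ℝ) ^ n < ∑ v ∈ F, μ v := by
    intro n
    by_contra! h2
    exact h (summable_of_sum_le (fun v => (hμ v).le) h2)
  choose F hF using h1
  let g : ℕ → Λ.vertexSet → ℝ := fun n v => if v ∈ F n then (1 / 2 : ℝ) ^ n else 0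
  have hg0 : ∀ n v, 0 ≤ g n v := fun n v => by simp only [g]; split_ifs <;> positivity
  have hgle : ∀ n v, ‖g n v‖ ≤ (1 / 2 : ℝ) ^ n := fun n v => by
    rw [Real.norm_of_nonneg (hg0 n v)]
    simp only [g]; split_ifs
    · exact le_rfl
    · positivity
  have hsum : ∀ v, Summable fun n => g n v := fun v =>
    Summable.of_norm_bounded summable_geometric_two fun n => hgle n v
  refine ⟨fun v => ∑' n, g n v, fun v => tsum_nonneg fun n => hg0 n v, ?_, fun hs => ?_⟩
  · have h2 := tendsto_tsum_of_dominated_convergence (𝓕 := (cofinite : Filter Λ.vertexSet))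
      (f := fun v n => g n v) (g := fun _ => (0 : ℝ)) summable_geometric_two (fun n => ?_)
      (Eventually.of_forall fun v n => hgle n v)
    · simpa using h2
    · refine tendsto_const_nhds.congr' ?_
      filter_upwards [(F n).finite_toSet.compl_mem_cofinite] with v hv
      exact (if_neg fun h => hv h).symm
  · obtain ⟨n, hn⟩ := exists_nat_gt (∑' v, μ v * (∑' n, g n v) ^ 2)
    have h3 : (n : ℝ) < 2 ^ n := by exact_mod_cast Nat.lt_two_pow_self
    have h4 := hs.sum_le_tsum (F n) (fun v _ => mul_nonneg (hμ v).le (sq_nonneg _))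
    have h5 : ∑ v ∈ F n, μ v * (1 / 4 : ℝ) ^ n ≤ ∑ v ∈ F n, μ v * (∑' n, g n v) ^ 2 := by
      refine Finset.sum_le_sum fun v hv => mul_le_mul_of_nonneg_left ?_ (hμ v).le
      have h6 : g n v ≤ ∑' n, g n v := (hsum v).le_tsum n fun m _ => hg0 m v
      have h7 : g n v = (1 / 2 : ℝ) ^ n := if_pos hv
      calc (1 / 4 : ℝ) ^ n = (g n v) ^ 2 := by rw [h7, ← pow_mul, mul_comm n, pow_mul]; norm_num
        _ ≤ _ := pow_le_pow_left₀ (hg0 n v) h6 2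
    rw [← Finset.sum_mul] at h5
    have h8 : (2 : ℝ) ^ n < (∑ v ∈ F n, μ v) * (1 / 4 : ℝ) ^ n := by
      calc (2 : ℝ) ^ n = 8 ^ n * (1 / 4 : ℝ) ^ n := by rw [← mul_pow]; norm_num
        _ < _ := by gcongr; exact hF n
    linarith

/-- A *-algebra of operators on the Fock space that contains `C₀(V)`, on which the vacuum states
of all but finitely many vertices are given by functions in `C₀(V)` and are tracial, and on which
the weighted sum of the remaining vacuum states is tracial. -/
structure TracialData (μ : Λ.vertexSet → ℝ) (S : NonUnitalStarSubalgebra ℂ (FockOp Λ))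
    (s : Finset Λ.vertexSet) : Prop where
  leftHom_mem : ∀ c, leftHom Λ c ∈ S
  vacState_eq : ∀ x ∈ S, ∃ c : C₀(Λ.vertexSet, ℂ), ∀ v ∉ s, vacState v x = c v
  vacState_comm : ∀ z ∈ S, ∀ v ∉ s, vacState v (star z * z) = vacState v (z * star z)
  sum_comm : ∀ z ∈ S, ∑ v ∈ s, (μ v : ℂ) * vacState v (star z * z) =
    ∑ v ∈ s, (μ v : ℂ) * vacState v (z * star z)

namespace TracialData

variable {μ : Λ.vertexSet → ℝ} {S : NonUnitalStarSubalgebra ℂ (FockOp Λ)}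
  {s : Finset Λ.vertexSet} (h : TracialData μ S s)
include h

lemma tendsto_vacState {x : FockOp Λ} (hx : x ∈ S) :
    Tendsto (fun v => vacState v x) cofinite (𝓝 0) := by
  obtain ⟨c, hc⟩ := h.vacState_eq x hx
  have h1 := zero_at_infty c
  rw [cocompact_eq_cofinite] at h1
  refine h1.congr' ?_
  filter_upwards [s.finite_toSet.compl_mem_cofinite] with v hv
  exact (hc v hv).symm

lemma Tr_coe (x : S) :
    Tr μ (x : FockOp Λ) =
      ∑' v, ENNReal.ofReal (μ v) * ENNReal.ofReal (vacState v (x : FockOp Λ)).re :=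
  Tr_eq (h.tendsto_vacState x.2) μ

omit h in
lemma re_vacState_nonneg {x : S} (hx : IsPos x) (v : Λ.vertexSet) :
    0 ≤ vacState v (x : FockOp Λ) := by
  obtain ⟨z, rfl⟩ := hx
  exact vacState_star_mul_self_nonneg v (z : FockOp Λ)

lemma Tr_star_mul_self (hμ : ∀ v, 0 < μ v) (z : S) :
    Tr μ (star z * z : S) = Tr μ (z * star z : S) := by
  rw [h.Tr_coe, h.Tr_coe]
  rw [← ENNReal.sum_add_tsum_compl s, ← ENNReal.sum_add_tsum_compl s]
  -- Over the exceptional set only the weighted sum is tracial, so the finite sum is moved inside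
  -- `ENNReal.ofReal`; the other vertices are compared term by term.
  have h1 : ∀ y : FockOp Λ, ∑ v ∈ s, ENNReal.ofReal (μ v) *
      ENNReal.ofReal (vacState v (star y * y)).re =
      ENNReal.ofReal (∑ v ∈ s, (μ v : ℂ) * vacState v (star y * y)).re := by
    intro y
    rw [Complex.re_sum, ENNReal.ofReal_sum_of_nonneg]
    · refine Finset.sum_congr rfl fun v _ => ?_
      rw [Complex.re_ofReal_mul, ENNReal.ofReal_mul (hμ v).le]
    · intro v _
      rw [Complex.re_ofReal_mul]
      exact mul_nonneg (hμ v).le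
        (Complex.nonneg_iff.1 (vacState_star_mul_self_nonneg v y)).1
  have h2 := h1 (star (z : FockOp Λ))
  rw [star_star, ← h.sum_comm z z.2, ← h1] at h2
  have h3 : ∀ v : ↥((s : Set Λ.vertexSet)ᶜ), ENNReal.ofReal (μ v) *
      ENNReal.ofReal (vacState v.1 (star (z : FockOp Λ) * z)).re = ENNReal.ofReal (μ v) *
      ENNReal.ofReal (vacState v.1 ((z : FockOp Λ) * star (z : FockOp Λ))).re :=
    fun v => by rw [h.vacState_comm z z.2 v v.2]
  exact congrArg₂ _ h2.symm (tsum_congr h3)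

theorem isLscTracialWeight (hμ : ∀ v, 0 < μ v) :
    IsLscTracialWeight (fun x : S => Tr μ (x : FockOp Λ)) where
  add x y hx hy := by
    simp only [h.Tr_coe]
    rw [← ENNReal.tsum_add]
    refine tsum_congr fun v => ?_
    rw [← mul_add, ← ENNReal.ofReal_add (Complex.nonneg_iff.1 (re_vacState_nonneg hx v)).1
      (Complex.nonneg_iff.1 (re_vacState_nonneg hy v)).1, ← Complex.add_re, ← map_add]
    rfl
  smul c x hx := by
    simp only [h.Tr_coe]
    rw [← ENNReal.tsum_mul_left]
    refine tsum_congr fun v => ?_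
    have h1 : vacState v ((((c : ℝ) : ℂ) • x : S) : FockOp Λ) =
        ((c : ℝ) : ℂ) * vacState v (x : FockOp Λ) := (vacState v).map_smul _ _
    rw [h1, Complex.re_ofReal_mul, ENNReal.ofReal_mul c.coe_nonneg, ENNReal.ofReal_coe_nnreal]
    ring
  lsc := by
    simp only [h.Tr_coe]
    refine LowerSemicontinuous.lowerSemicontinuousOn ?_ _
    -- Each vacuum state is norm continuous, and a sum of continuous `[0, ∞]`-valued functions is
    -- lower semicontinuous.
    refine lowerSemicontinuous_tsum fun v => Continuous.lowerSemicontinuous ?_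
    refine (ENNReal.continuous_const_mul ENNReal.ofReal_ne_top).comp
      (ENNReal.continuous_ofReal.comp (Complex.continuous_re.comp
        ((vacState v).continuous.comp continuous_subtype_val)))
  tracial z := h.Tr_star_mul_self hμ z

lemma Tr_lt_top_iff (hμ : ∀ v, 0 < μ v) :
    (∀ x : S, IsPos x → Tr μ (x : FockOp Λ) < ∞) ↔ Summable μ := by
  constructor
  · intro h1
    by_contra h2
    obtain ⟨s', hs0, hst, hns⟩ := exists_czero_sq_not_summable hμ h2
    have hst' : Tendsto (fun v => ((s' v : ℝ) : ℂ)) cofinite (𝓝 0) := by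
      have := (Complex.continuous_ofReal.tendsto 0).comp hst
      rwa [Complex.ofReal_zero] at this
    -- The trace of the positive element `c* c` of `C₀(V)` is the divergent sum of `μ(v) s'(v)²`.
    let c := mkCZero _ hst'
    let z : S := ⟨leftHom Λ c, h.leftHom_mem c⟩
    have h3 := h1 (star z * z) ⟨z, rfl⟩
    rw [h.Tr_coe] at h3
    refine hns ?_
    have h4 : ∀ v, vacState v ((star z * z : S) : FockOp Λ) = ((s' v ^ 2 : ℝ) : ℂ) := by
      intro v
      change vacState v (star (leftHom Λ c) * leftHom Λ c) = _
      rw [← map_star, ← map_mul, vacState_leftHom]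
      change star ((s' v : ℝ) : ℂ) * ((s' v : ℝ) : ℂ) = _
      rw [Complex.star_def, Complex.conj_ofReal]
      push_cast; ring
    simp only [h4, Complex.ofReal_re] at h3
    have h5 : ∀ v, ENNReal.ofReal (μ v) * ENNReal.ofReal (s' v ^ 2) =
        ENNReal.ofReal (μ v * s' v ^ 2) := fun v => (ENNReal.ofReal_mul (hμ v).le).symm
    simp only [h5] at h3
    have h6 := ENNReal.summable_toReal h3.ne
    refine h6.congr fun v => ?_
    exact ENNReal.toReal_ofReal (mul_nonneg (hμ v).le (sq_nonneg _))
  · intro h1 x _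
    have hx := h.tendsto_vacState x.2
    rw [h.Tr_coe]
    -- The vacuum states of `x` are uniformly bounded by the norm of the `C₀`-function that they
    -- define.
    calc ∑' v, ENNReal.ofReal (μ v) * ENNReal.ofReal (vacState v (x : FockOp Λ)).re
        ≤ ∑' v, ENNReal.ofReal (μ v) * ENNReal.ofReal ‖mkCZero _ hx‖ := by
          refine ENNReal.tsum_le_tsum fun v => ?_
          gcongr
          exact (Complex.re_le_norm _).trans (czero_norm_apply_le (mkCZero _ hx) v)
      _ = (∑' v, ENNReal.ofReal (μ v)) * ENNReal.ofReal ‖mkCZero _ hx‖ := ENNReal.tsum_mul_right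
      _ < ∞ := ENNReal.mul_lt_top h1.tsum_ofReal_lt_top ENNReal.ofReal_lt_top

lemma summable_inner (x : S) :
    Summable fun α => inner C₀(Λ.vertexSet, ℂ) (vacuum α) ((x : FockOp Λ).1 (vacuum α)) :=
  (hasSum_inner_vacuum (h.tendsto_vacState x.2)).summable

/-- The trace of an element whose vacuum states vanish outside of `s`. -/
lemma hasTr {x : FockOp Λ} (hx : x ∈ S) (h0 : ∀ v ∉ s, vacState v x = 0) :
    HasTr μ x (∑ v ∈ s, (μ v : ℂ) * vacState v x) := by
  simp only [HasTr, condExp_apply (h.tendsto_vacState hx)]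
  exact hasSum_sum_of_ne_finset_zero fun v hv => by rw [h0 v hv, mul_zero]

lemma Tr_eq_ofReal (hμ : ∀ v, 0 < μ v) {x : FockOp Λ} (hx : x ∈ S)
    (h0 : ∀ v ∉ s, vacState v x = 0) (hpos : ∀ v ∈ s, 0 ≤ vacState v x) :
    Tr μ x = ENNReal.ofReal (∑ v ∈ s, (μ v : ℂ) * vacState v x).re := by
  rw [Tr_eq (h.tendsto_vacState hx), tsum_eq_sum (s := s) fun v hv => by simp [h0 v hv],
    Complex.re_sum, ENNReal.ofReal_sum_of_nonneg]
  · refine Finset.sum_congr rfl fun v _ => ?_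
    rw [Complex.re_ofReal_mul, ENNReal.ofReal_mul (hμ v).le]
  · intro v hv
    rw [Complex.re_ofReal_mul]
    exact mul_nonneg (hμ v).le (Complex.nonneg_iff.1 (hpos v hv)).1

end TracialData

end Weight

end FreeGraph

end

noncomputable section

/-! ## The algebra of a loop -/

namespace FreeGraph

/-- Two *-homomorphisms with orthogonal ranges combine to a *-homomorphism on the product. -/
def prodHom {A B₁ B₂ : Type*} [Ring A] [StarRing A] [Algebra ℂ A]
    [NonUnitalNonAssocSemiring B₁] [Module ℂ B₁] [Star B₁]
    [NonUnitalNonAssocSemiring B₂] [Module ℂ B₂] [Star B₂]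
    (ψ₁ : B₁ →⋆ₙₐ[ℂ] A) (ψ₂ : B₂ →⋆ₙₐ[ℂ] A) (h : ∀ x y, ψ₁ x * ψ₂ y = 0)
    (h' : ∀ x y, ψ₂ y * ψ₁ x = 0) : B₁ × B₂ →⋆ₙₐ[ℂ] A where
  toFun b := ψ₁ b.1 + ψ₂ b.2
  map_smul' c b := by simp
  map_zero' := by simp
  map_add' b b' := by simp only [Prod.fst_add, Prod.snd_add, map_add]; abel
  map_mul' b b' := by
    simp only [Prod.fst_mul, Prod.snd_mul, map_mul, add_mul, mul_add, h, h', add_zero, zero_add]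
  map_star' b := by
    simp only [Prod.fst_star, Prod.snd_star, map_star, star_add]

lemma integrable_unitInterval (f : C(unitInterval, ℂ)) : Integrable fun t => f t :=
  f.continuous.integrable_of_hasCompactSupport (HasCompactSupport.of_compactSpace _)

lemma eq_zero_of_integral_normSq (f : C(unitInterval, ℂ))
    (h : ∫ t, star (f t) * f t = 0) : f = 0 := by
  have h1 : ∀ t, star (f t) * f t = ((Complex.normSq (f t) : ℝ) : ℂ) := fun t => by
    rw [Complex.normSq_eq_conj_mul_self]; rfl
  simp only [h1] at h
  rw [integral_complex_ofReal, Complex.ofReal_eq_zero] at h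
  have h2 := eq_zero_of_integral_unitInterval
    (f := ⟨fun t => Complex.normSq (f t), Complex.continuous_normSq.comp f.continuous⟩)
    (fun t => Complex.normSq_nonneg _) h
  ext t
  exact Complex.normSq_eq_zero.1 (DFunLike.congr_fun h2 t)

section Loop

variable {V E : Type*} {Λ : Graph V E} [TopologicalSpace V] [DiscreteTopology V]
  {μ : Λ.vertexSet → ℝ} {d : DirEdge Λ}

/-- `C₀` of a set of vertices, as operators on the Fock space. -/
def restHom (P : Λ.vertexSet → Prop) : C₀({v // P v}, ℂ) →⋆ₙₐ[ℂ] FockOp Λ :=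
  (leftHom Λ).comp (extZero P)

lemma restHom_apply (P : Λ.vertexSet → Prop) (c : C₀({v // P v}, ℂ)) :
    restHom P c = leftHom Λ (extZero P c) := rfl

lemma vproj_mul_restHom {P : Λ.vertexSet → Prop} {α : Λ.vertexSet} (hα : ¬ P α)
    (c : C₀({v // P v}, ℂ)) : vproj α * restHom P c = 0 := by
  rw [restHom_apply, vproj_mul_leftHom, extZero_apply_of_neg hα, zero_smul]

lemma restHom_mul_vproj {P : Λ.vertexSet → Prop} {α : Λ.vertexSet} (hα : ¬ P α)
    (c : C₀({v // P v}, ℂ)) : restHom P c * vproj α = 0 := by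
  rw [restHom_apply, leftHom_mul_vproj, extZero_apply_of_neg hα, zero_smul]

lemma vacState_restHom_of_pos {P : Λ.vertexSet → Prop} {v : Λ.vertexSet} (hv : P v)
    (c : C₀({v // P v}, ℂ)) : vacState v (restHom P c) = c ⟨v, hv⟩ := by
  rw [restHom_apply, vacState_leftHom, extZero_apply_of_pos hv]

lemma vacState_restHom_of_neg {P : Λ.vertexSet → Prop} {v : Λ.vertexSet} (hv : ¬ P v)
    (c : C₀({v // P v}, ℂ)) : vacState v (restHom P c) = 0 := by
  rw [restHom_apply, vacState_leftHom, extZero_apply_of_neg hv]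

lemma vproj_mul_loop (hd : d.src = d.tgt) :
    vproj d.src * (create d + star (create d)) = create d + star (create d) := by
  have h := congrArg star (create_mul_vproj d)
  rw [star_mul, star_vproj, ← hd] at h
  rw [mul_add, h, vproj_mul_create]

lemma loop_mul_vproj (hd : d.src = d.tgt) :
    (create d + star (create d)) * vproj d.src = create d + star (create d) := by
  have h := congrArg star (vproj_mul_loop hd)
  rwa [star_mul, star_vproj, (isSelfAdjoint_create_add d).star_eq] at h

/-- The functional calculus of `T_ε` for a loop. -/
def loopCalc (d : DirEdge Λ) : C(gapSet 0 2, ℂ) →⋆ₐ[ℂ] FockOp Λ :=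
  gapCalc (isSelfAdjoint_create_add d) (spectrum_loop d)

lemma vproj_mul_loopCalc (hd : d.src = d.tgt) (g : C(gapSet 0 2, ℂ)) :
    vproj d.src * loopCalc d g = loopCalc d g * vproj d.src := by
  have h : (ContinuousLinearMap.mul ℂ (FockOp Λ) (vproj d.src)).comp
      (gapCalcCLM (isSelfAdjoint_create_add d) (spectrum_loop d)) =
      ((ContinuousLinearMap.mul ℂ (FockOp Λ)).flip (vproj d.src)).comp
        (gapCalcCLM (isSelfAdjoint_create_add d) (spectrum_loop d)) := by
    refine gap_ext fun n => ?_
    change vproj d.src * loopCalc d (gapId _ _ ^ n) = loopCalc d (gapId _ _ ^ n) * vproj d.src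
    rw [loopCalc, gapCalc_pow]
    exact Commute.pow_right ((vproj_mul_loop hd).trans (loop_mul_vproj hd).symm) n
  exact DFunLike.congr_fun h g

/-- The corner of the loop vertex. -/
def loopHom (hd : d.src = d.tgt) : C(unitInterval, ℂ) →⋆ₙₐ[ℂ] FockOp Λ where
  toFun f := vproj d.src * loopCalc d (f.comp loopParam)
  map_smul' c f := by
    have : (c • f).comp loopParam = c • f.comp loopParam := rfl
    rw [this, map_smul, mul_smul_comm]; rfl
  map_zero' := by
    have : (0 : C(unitInterval, ℂ)).comp loopParam = 0 := rfl
    rw [this, map_zero, mul_zero]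
  map_add' f g := by
    have : (f + g).comp loopParam = f.comp loopParam + g.comp loopParam := rfl
    rw [this, map_add, mul_add]
  map_mul' f g := by
    have : (f * g).comp loopParam = f.comp loopParam * g.comp loopParam := rfl
    rw [this, map_mul, mul_assoc, ← mul_assoc _ (vproj d.src), ← vproj_mul_loopCalc hd,
      ← mul_assoc, ← mul_assoc, ← mul_assoc, vproj_mul_self]
  map_star' f := by
    have : (star f).comp loopParam = star (f.comp loopParam) := rfl
    rw [this, map_star, star_mul, star_vproj, ← map_star, vproj_mul_loopCalc hd]

lemma loopHom_apply (hd : d.src = d.tgt) (f : C(unitInterval, ℂ)) :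
    loopHom hd f = vproj d.src * loopCalc d (f.comp loopParam) := rfl

/-- The model of `𝓢_ε` for a loop. -/
def loopModel (hd : d.src = d.tgt) :
    C(unitInterval, ℂ) × C₀({v : Λ.vertexSet // v ≠ d.src}, ℂ) →⋆ₙₐ[ℂ] FockOp Λ :=
  prodHom (loopHom hd) (restHom fun v => v ≠ d.src)
    (fun f c => by
      rw [loopHom_apply, vproj_mul_loopCalc hd, mul_assoc, vproj_mul_restHom (by simp), mul_zero])
    (fun f c => by
      rw [loopHom_apply, ← mul_assoc, restHom_mul_vproj (by simp), zero_mul])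

lemma loopModel_apply (hd : d.src = d.tgt)
    (b : C(unitInterval, ℂ) × C₀({v : Λ.vertexSet // v ≠ d.src}, ℂ)) :
    loopModel hd b = vproj d.src * loopCalc d (b.1.comp loopParam) +
      restHom (fun v => v ≠ d.src) b.2 := rfl

lemma vacState_loopModel_self (hd : d.src = d.tgt)
    (b : C(unitInterval, ℂ) × C₀({v : Λ.vertexSet // v ≠ d.src}, ℂ)) :
    vacState d.src (loopModel hd b) = ∫ t, b.1 t := by
  rw [loopModel_apply, map_add, vacState_vproj_mul, vacState_restHom_of_neg (by simp), add_zero]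
  refine (vacState_loop hd _).trans ?_
  simp only [ContinuousMap.comp_apply, loopParam_loopPoint]

lemma vacState_loopModel_of_ne (hd : d.src = d.tgt)
    (b : C(unitInterval, ℂ) × C₀({v : Λ.vertexSet // v ≠ d.src}, ℂ))
    {v : Λ.vertexSet} (hv : v ≠ d.src) : vacState v (loopModel hd b) = b.2 ⟨v, hv⟩ := by
  rw [loopModel_apply, map_add, vacState_vproj_mul_of_ne hv, vacState_restHom_of_pos (P := fun v => v ≠ d.src) hv,
    zero_add]

/-- On `b* b` the vacuum state of the loop vertex is `∫ |f|²`, and the states of the other vertices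
recover the second component. -/
lemma loopModel_injective (hd : d.src = d.tgt) : Function.Injective (loopModel hd) := by
  refine (injective_iff_map_eq_zero (loopModel hd)).2 fun b hb => ?_
  have h1 : loopModel hd (star b * b) = 0 := by rw [map_mul, hb, mul_zero]
  refine Prod.ext ?_ ?_
  · refine eq_zero_of_integral_normSq _ ?_
    rw [← map_zero (vacState d.src), ← h1, vacState_loopModel_self]
    rfl
  · ext ⟨v, hv⟩
    rw [← vacState_loopModel_of_ne hd b hv, hb, map_zero]
    rfl

lemma loopModel_const (hd : d.src = d.tgt) (c : C₀(Λ.vertexSet, ℂ)) :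
    loopModel hd (ContinuousMap.const _ (c d.src), restrictZero _ c) = leftHom Λ c := by
  have h1 : (ContinuousMap.const unitInterval (c d.src)).comp loopParam =
      c d.src • (1 : C(gapSet 0 2, ℂ)) := by
    ext z; simp
  rw [loopModel_apply, h1, map_smul, map_one, mul_smul_comm, mul_one, ← map_smul, restHom_apply,
    ← map_add]
  congr 1
  ext v
  change c d.src * vertexProj d.src v + extZero (fun v => v ≠ d.src) _ v = c v
  rw [vertexProj_apply]
  by_cases hv : v = d.src
  · rw [if_pos hv, extZero_apply_of_neg (by simpa using hv), hv]; simp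
  · rw [if_neg hv, extZero_apply_of_pos (P := fun v => v ≠ d.src) hv, restrictZero_apply]; simp

lemma edgeOp_loop (hd : d.src = d.tgt) : edgeOp μ d = create d + star (create d) := if_pos hd

lemma loopModel_point (hd : d.src = d.tgt) :
    loopModel hd ((gapId 0 2).comp loopPoint, 0) = edgeOp μ d := by
  have h1 : ((gapId 0 2).comp loopPoint).comp loopParam = gapId 0 2 := by
    ext z; simp [loopPoint_loopParam]
  rw [loopModel_apply, h1, loopCalc, gapCalc_id, vproj_mul_loop hd, edgeOp_loop hd, map_zero,
    add_zero]

lemma loopModel_mem (hd : d.src = d.tgt)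
    (b : C(unitInterval, ℂ) × C₀({v : Λ.vertexSet // v ≠ d.src}, ℂ)) :
    loopModel hd b ∈ edgeAlg μ d := by
  rw [loopModel_apply]
  refine add_mem (mul_gapCalc_mem _ _ isClosed_edgeAlg (leftHom_mem _) ?_ _) (leftHom_mem _)
  rw [← edgeOp_loop (μ := μ) hd]
  exact edgeOp_mem

lemma isClosed_range_loopModel (hd : d.src = d.tgt) : IsClosed (Set.range (loopModel hd)) :=
  isClosed_range_of_injective (loopModel hd) (loopModel_injective hd)

theorem exists_loop_equiv (hd : d.src = d.tgt) :
    ∃ φ : edgeAlg μ d ≃⋆ₐ[ℂ] C(unitInterval, ℂ) × C₀({v : Λ.vertexSet // v ≠ d.src}, ℂ),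
      (∀ c, φ (incl μ d c) = (ContinuousMap.const _ (c d.src), restrictZero _ c)) ∧
      ∀ x : edgeAlg μ d, loopModel hd (φ x) = x :=
  exists_equiv_of_model (loopModel hd) (loopModel_injective hd) (isClosed_range_loopModel hd)
    (loopModel_mem hd) (fun c => (ContinuousMap.const _ (c d.src), restrictZero _ c))
    (loopModel_const hd) ⟨_, loopModel_point hd⟩

/-- The model is commutative, so every vacuum state is tracial by itself. -/
lemma tracialData_loop (hd : d.src = d.tgt) : TracialData μ (edgeAlg μ d) {d.src} := by
  obtain ⟨φ, -, h⟩ := exists_loop_equiv (μ := μ) hd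
  have h1 : ∀ x : edgeAlg μ d, vacState d.src (x : FockOp Λ) = ∫ t, (φ x).1 t := fun x => by
    rw [← vacState_loopModel_self hd, h]
  have h2 : ∀ (x : edgeAlg μ d) (v : Λ.vertexSet) (hv : v ≠ d.src),
      vacState v (x : FockOp Λ) = (φ x).2 ⟨v, hv⟩ := fun x v hv => by
    rw [← vacState_loopModel_of_ne hd _ hv, h]
  refine ⟨leftHom_mem, fun x hx => ⟨extZero _ (φ ⟨x, hx⟩).2, fun v hv => ?_⟩, fun z hz v hv => ?_,
    fun z hz => ?_⟩
  · have hv' : v ≠ d.src := by simpa using hv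
    rw [extZero_apply_of_pos (P := fun v => v ≠ d.src) hv']
    exact h2 ⟨x, hx⟩ v hv'
  · have hv' : v ≠ d.src := by simpa using hv
    have h3 := h2 (star ⟨z, hz⟩ * ⟨z, hz⟩) v hv'
    have h4 := h2 (⟨z, hz⟩ * star ⟨z, hz⟩) v hv'
    rw [map_mul, mul_comm, ← map_mul] at h3
    exact h3.trans h4.symm
  · rw [Finset.sum_singleton, Finset.sum_singleton]
    have h3 := h1 (star ⟨z, hz⟩ * ⟨z, hz⟩)
    have h4 := h1 (⟨z, hz⟩ * star ⟨z, hz⟩)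
    rw [map_mul, mul_comm (φ _), ← map_mul] at h3
    exact congrArg _ (h3.trans h4.symm)

end Loop

end FreeGraph

end

noncomputable section

/-! ## Graded matrices of functions of `T_ε` -/

namespace FreeGraph

section Graded

variable {k₀ k₁ : ℝ}

/-- A matrix of functions on a gap set whose diagonal entries are even and whose off-diagonal
entries are odd. -/
structure IsGraded (M : Matrix (Fin 2) (Fin 2) C(gapSet k₀ k₁, ℂ)) : Prop where
  even : ∀ i, (M i i).comp (gapNeg k₀ k₁) = M i i
  odd : ∀ i j, i ≠ j → (M i j).comp (gapNeg k₀ k₁) = -M i j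

/-- Two orthogonal self-adjoint projections that intertwine to the grading of a self-adjoint `T`
whose spectrum lies in a gap set. -/
structure Grading {A : Type*} [CStarAlgebra A] (k₀ k₁ : ℝ) (e : Fin 2 → A) (T : A) : Prop where
  isSelfAdjoint : IsSelfAdjoint T
  spectrum_subset : spectrum ℂ T ⊆ gapSet k₀ k₁
  star_proj : ∀ i, star (e i) = e i
  proj_mul_self : ∀ i, e i * e i = e i
  proj_mul_of_ne : ∀ i j, i ≠ j → e i * e j = 0
  proj_add : ∀ i, e i * T + T * e i = T

namespace Grading

variable {A : Type*} [CStarAlgebra A] {e : Fin 2 → A} {T : A} (h : Grading k₀ k₁ e T)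

/-- The functional calculus of `T`. -/
abbrev fcalc : C(gapSet k₀ k₁, ℂ) →⋆ₐ[ℂ] A := gapCalc h.isSelfAdjoint h.spectrum_subset

include h

lemma proj_mul_even (i : Fin 2) {g : C(gapSet k₀ k₁, ℂ)} (hg : g.comp (gapNeg k₀ k₁) = g) :
    e i * h.fcalc g = h.fcalc g * e i :=
  commute_gapCalc_of_even _ _ (h.proj_mul_self i) (h.proj_add i) hg

/-- Off-diagonality with respect to both projections shows that each side equals `e i * g(T) * e j`.
-/
lemma proj_mul_odd {i j : Fin 2} (hij : i ≠ j) {g : C(gapSet k₀ k₁, ℂ)}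
    (hg : g.comp (gapNeg k₀ k₁) = -g) : e i * h.fcalc g = h.fcalc g * e j := by
  have h1 := add_gapCalc_of_odd h.isSelfAdjoint h.spectrum_subset (h.proj_mul_self i)
    (h.proj_add i) hg
  have h2 := add_gapCalc_of_odd h.isSelfAdjoint h.spectrum_subset (h.proj_mul_self j)
    (h.proj_add j) hg
  have h3 := congrArg (· * e j) h1
  have h4 := congrArg (e i * ·) h2
  simp only [add_mul, mul_add] at h3 h4
  rw [mul_assoc _ (e i), h.proj_mul_of_ne i j hij, mul_zero, add_zero] at h3
  rw [← mul_assoc, h.proj_mul_of_ne i j hij, zero_mul, zero_add, ← mul_assoc] at h4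
  exact h4.symm.trans h3

lemma proj_mul_entry {M : Matrix (Fin 2) (Fin 2) C(gapSet k₀ k₁, ℂ)} (hM : IsGraded M)
    (i j : Fin 2) : e i * h.fcalc (M i j) = h.fcalc (M i j) * e j := by
  by_cases hij : i = j
  · subst hij
    exact h.proj_mul_even i (hM.even i)
  · exact h.proj_mul_odd hij (hM.odd i j hij)

/-- The operator of a graded matrix. -/
def gradedMap (M : Matrix (Fin 2) (Fin 2) C(gapSet k₀ k₁, ℂ)) : A :=
  ∑ i, ∑ j, e i * h.fcalc (M i j)

/-- Passing an entry `M i j` turns `e i` into `e j`, so the products contract like matrix units.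
Only the left factor has to be graded. -/
lemma gradedMap_mul {M N : Matrix (Fin 2) (Fin 2) C(gapSet k₀ k₁, ℂ)} (hM : IsGraded M) :
    h.gradedMap (M * N) = h.gradedMap M * h.gradedMap N := by
  have key : ∀ i j k l, e i * h.fcalc (M i j) * (e k * h.fcalc (N k l)) =
      if j = k then e i * h.fcalc (M i j * N k l) else 0 := by
    intro i j k l
    rw [h.proj_mul_entry hM, mul_assoc, ← mul_assoc (e j)]
    split_ifs with hjk
    · subst hjk
      rw [h.proj_mul_self, ← mul_assoc, ← h.proj_mul_entry hM, mul_assoc, map_mul]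
    · rw [h.proj_mul_of_ne _ _ hjk, zero_mul, mul_zero]
  simp only [gradedMap, Finset.mul_sum, Finset.sum_mul, key, Matrix.mul_apply,
    map_sum]
  simp only [Fin.sum_univ_two]
  simp
  abel

lemma gradedMap_star {M : Matrix (Fin 2) (Fin 2) C(gapSet k₀ k₁, ℂ)}
    (hM : IsGraded (star M)) : h.gradedMap (star M) = star (h.gradedMap M) := by
  have key : ∀ i j, e i * h.fcalc ((star M) i j) = star (e j * h.fcalc (M j i)) := by
    intro i j
    rw [h.proj_mul_entry hM, star_mul, h.star_proj, ← map_star]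
    rfl
  simp only [gradedMap, key, star_sum]
  exact Finset.sum_comm

/-- The *-homomorphism defined by a *-homomorphism into graded matrices. -/
def gradedHom {B : Type*} [NonUnitalNonAssocSemiring B] [Module ℂ B] [Star B]
    (G : B →⋆ₙₐ[ℂ] Matrix (Fin 2) (Fin 2) C(gapSet k₀ k₁, ℂ)) (hG : ∀ b, IsGraded (G b)) :
    B →⋆ₙₐ[ℂ] A where
  toFun b := h.gradedMap (G b)
  map_smul' c b := by
    simp only [map_smul, gradedMap, Matrix.smul_apply, mul_smul_comm, Finset.smul_sum]
    rfl
  map_zero' := by simp [gradedMap]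
  map_add' b b' := by
    simp only [map_add, gradedMap, Matrix.add_apply, mul_add, Finset.sum_add_distrib]
  map_mul' b b' := by rw [map_mul, h.gradedMap_mul (hG b)]
  map_star' b := by
    rw [map_star, h.gradedMap_star]
    rw [← map_star]
    exact hG _

lemma gradedMap_mem {S : NonUnitalStarSubalgebra ℂ A} (hS : IsClosed (S : Set A))
    (he : ∀ i, e i ∈ S) (hT : T ∈ S) (M : Matrix (Fin 2) (Fin 2) C(gapSet k₀ k₁, ℂ)) :
    h.gradedMap M ∈ S :=
  sum_mem fun i _ => sum_mem fun _ _ => mul_gapCalc_mem _ _ hS (he i) hT _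

end Grading

/-- The sign of a point of a gap set. -/
def gapSign (z : gapSet k₀ k₁) : ℂ := (Real.sign (z : ℂ).re : ℂ)

lemma gapSign_neg (z : gapSet k₀ k₁) : gapSign (gapNeg k₀ k₁ z) = -gapSign z := by
  simp [gapSign, coe_gapNeg, Real.sign_neg]

lemma gapSign_of_re_eq_zero {z : gapSet k₀ k₁} (hz : (z : ℂ).re = 0) : gapSign z = 0 := by
  simp [gapSign, hz]

lemma gapSign_mul_self {z : gapSet k₀ k₁} (hz : (z : ℂ).re ≠ 0) : gapSign z * gapSign z = 1 := by
  rcases Real.sign_apply_eq_of_ne_zero _ hz with h | h <;> simp [gapSign, h]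

lemma gapSign_cube (z : gapSet k₀ k₁) : gapSign z * gapSign z * gapSign z = gapSign z := by
  by_cases hz : (z : ℂ).re = 0
  · simp [gapSign_of_re_eq_zero hz]
  · rw [gapSign_mul_self hz, one_mul]

lemma star_gapSign (z : gapSet k₀ k₁) : star (gapSign z) = gapSign z := Complex.conj_ofReal _

lemma gapSign_mul_abs (z : gapSet k₀ k₁) : gapSign z * (|(z : ℂ).re| : ℝ) = z := by
  rw [gapSet_eq_re z, gapSign, ← Complex.ofReal_mul, Complex.ofReal_re]
  congr 1
  rcases lt_trichotomy (z : ℂ).re 0 with h | h | h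
  · rw [Real.sign_of_neg h, abs_of_neg h]; ring
  · simp [h]
  · rw [Real.sign_of_pos h, abs_of_pos h]; ring

/-- A positive gap isolates `0`, and on the gap set the sign agrees with `t / k₀` truncated to `[-1,
1]`. -/
lemma continuous_gapSign (hk : 0 < k₀) : Continuous (gapSign : gapSet k₀ k₁ → ℂ) := by
  have h1 : (gapSign : gapSet k₀ k₁ → ℂ) =
      fun z : gapSet k₀ k₁ => ((max (-1) (min 1 ((z : ℂ).re / k₀)) : ℝ) : ℂ) := by
    funext z
    rw [gapSign]
    congr 1
    rcases z.2.2.1 with h | h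
    · simp [h]
    · rcases le_total 0 (z : ℂ).re with h0 | h0
      · rw [abs_of_nonneg h0] at h
        rw [Real.sign_of_pos (hk.trans_le h), min_eq_left ((one_le_div hk).2 h)]
        norm_num
      · rw [abs_of_nonpos h0] at h
        have h2 : (z : ℂ).re / k₀ ≤ -1 := by rw [div_le_iff₀ hk]; linarith
        rw [Real.sign_of_neg (by linarith), min_eq_right (by linarith), max_eq_left h2]
  rw [h1]
  have h2 : Continuous fun z : gapSet k₀ k₁ => (z : ℂ).re :=
    Complex.continuous_re.comp continuous_subtype_val
  exact Complex.continuous_ofReal.comp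
    (continuous_const.max (continuous_const.min (h2.div_const _)))

/-- The substitute for continuity of the sign when the gap closes: a factor that vanishes over `0`
removes the jump. This is where the boundary condition of `𝓓` enters. -/
lemma continuous_gapSign_mul {g : gapSet k₀ k₁ → ℂ} (hg : Continuous g)
    (h0 : ∀ z : gapSet k₀ k₁, (z : ℂ).re = 0 → g z = 0) :
    Continuous fun z => gapSign z * g z := by
  have h1 : (fun z => gapSign z * g z) = fun z : gapSet k₀ k₁ => if 0 ≤ (z : ℂ).re then g z else -g z := by
    funext z
    split_ifs with h
    · rcases h.eq_or_lt with h | h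
      · rw [h0 z h.symm, mul_zero]
      · rw [gapSign, Real.sign_of_pos h]; simp
    · rw [gapSign, Real.sign_of_neg (not_le.1 h)]; simp
  rw [h1]
  have h2 : Continuous fun z : gapSet k₀ k₁ => (z : ℂ).re :=
    Complex.continuous_re.comp continuous_subtype_val
  exact hg.if_le hg.neg continuous_const h2 fun z hz => by rw [h0 z hz.symm, neg_zero]

lemma continuous_entry (i j : Fin 2) (f : C(unitInterval, Matrix (Fin 2) (Fin 2) ℂ))
    (κ : C(gapSet k₀ k₁, unitInterval)) : Continuous fun z => f (κ z) i j :=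
  (continuous_apply_apply i j).comp (f.continuous.comp κ.continuous)

/-- Matrix functions on `[0, 1]` as graded matrices on the nonzero part of a gap set. -/
def splitMatrix (hk : 0 < k₀) (κ : C(gapSet k₀ k₁, unitInterval)) :
    C(unitInterval, Matrix (Fin 2) (Fin 2) ℂ) →⋆ₙₐ[ℂ] Matrix (Fin 2) (Fin 2) C(gapSet k₀ k₁, ℂ) where
  toFun f := Matrix.of fun i j =>
    ⟨fun z => (if i = j then gapSign z * gapSign z else gapSign z) * f (κ z) i j, by
      have h1 := continuous_gapSign (k₁ := k₁) hk
      have h2 := continuous_entry i j f κ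
      split_ifs
      · exact (h1.mul h1).mul h2
      · exact h1.mul h2⟩
  map_smul' c f := by
    ext i j z
    exact mul_left_comm _ _ _
  map_zero' := by
    ext i j z
    exact mul_zero _
  map_add' f g := by
    ext i j z
    exact mul_add _ _ _
  map_mul' f g := by
    ext i j z
    -- Multiplicativity rests on `σ³ = σ` for the sign `σ`: the square of the sign is the indicator
    -- of the nonzero points, so at `0` both sides vanish.
    have h3 := gapSign_cube z
    rw [Matrix.mul_apply, ContinuousMap.sum_apply]
    change (if i = j then gapSign z * gapSign z else gapSign z) * (f (κ z) * g (κ z)) i j =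
      ∑ k, ((if i = k then gapSign z * gapSign z else gapSign z) * f (κ z) i k) *
        ((if k = j then gapSign z * gapSign z else gapSign z) * g (κ z) k j)
    rw [Matrix.mul_apply]
    fin_cases i <;> fin_cases j <;> simp [Fin.sum_univ_two]
    · linear_combination -(gapSign z * f (κ z) 0 0 * g (κ z) 0 0) * h3
    · linear_combination -(f (κ z) 0 0 * g (κ z) 0 1 + f (κ z) 0 1 * g (κ z) 1 1) * h3
    · linear_combination -(f (κ z) 1 0 * g (κ z) 0 0 + f (κ z) 1 1 * g (κ z) 1 0) * h3
    · linear_combination -(gapSign z * f (κ z) 1 1 * g (κ z) 1 1) * h3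
  map_star' f := by
    ext i j z
    change (if i = j then gapSign z * gapSign z else gapSign z) * star (f (κ z) j i) =
      star ((if j = i then gapSign z * gapSign z else gapSign z) * f (κ z) j i)
    rw [star_mul']
    congr 1
    simp only [eq_comm (a := j)]
    split_ifs <;> simp only [star_mul', star_gapSign]

lemma splitMatrix_apply (hk : 0 < k₀) (κ : C(gapSet k₀ k₁, unitInterval))
    (f : C(unitInterval, Matrix (Fin 2) (Fin 2) ℂ)) (i j : Fin 2) (z : gapSet k₀ k₁) :
    splitMatrix hk κ f i j z =
      (if i = j then gapSign z * gapSign z else gapSign z) * f (κ z) i j := rfl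

lemma isGraded_splitMatrix (hk : 0 < k₀) {κ : C(gapSet k₀ k₁, unitInterval)}
    (hκ : ∀ z, κ (gapNeg k₀ k₁ z) = κ z) (f : C(unitInterval, Matrix (Fin 2) (Fin 2) ℂ)) :
    IsGraded (splitMatrix hk κ f) where
  even i := by
    ext z
    rw [ContinuousMap.comp_apply, splitMatrix_apply, splitMatrix_apply, hκ, gapSign_neg]
    simp
  odd i j hij := by
    ext z
    rw [ContinuousMap.comp_apply, ContinuousMap.neg_apply, splitMatrix_apply, splitMatrix_apply, hκ,
      gapSign_neg]
    simp [hij]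

/-- The elements of `𝓓` as graded matrices on a gap set. -/
def gluedMatrix (κ : C(gapSet k₀ k₁, unitInterval))
    (h0 : ∀ z : gapSet k₀ k₁, (z : ℂ).re = 0 → κ z = 0) :
    diagAtZero →⋆ₙₐ[ℂ] Matrix (Fin 2) (Fin 2) C(gapSet k₀ k₁, ℂ) where
  toFun f := Matrix.of fun i j =>
    ⟨fun z => (if i = j then 1 else gapSign z) * f.1 (κ z) i j, by
      have h2 := continuous_entry i j f.1 κ
      split_ifs with h
      · exact continuous_const.mul h2
      · exact continuous_gapSign_mul h2 fun z hz => by rw [h0 z hz]; exact f.2 h⟩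
  map_smul' c f := by
    ext i j z
    exact mul_left_comm _ _ _
  map_zero' := by
    ext i j z
    exact mul_zero _
  map_add' f g := by
    ext i j z
    exact mul_add _ _ _
  map_mul' f g := by
    ext i j z
    rw [Matrix.mul_apply, ContinuousMap.sum_apply]
    change (if i = j then 1 else gapSign z) * (f.1 (κ z) * g.1 (κ z)) i j =
      ∑ k, ((if i = k then 1 else gapSign z) * f.1 (κ z) i k) *
        ((if k = j then 1 else gapSign z) * g.1 (κ z) k j)
    rw [Matrix.mul_apply]
    -- Over `0` both matrices are diagonal, and elsewhere the sign squares to one.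
    by_cases hz : (z : ℂ).re = 0
    · have hf : (f.1 (κ z)).IsDiag := by rw [h0 z hz]; exact f.2
      have hg : (g.1 (κ z)).IsDiag := by rw [h0 z hz]; exact g.2
      have hf0 : f.1 (κ z) 0 1 = 0 := hf zero_ne_one
      have hf1 : f.1 (κ z) 1 0 = 0 := hf one_ne_zero
      have hg0 : g.1 (κ z) 0 1 = 0 := hg zero_ne_one
      have hg1 : g.1 (κ z) 1 0 = 0 := hg one_ne_zero
      fin_cases i <;> fin_cases j <;> simp [Fin.sum_univ_two, hf0, hf1, hg0, hg1]
    · have h3 := gapSign_mul_self hz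
      fin_cases i <;> fin_cases j <;> simp [Fin.sum_univ_two]
      · linear_combination -(f.1 (κ z) 0 1 * g.1 (κ z) 1 0) * h3
      · ring
      · ring
      · linear_combination -(f.1 (κ z) 1 0 * g.1 (κ z) 0 1) * h3
  map_star' f := by
    ext i j z
    change (if i = j then 1 else gapSign z) * star (f.1 (κ z) j i) =
      star ((if j = i then 1 else gapSign z) * f.1 (κ z) j i)
    rw [star_mul']
    congr 1
    simp only [eq_comm (a := j)]
    split_ifs <;> simp only [star_one, star_gapSign]

lemma gluedMatrix_apply (κ : C(gapSet k₀ k₁, unitInterval))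
    (h0 : ∀ z : gapSet k₀ k₁, (z : ℂ).re = 0 → κ z = 0)
    (f : diagAtZero) (i j : Fin 2) (z : gapSet k₀ k₁) :
    gluedMatrix κ h0 f i j z = (if i = j then 1 else gapSign z) * f.1 (κ z) i j := rfl

lemma isGraded_gluedMatrix {κ : C(gapSet k₀ k₁, unitInterval)}
    (h0 : ∀ z : gapSet k₀ k₁, (z : ℂ).re = 0 → κ z = 0)
    (hκ : ∀ z, κ (gapNeg k₀ k₁ z) = κ z) (f : diagAtZero) :
    IsGraded (gluedMatrix κ h0 f) where
  even i := by
    ext z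
    rw [ContinuousMap.comp_apply, gluedMatrix_apply, gluedMatrix_apply, hκ]
    simp
  odd i j hij := by
    ext z
    rw [ContinuousMap.comp_apply, ContinuousMap.neg_apply, gluedMatrix_apply, gluedMatrix_apply, hκ,
      gapSign_neg]
    simp [hij]

end Graded

end FreeGraph

end

noncomputable section

/-! ## The null space of `T_ε` and the vacuum states of graded matrices -/

namespace FreeGraph

section Null

variable {k₀ k₁ : ℝ}

/-- The indicator function of `0` on a gap set. -/
def gapNull (k₁ : ℝ) (hk : 0 < k₀) : C(gapSet k₀ k₁, ℂ) where
  toFun z := 1 - gapSign z * gapSign z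
  continuous_toFun :=
    continuous_const.sub ((continuous_gapSign hk).mul (continuous_gapSign hk))

lemma gapNull_apply (hk : 0 < k₀) (z : gapSet k₀ k₁) :
    gapNull k₁ hk z = 1 - gapSign z * gapSign z := rfl

lemma gapNull_mul_self (hk : 0 < k₀) : gapNull k₁ hk * gapNull k₁ hk = gapNull k₁ hk := by
  ext z
  rw [ContinuousMap.mul_apply, gapNull_apply]
  linear_combination gapSign z * gapSign_cube z

lemma star_gapNull (hk : 0 < k₀) : star (gapNull k₁ hk) = gapNull k₁ hk := by
  ext z
  rw [ContinuousMap.star_apply, gapNull_apply, star_sub, star_mul', star_gapSign, star_one]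

lemma gapNull_comp_neg (hk : 0 < k₀) :
    (gapNull k₁ hk).comp (gapNeg k₀ k₁) = gapNull k₁ hk := by
  ext z
  rw [ContinuousMap.comp_apply, gapNull_apply, gapNull_apply, gapSign_neg, neg_mul_neg]

lemma gapId_mul_gapNull (hk : 0 < k₀) : gapId k₀ k₁ * gapNull k₁ hk = 0 := by
  ext z
  rw [ContinuousMap.mul_apply, gapNull_apply, gapId_apply, ← gapSign_mul_abs,
    ContinuousMap.zero_apply]
  linear_combination -((|(z : ℂ).re| : ℝ) : ℂ) * gapSign_cube z

lemma splitMatrix_mul_gapNull (hk : 0 < k₀) (κ : C(gapSet k₀ k₁, unitInterval))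
    (f : C(unitInterval, Matrix (Fin 2) (Fin 2) ℂ)) (i j : Fin 2) :
    splitMatrix hk κ f i j * gapNull k₁ hk = 0 := by
  ext z
  rw [ContinuousMap.mul_apply, gapNull_apply, splitMatrix_apply, ContinuousMap.zero_apply]
  split_ifs
  · linear_combination -(gapSign z * f (κ z) i j) * gapSign_cube z
  · linear_combination -(f (κ z) i j) * gapSign_cube z

namespace Grading

variable {A : Type*} [CStarAlgebra A] {e : Fin 2 → A} {T : A} (h : Grading k₀ k₁ e T)
include h

lemma proj_mul_null (hk : 0 < k₀) (i : Fin 2) :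
    e i * h.fcalc (gapNull k₁ hk) = h.fcalc (gapNull k₁ hk) * e i :=
  h.proj_mul_even i (gapNull_comp_neg hk)

lemma null_mul_null (hk : 0 < k₀) :
    h.fcalc (gapNull k₁ hk) * h.fcalc (gapNull k₁ hk) = h.fcalc (gapNull k₁ hk) := by
  rw [← map_mul, gapNull_mul_self]

lemma star_null (hk : 0 < k₀) : star (h.fcalc (gapNull k₁ hk)) = h.fcalc (gapNull k₁ hk) := by
  rw [← map_star, star_gapNull]

lemma mul_null (hk : 0 < k₀) : T * h.fcalc (gapNull k₁ hk) = 0 := by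
  have h1 : h.fcalc (gapId k₀ k₁ * gapNull k₁ hk) = 0 := by rw [gapId_mul_gapNull, map_zero]
  rwa [map_mul, gapCalc_id] at h1

lemma isStarProjection_proj_mul_null (hk : 0 < k₀) (i : Fin 2) :
    IsStarProjection (e i * h.fcalc (gapNull k₁ hk)) where
  isIdempotentElem := by
    change e i * h.fcalc (gapNull k₁ hk) * (e i * h.fcalc (gapNull k₁ hk)) = _
    rw [mul_assoc, ← mul_assoc _ (e i), ← h.proj_mul_null hk, mul_assoc (e i), h.null_mul_null,
      ← mul_assoc, h.proj_mul_self]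
  isSelfAdjoint := by
    change star _ = _
    rw [star_mul, h.star_proj, h.star_null, h.proj_mul_null hk]

lemma gradedMap_mul_null (hk : 0 < k₀) (κ : C(gapSet k₀ k₁, unitInterval))
    (f : C(unitInterval, Matrix (Fin 2) (Fin 2) ℂ)) :
    h.gradedMap (splitMatrix hk κ f) * h.fcalc (gapNull k₁ hk) = 0 := by
  simp only [gradedMap, Finset.sum_mul, mul_assoc, ← map_mul, splitMatrix_mul_gapNull, map_zero,
    mul_zero, Finset.sum_const_zero]

lemma null_mul_gradedMap (hk : 0 < k₀) (κ : C(gapSet k₀ k₁, unitInterval))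
    (f : C(unitInterval, Matrix (Fin 2) (Fin 2) ℂ)) :
    h.fcalc (gapNull k₁ hk) * h.gradedMap (splitMatrix hk κ f) = 0 := by
  simp only [gradedMap, Finset.mul_sum, ← mul_assoc, ← h.proj_mul_null hk]
  simp only [mul_assoc, ← map_mul, mul_comm (gapNull k₁ hk), splitMatrix_mul_gapNull, map_zero,
    mul_zero, Finset.sum_const_zero]

/-- The off-diagonal graded matrix of the coordinate function represents `T`. -/
lemma gradedMap_gapId {M : Matrix (Fin 2) (Fin 2) C(gapSet k₀ k₁, ℂ)}
    (hT : e 0 * T + e 1 * T = T) (h0 : ∀ i, M i i = 0) (h1 : ∀ i j, i ≠ j → M i j = gapId k₀ k₁) :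
    h.gradedMap M = T := by
  simp only [gradedMap, Fin.sum_univ_two, h0, h1 0 1 zero_ne_one, h1 1 0 one_ne_zero, map_zero,
    mul_zero, zero_add, add_zero, gapCalc_id, hT]

end Grading

end Null

section Edge

variable {V E : Type*} {Λ : Graph V E} [TopologicalSpace V] [DiscreteTopology V]
  {d : DirEdge Λ} {a : ℝ}

lemma edgeGrading (hd : d.src ≠ d.tgt) (ha : 1 ≤ a) :
    Grading (a - a⁻¹) (a + a⁻¹) ![vproj d.src, vproj d.tgt]
      (edgeComb a (create d) (create d.op)) where
  isSelfAdjoint := isSelfAdjoint_edgeComb _ _ _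
  spectrum_subset := (edgeRel_create hd).spectrum_comb ha
  star_proj i := by fin_cases i <;> exact star_vproj _
  proj_mul_self i := by fin_cases i <;> exact vproj_mul_self _
  proj_mul_of_ne i j hij := by
    fin_cases i <;> fin_cases j
    · exact absurd rfl hij
    · exact vproj_mul_vproj_of_ne hd
    · exact vproj_mul_vproj_of_ne hd.symm
    · exact absurd rfl hij
  proj_add i := by
    fin_cases i
    · exact (edgeRel_create hd).left_comb_add
    · exact (edgeRel_create hd).right_comb_add

lemma edgeGrading_mul (hd : d.src ≠ d.tgt) :
    vproj d.src * edgeComb a (create d) (create d.op) +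
      vproj d.tgt * edgeComb a (create d) (create d.op) = edgeComb a (create d) (create d.op) := by
  rw [(edgeRel_create hd).left_mul_comb, (edgeRel_create hd).right_mul_comb, ← edgeComb_eq]

/-- `T_ε` is injective on the range of the projection of the vertex with the smaller weight. -/
lemma EdgeRel.right_mul_eq_zero {A : Type*} [CStarAlgebra A] {p q V W n : A}
    (h : EdgeRel p q V W) (ha : 1 < a) (hn : IsStarProjection n) (hqn : q * n = n * q)
    (hTn : edgeComb a V W * n = 0) : q * n = 0 := by
  let _ := CStarAlgebra.spectralOrder A
  have _ := CStarAlgebra.spectralOrderedRing A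
  have hqq := h.isStarProjection_right.isIdempotentElem.eq
  have hnn := hn.isIdempotentElem.eq
  have hk : 0 < (a - a⁻¹) ^ 2 := by
    have : a⁻¹ < 1 := inv_lt_one_of_one_lt₀ ha
    have : 0 < a - a⁻¹ := by linarith
    positivity
  have hX : edgeCorner a V W * n = 0 := by
    rw [← h.left_mul_comb, mul_assoc, hTn, mul_zero]
  -- Compressing `X*X - m q ≥ 0` by `n`, which `X` annihilates, leaves `-m q n ≥ 0` with `m > 0`,
  -- while `q n` is a projection.
  have h1 := star_left_conjugate_nonneg (h.star_corner_mul_corner_sub_nonneg ha.le) n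
  rw [hn.isSelfAdjoint.star_eq, mul_sub, sub_mul, mul_assoc, mul_assoc, hX, mul_zero, mul_zero,
    zero_sub, mul_smul_comm, smul_mul_assoc, ← hqn, mul_assoc, hnn, neg_nonneg] at h1
  have h2 : IsStarProjection (q * n) := by
    refine ⟨?_, ?_⟩
    · change q * n * (q * n) = q * n
      rw [mul_assoc, ← mul_assoc n, ← hqn, mul_assoc q n, hnn, ← mul_assoc, hqq]
    · change star _ = _
      rw [star_mul, hn.isSelfAdjoint.star_eq, h.isStarProjection_right.isSelfAdjoint.star_eq, hqn]
  have h3 : 0 ≤ (((a - a⁻¹) ^ 2 : ℝ) : ℂ) • (q * n) :=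
    smul_nonneg (by exact_mod_cast hk.le) h2.nonneg
  have h4 := le_antisymm h1 h3
  exact (smul_eq_zero.1 h4).resolve_left (by exact_mod_cast hk.ne')

lemma tgt_mul_null (hd : d.src ≠ d.tgt) (ha : 1 < a) (hk : 0 < a - a⁻¹) :
    vproj d.tgt * (edgeGrading hd ha.le).fcalc (gapNull _ hk) = 0 :=
  (edgeRel_create hd).right_mul_eq_zero ha
    ⟨(edgeGrading hd ha.le).null_mul_null hk, (edgeGrading hd ha.le).star_null hk⟩
    ((edgeGrading hd ha.le).proj_mul_null hk 1) ((edgeGrading hd ha.le).mul_null hk)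

variable (hd : d.src ≠ d.tgt) (ha : 1 ≤ a)
  {M : Matrix (Fin 2) (Fin 2) C(gapSet (a - a⁻¹) (a + a⁻¹), ℂ)}

/-- The vacuum at the source kills the row of `p_β` from the left and, after the projection has
moved across an odd entry, the off-diagonal term from the right. Only the even entry `M 0 0`
remains, and its state is given by the law. -/
lemma vacState_gradedMap_src (hM : IsGraded M) :
    vacState d.src ((edgeGrading hd ha).gradedMap M) =
      ((1 - (a⁻¹ ^ 2) ^ 2 : ℝ) : ℂ) * M 0 0 (gapZero (top_nonneg ha)) +
      (((a⁻¹ ^ 2) ^ 2 : ℝ) : ℂ) * ∫ s, M 0 0 (edgeRad ha s) := by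
  have h1 := (edgeGrading hd ha).proj_mul_entry hM 0 1
  simp only [Matrix.cons_val_zero, Matrix.cons_val_one] at h1
  simp only [Grading.gradedMap, Fin.sum_univ_two, Matrix.cons_val_zero, Matrix.cons_val_one, map_add,
    vacState_vproj_mul_of_ne hd, add_zero]
  rw [h1, vacState_mul_vproj_of_ne hd, add_zero, vacState_vproj_mul,
    ← edgeMean_of_even ha (hM.even 0)]
  exact vacState_gapCalc_src _ (edgeRel_create hd) ha _

lemma vacState_gradedMap_tgt (hM : IsGraded M) :
    vacState d.tgt ((edgeGrading hd ha).gradedMap M) = ∫ s, M 1 1 (edgeRad ha s) := by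
  have h1 := (edgeGrading hd ha).proj_mul_entry hM 1 0
  simp only [Matrix.cons_val_zero, Matrix.cons_val_one] at h1
  simp only [Grading.gradedMap, Fin.sum_univ_two, Matrix.cons_val_zero, Matrix.cons_val_one, map_add,
    vacState_vproj_mul_of_ne hd.symm, add_zero, zero_add]
  rw [h1, vacState_mul_vproj_of_ne hd.symm, zero_add, vacState_vproj_mul,
    ← edgeMean_of_even ha (hM.even 1)]
  exact vacState_gapCalc_tgt _ (edgeRel_create hd) ha _

lemma vacState_gradedMap_of_ne {v : Λ.vertexSet} (h1 : v ≠ d.src) (h2 : v ≠ d.tgt) :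
    vacState v ((edgeGrading hd ha).gradedMap M) = 0 := by
  simp only [Grading.gradedMap, Fin.sum_univ_two, Matrix.cons_val_zero, Matrix.cons_val_one, map_add,
    vacState_vproj_mul_of_ne h1, vacState_vproj_mul_of_ne h2, add_zero]

lemma restHom_mul_gradedMap (c : C₀({v : Λ.vertexSet // v ≠ d.src ∧ v ≠ d.tgt}, ℂ)) :
    restHom _ c * (edgeGrading hd ha).gradedMap M = 0 := by
  simp only [Grading.gradedMap, Fin.sum_univ_two, Matrix.cons_val_zero, Matrix.cons_val_one, mul_add,
    ← mul_assoc]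
  rw [restHom_mul_vproj (by simp), restHom_mul_vproj (by simp)]
  simp

lemma gradedMap_mul_restHom (hM : IsGraded M)
    (c : C₀({v : Λ.vertexSet // v ≠ d.src ∧ v ≠ d.tgt}, ℂ)) :
    (edgeGrading hd ha).gradedMap M * restHom _ c = 0 := by
  simp only [Grading.gradedMap, (edgeGrading hd ha).proj_mul_entry hM]
  simp only [Fin.sum_univ_two, Matrix.cons_val_zero, Matrix.cons_val_one, add_mul, mul_assoc]
  rw [vproj_mul_restHom (by simp), vproj_mul_restHom (by simp)]
  simp

include hd in
lemma leftHom_eq_add (c : C₀(Λ.vertexSet, ℂ)) :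
    c d.src • vproj d.src + c d.tgt • vproj d.tgt +
      restHom (fun v => v ≠ d.src ∧ v ≠ d.tgt) (restrictZero _ c) = leftHom Λ c := by
  rw [restHom_apply, ← map_smul, ← map_smul, ← map_add, ← map_add]
  congr 1
  ext v
  change c d.src * vertexProj d.src v + c d.tgt * vertexProj d.tgt v +
    extZero (fun v => v ≠ d.src ∧ v ≠ d.tgt) _ v = c v
  rw [vertexProj_apply, vertexProj_apply]
  by_cases h1 : v = d.src
  · rw [if_pos h1, if_neg (h1 ▸ hd), extZero_apply_of_neg (by simp [h1]), h1]; simp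
  · by_cases h2 : v = d.tgt
    · rw [if_neg h1, if_pos h2, extZero_apply_of_neg (by simp [h2]), h2]; simp
    · rw [if_neg h1, if_neg h2,
        extZero_apply_of_pos (P := fun v => v ≠ d.src ∧ v ≠ d.tgt) ⟨h1, h2⟩, restrictZero_apply]
      simp

end Edge

section Integral

/-- The `j`-th diagonal entry of `f* f` is the sum of the squared moduli in the `j`-th column, so
its integral detects that column. -/
lemma eq_zero_of_integral_star_mul (f : C(unitInterval, Matrix (Fin 2) (Fin 2) ℂ)) (j : Fin 2)
    (h : ∫ t, (star (f t) * f t) j j = 0) (t : unitInterval) (i : Fin 2) : f t i j = 0 := by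
  have h1 : ∀ t, (star (f t) * f t) j j = ((∑ i, Complex.normSq (f t i j) : ℝ) : ℂ) := fun t => by
    rw [Matrix.mul_apply, Complex.ofReal_sum]
    refine Finset.sum_congr rfl fun i _ => ?_
    rw [Complex.normSq_eq_conj_mul_self]; rfl
  simp only [h1] at h
  rw [integral_complex_ofReal, Complex.ofReal_eq_zero] at h
  have h2 := eq_zero_of_integral_unitInterval
    (f := ⟨fun t => ∑ i, Complex.normSq (f t i j), continuous_finsetSum _ fun i _ =>
      Complex.continuous_normSq.comp ((continuous_apply_apply i j).comp f.continuous)⟩)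
    (fun t => Finset.sum_nonneg fun i _ => Complex.normSq_nonneg _) h
  have h3 : ∑ i, Complex.normSq (f t i j) = 0 := DFunLike.congr_fun h2 t
  exact Complex.normSq_eq_zero.1
    ((Finset.sum_eq_zero_iff_of_nonneg fun i _ => Complex.normSq_nonneg _).1 h3 i (Finset.mem_univ i))

lemma integrable_entry (f : C(unitInterval, Matrix (Fin 2) (Fin 2) ℂ)) (i j : Fin 2) :
    Integrable fun t => f t i j :=
  integrable_unitInterval ⟨fun t => f t i j, (continuous_apply_apply i j).comp f.continuous⟩

lemma integral_trace (f : C(unitInterval, Matrix (Fin 2) (Fin 2) ℂ)) :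
    ∫ t, (f t).trace = (∫ t, f t 0 0) + ∫ t, f t 1 1 := by
  simp only [Matrix.trace_fin_two]
  exact integral_add (integrable_entry f 0 0) (integrable_entry f 1 1)

lemma integral_trace_mul_comm (f g : C(unitInterval, Matrix (Fin 2) (Fin 2) ℂ)) :
    ∫ t, ((f * g) t).trace = ∫ t, ((g * f) t).trace :=
  integral_congr_ae (Eventually.of_forall fun t => Matrix.trace_mul_comm (f t) (g t))

end Integral

end FreeGraph

end

noncomputable section

/-! ## The algebra of an edge between vertices of different weights -/

namespace FreeGraph

/-- The *-homomorphism on `ℂ` defined by a projection. -/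
def projHom {A : Type*} [CStarAlgebra A] {r : A} (hr : IsStarProjection r) : ℂ →⋆ₙₐ[ℂ] A where
  toFun l := l • r
  map_smul' c l := by rw [smul_assoc]; rfl
  map_zero' := zero_smul _ _
  map_add' l l' := add_smul _ _ _
  map_mul' l l' := by
    rw [smul_mul_smul_comm, hr.isIdempotentElem.eq]
  map_star' l := by rw [star_smul, hr.isSelfAdjoint.star_eq]

lemma projHom_apply {A : Type*} [CStarAlgebra A] {r : A} (hr : IsStarProjection r) (l : ℂ) :
    projHom hr l = l • r := rfl

section Split

variable {V E : Type*} {Λ : Graph V E} [TopologicalSpace V] [DiscreteTopology V]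
  {μ : Λ.vertexSet → ℝ} {d e : DirEdge Λ} {a : ℝ} (he : e.src ≠ e.tgt) (ha : 1 < a)

lemma gap_pos (ha : 1 < a) : 0 < a - a⁻¹ := by
  have : a⁻¹ < 1 := inv_lt_one_of_one_lt₀ ha
  linarith

/-- The matrix summand of `𝓢_ε`. -/
def splitHom : C(unitInterval, Matrix (Fin 2) (Fin 2) ℂ) →⋆ₙₐ[ℂ] FockOp Λ :=
  (edgeGrading he ha.le).gradedHom (splitMatrix (gap_pos ha) (edgeParam ha.le))
    (isGraded_splitMatrix (gap_pos ha) (edgeParam_neg ha.le))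

lemma splitHom_apply (f : C(unitInterval, Matrix (Fin 2) (Fin 2) ℂ)) : splitHom he ha f =
    (edgeGrading he ha.le).gradedMap (splitMatrix (gap_pos ha) (edgeParam ha.le) f) := rfl

lemma isGraded_edgeMatrix (f : C(unitInterval, Matrix (Fin 2) (Fin 2) ℂ)) :
    IsGraded (splitMatrix (gap_pos ha) (edgeParam ha.le) f) :=
  isGraded_splitMatrix (gap_pos ha) (edgeParam_neg ha.le) f

/-- The projection onto the null space of `T_ε` at the vertex with the larger weight. -/
def nullProj : FockOp Λ :=
  vproj e.src * (edgeGrading he ha.le).fcalc (gapNull _ (gap_pos ha))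

lemma isStarProjection_nullProj : IsStarProjection (nullProj he ha) :=
  (edgeGrading he ha.le).isStarProjection_proj_mul_null (gap_pos ha) 0

lemma splitHom_mul_nullProj (f : C(unitInterval, Matrix (Fin 2) (Fin 2) ℂ)) :
    splitHom he ha f * nullProj he ha = 0 := by
  have h := (edgeGrading he ha.le).proj_mul_null (gap_pos ha) 0
  simp only [Matrix.cons_val_zero] at h
  rw [nullProj, h, ← mul_assoc, splitHom_apply, Grading.gradedMap_mul_null, zero_mul]

lemma nullProj_mul_splitHom (f : C(unitInterval, Matrix (Fin 2) (Fin 2) ℂ)) :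
    nullProj he ha * splitHom he ha f = 0 := by
  rw [nullProj, mul_assoc, splitHom_apply, Grading.null_mul_gradedMap, mul_zero]

lemma nullProj_mul_restHom (c : C₀({v : Λ.vertexSet // v ≠ e.src ∧ v ≠ e.tgt}, ℂ)) :
    nullProj he ha * restHom _ c = 0 := by
  have h := (edgeGrading he ha.le).proj_mul_null (gap_pos ha) 0
  simp only [Matrix.cons_val_zero] at h
  rw [nullProj, h, mul_assoc, vproj_mul_restHom (by simp), mul_zero]

lemma restHom_mul_nullProj (c : C₀({v : Λ.vertexSet // v ≠ e.src ∧ v ≠ e.tgt}, ℂ)) :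
    restHom _ c * nullProj he ha = 0 := by
  rw [nullProj, ← mul_assoc, restHom_mul_vproj (by simp), zero_mul]

/-- The scalar summand and the summand of the other vertices. -/
def splitTail : ℂ × C₀({v : Λ.vertexSet // v ≠ e.src ∧ v ≠ e.tgt}, ℂ) →⋆ₙₐ[ℂ] FockOp Λ :=
  prodHom (projHom (isStarProjection_nullProj he ha)) (restHom _)
    (fun l c => by rw [projHom_apply, smul_mul_assoc, nullProj_mul_restHom, smul_zero])
    (fun l c => by rw [projHom_apply, mul_smul_comm, restHom_mul_nullProj, smul_zero])

lemma splitTail_apply (b : ℂ × C₀({v : Λ.vertexSet // v ≠ e.src ∧ v ≠ e.tgt}, ℂ)) :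
    splitTail he ha b = b.1 • nullProj he ha + restHom _ b.2 := rfl

/-- The model of `𝓢_ε` for an edge between vertices of different weights. -/
def splitModel : C(unitInterval, Matrix (Fin 2) (Fin 2) ℂ) × ℂ ×
    C₀({v : Λ.vertexSet // v ≠ e.src ∧ v ≠ e.tgt}, ℂ) →⋆ₙₐ[ℂ] FockOp Λ :=
  prodHom (splitHom he ha) (splitTail he ha)
    (fun f b => by
      rw [splitTail_apply, mul_add, mul_smul_comm, splitHom_mul_nullProj, smul_zero, zero_add,
        splitHom_apply, gradedMap_mul_restHom he ha.le (isGraded_edgeMatrix ha f)])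
    (fun f b => by
      rw [splitTail_apply, add_mul, smul_mul_assoc, nullProj_mul_splitHom, smul_zero, zero_add,
        splitHom_apply, restHom_mul_gradedMap he ha.le])

lemma splitModel_apply (b : C(unitInterval, Matrix (Fin 2) (Fin 2) ℂ) × ℂ ×
    C₀({v : Λ.vertexSet // v ≠ e.src ∧ v ≠ e.tgt}, ℂ)) :
    splitModel he ha b = splitHom he ha b.1 + (b.2.1 • nullProj he ha + restHom _ b.2.2) := rfl

lemma gapSign_edgeRad (s : unitInterval) :
    gapSign (edgeRad ha.le s) * gapSign (edgeRad ha.le s) = 1 := by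
  refine gapSign_mul_self ?_
  rw [coe_edgeRad, Complex.ofReal_re]
  exact ((gap_pos ha).trans_le (le_edgeRadReal ha.le s)).ne'

lemma gapSign_gapZero {k₀ k₁ : ℝ} (hk : 0 ≤ k₁) : gapSign (gapZero (k₀ := k₀) hk) = 0 :=
  gapSign_of_re_eq_zero rfl

lemma splitMatrix_edgeRad (f : C(unitInterval, Matrix (Fin 2) (Fin 2) ℂ)) (i : Fin 2)
    (s : unitInterval) :
    splitMatrix (gap_pos ha) (edgeParam ha.le) f i i (edgeRad ha.le s) = f s i i := by
  rw [splitMatrix_apply, if_pos rfl, gapSign_edgeRad ha, edgeParam_edgeRad, one_mul]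

lemma integral_splitMatrix (f : C(unitInterval, Matrix (Fin 2) (Fin 2) ℂ)) (i : Fin 2) :
    ∫ s, splitMatrix (gap_pos ha) (edgeParam ha.le) f i i (edgeRad ha.le s) = ∫ s, f s i i :=
  integral_congr_ae (Eventually.of_forall fun s => splitMatrix_edgeRad ha f i s)

lemma vacState_nullProj_src :
    vacState e.src (nullProj he ha) = ((1 - (a⁻¹ ^ 2) ^ 2 : ℝ) : ℂ) := by
  rw [nullProj, vacState_vproj_mul]
  refine (vacState_gapCalc_src _ (edgeRel_create he) ha.le _).trans ?_
  rw [edgeMean_of_even _ (gapNull_comp_neg (gap_pos ha))]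
  simp only [gapNull_apply, gapSign_gapZero, gapSign_edgeRad ha, sub_self, integral_zero]
  simp

lemma vacState_splitModel_src (b : C(unitInterval, Matrix (Fin 2) (Fin 2) ℂ) × ℂ ×
    C₀({v : Λ.vertexSet // v ≠ e.src ∧ v ≠ e.tgt}, ℂ)) :
    vacState e.src (splitModel he ha b) = ((1 - (a⁻¹ ^ 2) ^ 2 : ℝ) : ℂ) * b.2.1 +
      (((a⁻¹ ^ 2) ^ 2 : ℝ) : ℂ) * ∫ s, b.1 s 0 0 := by
  rw [splitModel_apply, map_add, map_add, map_smul, vacState_nullProj_src,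
    vacState_restHom_of_neg (by simp), splitHom_apply,
    vacState_gradedMap_src he ha.le (isGraded_edgeMatrix ha _), integral_splitMatrix ha]
  rw [splitMatrix_apply, if_pos rfl, gapSign_gapZero, smul_eq_mul]
  ring

lemma vacState_splitModel_tgt (b : C(unitInterval, Matrix (Fin 2) (Fin 2) ℂ) × ℂ ×
    C₀({v : Λ.vertexSet // v ≠ e.src ∧ v ≠ e.tgt}, ℂ)) :
    vacState e.tgt (splitModel he ha b) = ∫ s, b.1 s 1 1 := by
  rw [splitModel_apply, map_add, map_add, map_smul, nullProj, vacState_vproj_mul_of_ne he.symm,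
    vacState_restHom_of_neg (by simp), splitHom_apply,
    vacState_gradedMap_tgt he ha.le (isGraded_edgeMatrix ha _), integral_splitMatrix ha]
  simp

lemma vacState_splitModel_of_ne (b : C(unitInterval, Matrix (Fin 2) (Fin 2) ℂ) × ℂ ×
    C₀({v : Λ.vertexSet // v ≠ e.src ∧ v ≠ e.tgt}, ℂ)) {v : Λ.vertexSet}
    (hv : v ≠ e.src ∧ v ≠ e.tgt) : vacState v (splitModel he ha b) = b.2.2 ⟨v, hv⟩ := by
  rw [splitModel_apply, map_add, map_add, map_smul, nullProj, vacState_vproj_mul_of_ne hv.1,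
    vacState_restHom_of_pos (P := fun v => v ≠ e.src ∧ v ≠ e.tgt) hv, splitHom_apply,
    vacState_gradedMap_of_ne he ha.le hv.1 hv.2]
  simp

lemma inv_sq_lt_one (ha : 1 < a) : (a⁻¹ ^ 2) ^ 2 < 1 := by
  rw [← pow_mul]
  exact pow_lt_one₀ (by positivity) (inv_lt_one_of_one_lt₀ ha) (by norm_num)

lemma splitModel_injective : Function.Injective (splitModel he ha) := by
  refine (injective_iff_map_eq_zero (splitModel he ha)).2 fun b hb => ?_
  have hb1 : (a⁻¹ ^ 2) ^ 2 ≠ 0 := by positivity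
  -- The state at the source mixes the scalar with the matrix summand. Multiplication by the central
  -- projection `(0, 1, 0)` isolates the scalar, whose coefficient `1 - a⁻⁴` is nonzero since `a >
  -- 1`.
  have hl : b.2.1 = 0 := by
    have h1 : splitModel he ha ((0, 1, 0) * b) = 0 := by rw [map_mul, hb, mul_zero]
    have h2 := vacState_splitModel_src he ha ((0, 1, 0) * b)
    rw [h1, map_zero] at h2
    simp only [Prod.fst_mul, Prod.snd_mul, zero_mul, one_mul] at h2
    have h3 : ∫ s, (0 : C(unitInterval, Matrix (Fin 2) (Fin 2) ℂ)) s 0 0 = 0 := by simp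
    rw [h3, mul_zero, add_zero] at h2
    refine (mul_eq_zero.1 h2.symm).resolve_left ?_
    exact_mod_cast (sub_pos.2 (inv_sq_lt_one ha)).ne'
  have h1 : splitModel he ha (star b * b) = 0 := by rw [map_mul, hb, mul_zero]
  have h2 := vacState_splitModel_src he ha (star b * b)
  have h3 := vacState_splitModel_tgt he ha (star b * b)
  rw [h1, map_zero] at h2 h3
  simp only [Prod.fst_mul, Prod.snd_mul, hl, mul_zero, zero_add] at h2
  have h4 := (mul_eq_zero.1 h2.symm).resolve_left (by exact_mod_cast hb1)
  refine Prod.ext ?_ (Prod.ext hl ?_)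
  · ext t i j
    fin_cases j
    · exact eq_zero_of_integral_star_mul b.1 0 h4 t i
    · exact eq_zero_of_integral_star_mul b.1 1 h3.symm t i
  · ext ⟨v, hv⟩
    rw [← vacState_splitModel_of_ne he ha b hv, hb, map_zero]
    rfl

lemma gradedMap_diagonal {k₀ k₁ : ℝ} {A : Type*} [CStarAlgebra A] {p : Fin 2 → A} {T : A}
    (h : Grading k₀ k₁ p T) {M : Matrix (Fin 2) (Fin 2) C(gapSet k₀ k₁, ℂ)}
    (hM : ∀ i j, i ≠ j → M i j = 0) :
    h.gradedMap M = p 0 * h.fcalc (M 0 0) + p 1 * h.fcalc (M 1 1) := by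
  simp only [Grading.gradedMap, Fin.sum_univ_two, hM 0 1 zero_ne_one, hM 1 0 one_ne_zero, map_zero,
    mul_zero, zero_add, add_zero]

lemma splitModel_const (c : C₀(Λ.vertexSet, ℂ)) :
    splitModel he ha (ContinuousMap.const _ (Matrix.diagonal ![c e.src, c e.tgt]), c e.src,
      restrictZero _ c) = leftHom Λ c := by
  set M := splitMatrix (gap_pos ha) (edgeParam ha.le)
    (ContinuousMap.const _ (Matrix.diagonal ![c e.src, c e.tgt])) with hM
  have h0 : M 0 0 = c e.src • (1 - gapNull _ (gap_pos ha)) := by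
    ext z
    rw [hM, splitMatrix_apply]
    simp [gapNull_apply, mul_comm]
  have h1 : M 1 1 = c e.tgt • (1 - gapNull _ (gap_pos ha)) := by
    ext z
    rw [hM, splitMatrix_apply]
    simp [gapNull_apply, mul_comm]
  have h2 : ∀ i j, i ≠ j → M i j = 0 := by
    intro i j hij
    ext z
    rw [hM, splitMatrix_apply, ContinuousMap.const_apply, Matrix.diagonal_apply_ne _ hij, mul_zero]
    rfl
  -- The matrix summand contributes `c(α) p_α` and `c(β) p_β` off the null space of `T` only. At `α`
  -- the scalar summand restores the missing part; at `β` nothing is missing, because `p_β` is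
  -- orthogonal to the null projection.
  have h3 := tgt_mul_null he ha (gap_pos ha)
  rw [splitModel_apply, splitHom_apply, gradedMap_diagonal _ h2, h0, h1, ← leftHom_eq_add he c,
    ← add_assoc]
  congr 1
  simp only [Matrix.cons_val_zero, Matrix.cons_val_one, map_smul, map_sub, map_one, mul_smul_comm,
    mul_sub, mul_one, h3, smul_sub, nullProj, smul_zero]
  abel

/-- The matrix function that represents `T_ε`. -/
def radMatrix (ha : 1 ≤ a) : C(unitInterval, Matrix (Fin 2) (Fin 2) ℂ) where
  toFun s := Matrix.of fun i j => if i = j then 0 else (edgeRad ha s : ℂ)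
  continuous_toFun := by
    refine continuous_pi fun i => continuous_pi fun j => ?_
    simp only [Matrix.of_apply]
    split_ifs
    · exact continuous_const
    · exact continuous_subtype_val.comp (edgeRad ha).continuous

lemma radMatrix_apply (ha : 1 ≤ a) (s : unitInterval) (i j : Fin 2) :
    radMatrix ha s i j = if i = j then 0 else (edgeRad ha s : ℂ) := rfl

/-- The polar decomposition `z = sign(z) |z|`; the arbitrary parameter assigned to an isolated `0`
is harmless because the sign vanishes there. -/
lemma gapSign_mul_edgeRad (ha : 1 ≤ a) (z : gapSet (a - a⁻¹) (a + a⁻¹)) :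
    gapSign z * (edgeRad ha (edgeParam ha z) : ℂ) = z := by
  rcases z.2.2.1 with h | h
  · rw [gapSign_of_re_eq_zero h, zero_mul, gapSet_eq_re z, h, Complex.ofReal_zero]
  · rw [coe_edgeRad, edgeRadReal_edgeParam ha z h, gapSign_mul_abs]

lemma splitModel_radMatrix : splitModel he ha (radMatrix ha.le, 0, 0) =
    edgeComb a (create e) (create e.op) := by
  rw [splitModel_apply, zero_smul, map_zero, add_zero, add_zero, splitHom_apply]
  refine Grading.gradedMap_gapId _ (edgeGrading_mul he) (fun i => ?_) (fun i j hij => ?_)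
  · ext z
    rw [splitMatrix_apply, radMatrix_apply, if_pos rfl, if_pos rfl, mul_zero]
    rfl
  · ext z
    rw [splitMatrix_apply, radMatrix_apply, if_neg hij, if_neg hij, gapSign_mul_edgeRad, gapId_apply]

variable (hT : edgeOp μ d = edgeComb a (create e) (create e.op))
include hT

lemma splitModel_mem (b : C(unitInterval, Matrix (Fin 2) (Fin 2) ℂ) × ℂ ×
    C₀({v : Λ.vertexSet // v ≠ e.src ∧ v ≠ e.tgt}, ℂ)) : splitModel he ha b ∈ edgeAlg μ d := by
  have hTm : edgeComb a (create e) (create e.op) ∈ edgeAlg μ d := hT ▸ edgeOp_mem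
  have hp : ∀ i, (![vproj e.src, vproj e.tgt] : Fin 2 → FockOp Λ) i ∈ edgeAlg μ d := by
    intro i
    fin_cases i <;> exact leftHom_mem _
  rw [splitModel_apply]
  refine add_mem ((edgeGrading he ha.le).gradedMap_mem isClosed_edgeAlg hp hTm _)
    (add_mem (SMulMemClass.smul_mem _ ?_) (leftHom_mem _))
  exact mul_gapCalc_mem _ _ isClosed_edgeAlg (leftHom_mem _) hTm _

omit hT in
lemma isClosed_range_splitModel : IsClosed (Set.range (splitModel he ha)) :=
  isClosed_range_matrix (splitModel he ha) (splitModel_injective he ha)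

theorem exists_split_equiv :
    ∃ φ : edgeAlg μ d ≃⋆ₐ[ℂ] C(unitInterval, Matrix (Fin 2) (Fin 2) ℂ) × ℂ ×
        C₀({v : Λ.vertexSet // v ≠ e.src ∧ v ≠ e.tgt}, ℂ),
      (∀ c, φ (incl μ d c) = (ContinuousMap.const _ (Matrix.diagonal ![c e.src, c e.tgt]), c e.src,
        restrictZero _ c)) ∧
      ∀ x : edgeAlg μ d, splitModel he ha (φ x) = x :=
  exists_equiv_of_model (splitModel he ha) (splitModel_injective he ha)
    (isClosed_range_splitModel he ha) (splitModel_mem he ha hT)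
    (fun c => (ContinuousMap.const _ (Matrix.diagonal ![c e.src, c e.tgt]), c e.src,
      restrictZero _ c))
    (splitModel_const he ha) ⟨_, (splitModel_radMatrix he ha).trans hT.symm⟩

end Split

end FreeGraph

end

noncomputable section

/-! ## The algebra of an edge between vertices of equal weights -/

namespace FreeGraph

/-- For `a = 1` the point `T = 0` is `φ = 0`, the left end of the parameter interval; hence the
gluing condition of `𝓓` sits at `0`. -/
lemma edgeParam_of_re_eq_zero (z : gapSet ((1 : ℝ) - 1⁻¹) (1 + 1⁻¹)) (hz : (z : ℂ).re = 0) :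
    edgeParam le_rfl z = 0 := by
  have h1 : Real.arccos (((1 : ℝ) ^ 2 + 1⁻¹ ^ 2 - (z : ℂ).re ^ 2) / 2) = 0 := by
    rw [hz]; norm_num
  have h2 : (⟨Real.arccos (((1 : ℝ) ^ 2 + 1⁻¹ ^ 2 - (z : ℂ).re ^ 2) / 2),
      Real.arccos_nonneg _, Real.arccos_le_pi _⟩ : Set.Icc 0 Real.pi) =
      ⟨0, le_rfl, Real.pi_pos.le⟩ := Subtype.ext h1
  change edgeCdf le_rfl ⟨Real.arccos _, _⟩ = 0
  rw [h2]
  exact cdfHomeo_zero _ _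

section Glued

variable {V E : Type*} {Λ : Graph V E} [TopologicalSpace V] [DiscreteTopology V]
  {μ : Λ.vertexSet → ℝ} {d e : DirEdge Λ} (he : e.src ≠ e.tgt)

/-- The elements of `𝓓` as graded matrices on the spectrum of `T_ε`. -/
abbrev diagMatrix : diagAtZero →⋆ₙₐ[ℂ]
    Matrix (Fin 2) (Fin 2) C(gapSet ((1 : ℝ) - 1⁻¹) (1 + 1⁻¹), ℂ) :=
  gluedMatrix (edgeParam le_rfl) edgeParam_of_re_eq_zero

lemma isGraded_diagMatrix (f : diagAtZero) : IsGraded (diagMatrix f) :=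
  isGraded_gluedMatrix edgeParam_of_re_eq_zero (edgeParam_neg le_rfl) f

/-- The summand `𝓓` of `𝓢_ε`. -/
def gluedHom : diagAtZero →⋆ₙₐ[ℂ] FockOp Λ :=
  (edgeGrading he le_rfl).gradedHom diagMatrix isGraded_diagMatrix

lemma gluedHom_apply (f : diagAtZero) :
    gluedHom he f = (edgeGrading he le_rfl).gradedMap (diagMatrix f) := rfl

/-- The model of `𝓢_ε` for an edge between vertices of equal weights. -/
def gluedModel : diagAtZero × C₀({v : Λ.vertexSet // v ≠ e.src ∧ v ≠ e.tgt}, ℂ) →⋆ₙₐ[ℂ] FockOp Λ :=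
  prodHom (gluedHom he) (restHom _)
    (fun f c => by
      rw [gluedHom_apply, gradedMap_mul_restHom he le_rfl (isGraded_diagMatrix f)])
    (fun f c => by rw [gluedHom_apply, restHom_mul_gradedMap he le_rfl])

lemma gluedModel_apply (b : diagAtZero × C₀({v : Λ.vertexSet // v ≠ e.src ∧ v ≠ e.tgt}, ℂ)) :
    gluedModel he b = gluedHom he b.1 + restHom _ b.2 := rfl

lemma diagMatrix_edgeRad (f : diagAtZero) (i : Fin 2) (s : unitInterval) :
    diagMatrix f i i (edgeRad le_rfl s) = f.1 s i i := by
  rw [gluedMatrix_apply, if_pos rfl, edgeParam_edgeRad, one_mul]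

lemma integral_diagMatrix (f : diagAtZero) (i : Fin 2) :
    ∫ s, diagMatrix f i i (edgeRad le_rfl s) = ∫ s, f.1 s i i :=
  integral_congr_ae (Eventually.of_forall fun s => diagMatrix_edgeRad f i s)

lemma vacState_gluedModel_src
    (b : diagAtZero × C₀({v : Λ.vertexSet // v ≠ e.src ∧ v ≠ e.tgt}, ℂ)) :
    vacState e.src (gluedModel he b) = ∫ s, b.1.1 s 0 0 := by
  rw [gluedModel_apply, map_add, vacState_restHom_of_neg (by simp), gluedHom_apply,
    vacState_gradedMap_src he le_rfl (isGraded_diagMatrix _), integral_diagMatrix]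
  simp

lemma vacState_gluedModel_tgt
    (b : diagAtZero × C₀({v : Λ.vertexSet // v ≠ e.src ∧ v ≠ e.tgt}, ℂ)) :
    vacState e.tgt (gluedModel he b) = ∫ s, b.1.1 s 1 1 := by
  rw [gluedModel_apply, map_add, vacState_restHom_of_neg (by simp), gluedHom_apply,
    vacState_gradedMap_tgt he le_rfl (isGraded_diagMatrix _), integral_diagMatrix, add_zero]

lemma vacState_gluedModel_of_ne
    (b : diagAtZero × C₀({v : Λ.vertexSet // v ≠ e.src ∧ v ≠ e.tgt}, ℂ)) {v : Λ.vertexSet}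
    (hv : v ≠ e.src ∧ v ≠ e.tgt) : vacState v (gluedModel he b) = b.2 ⟨v, hv⟩ := by
  rw [gluedModel_apply, map_add,
    vacState_restHom_of_pos (P := fun v => v ≠ e.src ∧ v ≠ e.tgt) hv, gluedHom_apply,
    vacState_gradedMap_of_ne he le_rfl hv.1 hv.2, zero_add]

lemma eq_zero_of_gluedModel_eq_zero
    (b : diagAtZero × C₀({v : Λ.vertexSet // v ≠ e.src ∧ v ≠ e.tgt}, ℂ))
    (hb : gluedModel he b = 0) : b = 0 := by
  have h1 : gluedModel he (star b * b) = 0 := by rw [map_mul, hb, mul_zero]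
  have h2 := vacState_gluedModel_src he (star b * b)
  have h3 := vacState_gluedModel_tgt he (star b * b)
  rw [h1, map_zero] at h2 h3
  refine Prod.ext (Subtype.ext ?_) ?_
  · ext t i j
    fin_cases j
    · exact eq_zero_of_integral_star_mul b.1.1 0 h2.symm t i
    · exact eq_zero_of_integral_star_mul b.1.1 1 h3.symm t i
  · ext ⟨v, hv⟩
    rw [← vacState_gluedModel_of_ne he b hv, hb, map_zero]
    rfl

lemma gluedModel_injective : Function.Injective (gluedModel he) := by
  intro b b' h
  have h1 : gluedModel he (b + (-1 : ℂ) • b') = 0 := by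
    rw [map_add, map_smul, h, neg_one_smul, add_neg_cancel]
  have h2 := eq_zero_of_gluedModel_eq_zero he _ h1
  refine Prod.ext (Subtype.ext ?_) ?_
  · ext t i j
    have h3 : b.1.1 t i j + (-1 : ℂ) * b'.1.1 t i j = 0 := congrArg (fun b => b.1.1 t i j) h2
    linear_combination h3
  · ext v
    have h3 : b.2 v + (-1 : ℂ) * b'.2 v = 0 := congrArg (fun b => b.2 v) h2
    linear_combination h3

/-- A constant diagonal matrix as an element of `𝓓`. -/
def diagConst (x y : ℂ) : diagAtZero :=
  ⟨ContinuousMap.const _ (Matrix.diagonal ![x, y]), Matrix.isDiag_diagonal _⟩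

lemma gluedModel_const (c : C₀(Λ.vertexSet, ℂ)) :
    gluedModel he (diagConst (c e.src) (c e.tgt), restrictZero _ c) = leftHom Λ c := by
  set M := diagMatrix (diagConst (c e.src) (c e.tgt)) with hM
  have h0 : M 0 0 = c e.src • 1 := by
    ext z
    rw [hM, gluedMatrix_apply]
    simp [diagConst]
  have h1 : M 1 1 = c e.tgt • 1 := by
    ext z
    rw [hM, gluedMatrix_apply]
    simp [diagConst]
  have h2 : ∀ i j, i ≠ j → M i j = 0 := by
    intro i j hij
    ext z
    rw [hM, gluedMatrix_apply]
    change _ * Matrix.diagonal ![c e.src, c e.tgt] i j = 0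
    rw [Matrix.diagonal_apply_ne _ hij, mul_zero]
  rw [gluedModel_apply, gluedHom_apply, gradedMap_diagonal _ h2, h0, h1, ← leftHom_eq_add he c]
  congr 1
  simp only [Matrix.cons_val_zero, Matrix.cons_val_one, map_smul, map_one, mul_smul_comm, mul_one]

/-- The element of `𝓓` that represents `T_ε`. -/
def radDiag : diagAtZero :=
  ⟨radMatrix (le_refl (1 : ℝ)), fun i j hij => by
    change radMatrix (le_refl (1 : ℝ)) 0 i j = 0
    rw [radMatrix_apply, if_neg hij, coe_edgeRad]
    have h1 := edgeParam_of_re_eq_zero (gapZero (top_nonneg le_rfl)) rfl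
    rw [← h1, edgeRadReal_edgeParam le_rfl _ (by simp [gapZero])]
    simp [gapZero]⟩

lemma gluedModel_radDiag :
    gluedModel he (radDiag, 0) = edgeComb 1 (create e) (create e.op) := by
  rw [gluedModel_apply, map_zero, add_zero, gluedHom_apply]
  refine Grading.gradedMap_gapId _ (edgeGrading_mul he) (fun i => ?_) (fun i j hij => ?_)
  · ext z
    rw [gluedMatrix_apply]
    change _ * radMatrix le_rfl _ i i = 0
    rw [radMatrix_apply, if_pos rfl, if_pos rfl, mul_zero]
  · ext z
    rw [gluedMatrix_apply]
    change _ * radMatrix le_rfl _ i j = _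
    rw [radMatrix_apply, if_neg hij, if_neg hij, gapSign_mul_edgeRad, gapId_apply]

lemma isClosed_range_gluedModel : IsClosed (Set.range (gluedModel he)) :=
  isClosed_range_diagAtZero (gluedModel he) (gluedModel_injective he)

variable (hT : edgeOp μ d = edgeComb 1 (create e) (create e.op))
include hT

lemma gluedModel_mem (b : diagAtZero × C₀({v : Λ.vertexSet // v ≠ e.src ∧ v ≠ e.tgt}, ℂ)) :
    gluedModel he b ∈ edgeAlg μ d := by
  have hTm : edgeComb 1 (create e) (create e.op) ∈ edgeAlg μ d := hT ▸ edgeOp_mem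
  have hp : ∀ i, (![vproj e.src, vproj e.tgt] : Fin 2 → FockOp Λ) i ∈ edgeAlg μ d := by
    intro i
    fin_cases i <;> exact leftHom_mem _
  rw [gluedModel_apply]
  exact add_mem ((edgeGrading he le_rfl).gradedMap_mem isClosed_edgeAlg hp hTm _) (leftHom_mem _)

theorem exists_glued_equiv :
    ∃ φ : edgeAlg μ d ≃⋆ₐ[ℂ] diagAtZero × C₀({v : Λ.vertexSet // v ≠ e.src ∧ v ≠ e.tgt}, ℂ),
      (∀ c, φ (incl μ d c) = (diagConst (c e.src) (c e.tgt), restrictZero _ c)) ∧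
      ∀ x : edgeAlg μ d, gluedModel he (φ x) = x :=
  exists_equiv_of_model (gluedModel he) (gluedModel_injective he) (isClosed_range_gluedModel he)
    (gluedModel_mem he hT) (fun c => (diagConst (c e.src) (c e.tgt), restrictZero _ c))
    (gluedModel_const he) ⟨_, (gluedModel_radDiag he).trans hT.symm⟩

end Glued

end FreeGraph

end

noncomputable section

/-! ## The weight on the models -/

namespace FreeGraph

section Orientation

variable {V E : Type*} {Λ : Graph V E} [TopologicalSpace V] [DiscreteTopology V]
  {μ : Λ.vertexSet → ℝ} {d e : DirEdge Λ}

omit [TopologicalSpace V] [DiscreteTopology V] in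
lemma ratio_op (hμ : ∀ v, 0 < μ v) (d : DirEdge Λ) : ratio μ d.op = (ratio μ d)⁻¹ := by
  change (μ d.tgt / μ d.src) ^ (1 / 4 : ℝ) = ((μ d.src / μ d.tgt) ^ (1 / 4 : ℝ))⁻¹
  rw [← Real.inv_rpow (div_pos (hμ _) (hμ _)).le, inv_div]

omit [TopologicalSpace V] [DiscreteTopology V] in
lemma ratio_pow_four (hμ : ∀ v, 0 < μ v) (d : DirEdge Λ) :
    ratio μ d ^ 4 = μ d.src / μ d.tgt := by
  rw [ratio, ← Real.rpow_natCast, ← Real.rpow_mul (div_pos (hμ _) (hμ _)).le]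
  norm_num

omit [TopologicalSpace V] [DiscreteTopology V] in
-- The only place where the fourth root in the definition of `T_ε` matters: it makes the factor `b²
-- = a⁻⁴` of the vacuum laws equal to the ratio of the vertex weights.
lemma inv_ratio_sq_mul (hμ : ∀ v, 0 < μ v) (d : DirEdge Λ) :
    ((ratio μ d)⁻¹ ^ 2) ^ 2 * μ d.src = μ d.tgt := by
  rw [← pow_mul, inv_pow, ratio_pow_four hμ, inv_div, div_mul_cancel₀ _ (hμ _).ne']

omit [TopologicalSpace V] [DiscreteTopology V] in
lemma one_lt_ratio (hμ : ∀ v, 0 < μ v) {d : DirEdge Λ} (h : μ d.tgt < μ d.src) :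
    1 < ratio μ d :=
  Real.one_lt_rpow ((one_lt_div (hμ _)).2 h) (by norm_num)

omit [TopologicalSpace V] [DiscreteTopology V] in
lemma ratio_eq_one (hμ : ∀ v, 0 < μ v) {d : DirEdge Λ} (h : μ d.src = μ d.tgt) :
    ratio μ d = 1 := by
  rw [ratio, h, div_self (hμ _).ne', Real.one_rpow]

lemma edgeOp_of_ne (hd : d.src ≠ d.tgt) :
    edgeOp μ d = edgeComb (ratio μ d) (create d) (create d.op) := if_neg hd

lemma edgeOp_op (hμ : ∀ v, 0 < μ v) (hd : d.src ≠ d.tgt) :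
    edgeOp μ d = edgeComb (ratio μ d.op) (create d.op) (create d.op.op) := by
  rw [edgeOp_of_ne hd, ratio_op hμ, edgeComb_swap]
  rfl

/-- `T_ε` does not depend on the direction chosen over `ε`, so the edge may be directed from `α` to
`β` whatever the direction of `d`. -/
lemma exists_oriented (hμ : ∀ v, 0 < μ v) {α β : Λ.vertexSet} (h : Λ.IsLink d.edge α β)
    (hne : α ≠ β) : ∃ e : DirEdge Λ, e.src = α ∧ e.tgt = β ∧
      edgeOp μ d = edgeComb (ratio μ e) (create e) (create e.op) := by
  rcases d.isLink.eq_and_eq_or_eq_and_eq h with ⟨h1, h2⟩ | ⟨h1, h2⟩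
  · have h1 := Subtype.ext h1
    have h2 := Subtype.ext h2
    exact ⟨d, h1, h2, edgeOp_of_ne (h1 ▸ h2 ▸ hne)⟩
  · have h1 : d.src = β := Subtype.ext h1
    have h2 : d.tgt = α := Subtype.ext h2
    exact ⟨d.op, h2, h1, edgeOp_op hμ (by rw [h1, h2]; exact hne.symm)⟩

lemma re_integral (f : C(unitInterval, ℂ)) : (∫ t, f t).re = ∫ t, (f t).re :=
  (Complex.reCLM.integral_comp_comm (integrable_unitInterval f)).symm

lemma re_mul_integral (c : ℝ) (f : C(unitInterval, ℂ)) :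
    ((c : ℂ) * ∫ t, f t).re = c * ∫ t, (f t).re := by
  rw [Complex.re_ofReal_mul, re_integral]

lemma re_mul_integral_trace (c : ℝ) (f : C(unitInterval, Matrix (Fin 2) (Fin 2) ℂ)) :
    ((c : ℂ) * ∫ t, (f t).trace).re = c * ∫ t, (f t).trace.re :=
  re_mul_integral c ⟨fun t => (f t).trace, f.continuous.matrix_trace⟩

lemma integral_trace_one :
    ∫ t, ((1 : C(unitInterval, Matrix (Fin 2) (Fin 2) ℂ)) t).trace = 2 := by
  rw [integral_trace]
  norm_num

end Orientation

section Weight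

variable {V E : Type*} {Λ : Graph V E} [TopologicalSpace V] [DiscreteTopology V]
  {μ : Λ.vertexSet → ℝ} {d e : DirEdge Λ}

lemma TracialData.Tr_of_isPos {S : NonUnitalStarSubalgebra ℂ (FockOp Λ)}
    {s : Finset Λ.vertexSet} (h : TracialData μ S s) (hμ : ∀ v, 0 < μ v) {x : S} (hx : IsPos x)
    (h0 : ∀ v ∉ s, vacState v (x : FockOp Λ) = 0) :
    Tr μ (x : FockOp Λ) = ENNReal.ofReal (∑ v ∈ s, (μ v : ℂ) * vacState v (x : FockOp Λ)).re :=
  h.Tr_eq_ofReal hμ x.2 h0 fun v _ => TracialData.re_vacState_nonneg hx v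

section Equiv

variable {A B : Type*} [Add A] [Mul A] [SMul ℂ A] [Star A] [Add B] [Mul B] [SMul ℂ B] [Star B]
  (φ : A ≃⋆ₐ[ℂ] B)

lemma equiv_add {x y : A} {u v : B} (hx : φ x = u) (hy : φ y = v) : φ (x + y) = u + v :=
  hx ▸ hy ▸ φ.map_add' x y

lemma equiv_corner {x u : A} {w : B} (hu : φ u = w) (h : u * x * u = x) : w * φ x * w = φ x := by
  have h1 := congrArg φ h
  have h2 : φ (u * x * u) = φ u * φ x * φ u :=
    (φ.map_mul' (u * x) u).trans (congrArg (· * φ u) (φ.map_mul' u x))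
  rwa [h2, hu] at h1

/-- Elements that an isomorphism maps to a self-adjoint idempotent are projections. -/
lemma isStarProjection_of_equiv {x : A} {w : B} (h : φ x = w) (h1 : w * w = w)
    (h2 : star w = w) : IsStarProjection x where
  isIdempotentElem := EquivLike.injective φ ((φ.map_mul' x x).trans (by
    change φ x * φ x = φ x
    rw [h, h1]))
  isSelfAdjoint := EquivLike.injective φ ((φ.map_star' x).trans (by
    change star (φ x) = φ x
    rw [h, h2]))

end Equiv

lemma isPos_of_isStarProjection {A : Type*} [Mul A] [Star A] {x : A}
    (hx : IsStarProjection x) : IsPos x :=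
  ⟨x, by rw [hx.isSelfAdjoint.star_eq, hx.isIdempotentElem.eq]⟩

/-- The tracial data of an algebra that is the range of a model. -/
lemma TracialData.of_model {B : Type*} [NonUnitalNonAssocSemiring B] [DistribMulAction ℂ B]
    [Star B] (ψ : B →⋆ₙₐ[ℂ] FockOp Λ) {s : Finset Λ.vertexSet}
    (hψ : ∀ x ∈ edgeAlg μ d, ∃ b, ψ b = x)
    (hc : ∀ b, ∃ c : C₀(Λ.vertexSet, ℂ), ∀ v ∉ s, vacState v (ψ b) = c v)
    (hcomm : ∀ b, ∀ v ∉ s, vacState v (ψ (star b * b)) = vacState v (ψ (b * star b)))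
    (hsum : ∀ b, ∑ v ∈ s, (μ v : ℂ) * vacState v (ψ (star b * b)) =
      ∑ v ∈ s, (μ v : ℂ) * vacState v (ψ (b * star b))) :
    TracialData μ (edgeAlg μ d) s := by
  have h1 : ∀ b, ψ (star b * b) = star (ψ b) * ψ b := fun b => by rw [map_mul, map_star]
  have h2 : ∀ b, ψ (b * star b) = ψ b * star (ψ b) := fun b => by rw [map_mul, map_star]
  refine ⟨FreeGraph.leftHom_mem, fun x hx => ?_, fun z hz v hv => ?_, fun z hz => ?_⟩
  · obtain ⟨b, rfl⟩ := hψ x hx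
    exact hc b
  · obtain ⟨b, rfl⟩ := hψ z hz
    rw [← h1, ← h2]
    exact hcomm b v hv
  · obtain ⟨b, rfl⟩ := hψ z hz
    rw [← h1, ← h2]
    exact hsum b

section Corner

variable {B : Type*} [Add B] [Mul B] [SMul ℂ B] [Star B] {s : Finset Λ.vertexSet}
  (h : TracialData μ (edgeAlg μ d) s) (φ : edgeAlg μ d ≃⋆ₐ[ℂ] B) {I : B → ℂ} {Z : B → Prop}
  (hI : ∀ x : edgeAlg μ d, ∑ v ∈ s, (μ v : ℂ) * vacState v (x : FockOp Λ) = I (φ x))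
  (hZ : ∀ x : edgeAlg μ d, Z (φ x) → ∀ v ∉ s, vacState v (x : FockOp Λ) = 0)
include h hI hZ

lemma TracialData.Tr_of_equiv (hμ : ∀ v, 0 < μ v) {x : edgeAlg μ d} (hx : IsPos x) {w : B}
    (hw : φ x = w) (hZw : Z w) : Tr μ (x : FockOp Λ) = ENNReal.ofReal (I w).re :=
  (h.Tr_of_isPos hμ hx (hZ x (hw.symm ▸ hZw))).trans
    (congrArg (fun z : ℂ => ENNReal.ofReal z.re) ((hI x).trans (congrArg I hw)))

lemma TracialData.hasTr_of_equiv {x : edgeAlg μ d} (hw : Z (φ x)) :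
    HasTr μ (x : FockOp Λ) (I (φ x)) :=
  hI x ▸ h.hasTr x.2 (hZ x hw)

end Corner

section Split

variable (hμ : ∀ v, 0 < μ v) (he : e.src ≠ e.tgt) (ha : 1 < ratio μ e)
include hμ

/-- Since `b² μ(α) = μ(β)`, the two diagonal entries receive the same weight `μ(β)` and combine to a
matrix trace, and the null projection keeps `(1 - b²) μ(α) = μ(α) - μ(β)`. -/
lemma sum_splitModel (b : C(unitInterval, Matrix (Fin 2) (Fin 2) ℂ) × ℂ ×
    C₀({v : Λ.vertexSet // v ≠ e.src ∧ v ≠ e.tgt}, ℂ)) [DecidableEq Λ.vertexSet] :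
    ∑ v ∈ {e.src, e.tgt}, (μ v : ℂ) * vacState v (splitModel he ha b) =
      ((μ e.src - μ e.tgt : ℝ) : ℂ) * b.2.1 + (μ e.tgt : ℂ) * ∫ t, (b.1 t).trace := by
  rw [Finset.sum_pair he, vacState_splitModel_src, vacState_splitModel_tgt, integral_trace,
    ← inv_ratio_sq_mul hμ e]
  push_cast
  ring

variable (hT : edgeOp μ d = edgeComb (ratio μ e) (create e) (create e.op))
include he ha hT

lemma tracialData_split [DecidableEq Λ.vertexSet] :
    TracialData μ (edgeAlg μ d) {e.src, e.tgt} := by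
  have hv : ∀ v : Λ.vertexSet, v ∉ ({e.src, e.tgt} : Finset Λ.vertexSet) →
      v ≠ e.src ∧ v ≠ e.tgt := fun v hv => by simpa using hv
  refine TracialData.of_model (splitModel he ha) (fun x hx => ?_) (fun b => ?_)
    (fun b v h1 => ?_) (fun b => ?_)
  · exact (exists_split_equiv he ha hT).elim fun φ h => ⟨φ ⟨x, hx⟩, h.2 ⟨x, hx⟩⟩
  · refine ⟨extZero _ b.2.2, fun v h1 => ?_⟩
    rw [extZero_apply_of_pos (P := fun v => v ≠ e.src ∧ v ≠ e.tgt) (hv v h1),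
      ← vacState_splitModel_of_ne he ha]
  · exact (vacState_splitModel_of_ne he ha (star b * b) (hv v h1)).trans
      ((mul_comm _ _).trans (vacState_splitModel_of_ne he ha (b * star b) (hv v h1)).symm)
  · refine (sum_splitModel hμ he ha _).trans (Eq.trans ?_ (sum_splitModel hμ he ha _).symm)
    exact congrArg₂ (fun x y => ((μ e.src - μ e.tgt : ℝ) : ℂ) * x + (μ e.tgt : ℂ) * y)
      (mul_comm _ _) (integral_trace_mul_comm _ _)

end Split

section Glued

variable (he : e.src ≠ e.tgt) (hμe : μ e.src = μ e.tgt)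
include hμe

lemma sum_gluedModel (b : diagAtZero × C₀({v : Λ.vertexSet // v ≠ e.src ∧ v ≠ e.tgt}, ℂ))
    [DecidableEq Λ.vertexSet] :
    ∑ v ∈ {e.src, e.tgt}, (μ v : ℂ) * vacState v (gluedModel he b) =
      (μ e.src : ℂ) * ∫ t, (b.1.1 t).trace := by
  rw [Finset.sum_pair he, vacState_gluedModel_src, vacState_gluedModel_tgt, integral_trace, hμe]
  ring

variable (hT : edgeOp μ d = edgeComb 1 (create e) (create e.op))
include he hT

lemma tracialData_glued [DecidableEq Λ.vertexSet] :
    TracialData μ (edgeAlg μ d) {e.src, e.tgt} := by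
  have hv : ∀ v : Λ.vertexSet, v ∉ ({e.src, e.tgt} : Finset Λ.vertexSet) →
      v ≠ e.src ∧ v ≠ e.tgt := fun v hv => by simpa using hv
  refine TracialData.of_model (gluedModel he) (fun x hx => ?_) (fun b => ?_)
    (fun b v h1 => ?_) (fun b => ?_)
  · exact (exists_glued_equiv he hT).elim fun φ h => ⟨φ ⟨x, hx⟩, h.2 ⟨x, hx⟩⟩
  · refine ⟨extZero _ b.2, fun v h1 => ?_⟩
    rw [extZero_apply_of_pos (P := fun v => v ≠ e.src ∧ v ≠ e.tgt) (hv v h1),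
      ← vacState_gluedModel_of_ne he]
  · exact (vacState_gluedModel_of_ne he (star b * b) (hv v h1)).trans
      ((mul_comm _ _).trans (vacState_gluedModel_of_ne he (b * star b) (hv v h1)).symm)
  · refine (sum_gluedModel he hμe _).trans (Eq.trans ?_ (sum_gluedModel he hμe _).symm)
    exact congrArg (fun y => (μ e.src : ℂ) * y) (integral_trace_mul_comm _ _)

end Glued

lemma exists_tracialData (hμ : ∀ v, 0 < μ v) (d : DirEdge Λ) :
    ∃ s, TracialData μ (edgeAlg μ d) s := by
  classical
  by_cases hd : d.src = d.tgt
  · exact ⟨_, tracialData_loop hd⟩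
  · rcases lt_trichotomy (μ d.tgt) (μ d.src) with h | h | h
    · exact ⟨_, tracialData_split hμ hd (one_lt_ratio hμ h) (edgeOp_of_ne hd)⟩
    · refine ⟨_, tracialData_glued hd h.symm ?_⟩
      rw [edgeOp_of_ne hd, ratio_eq_one hμ h.symm]
    · exact ⟨_, tracialData_split hμ (e := d.op) (Ne.symm hd) (one_lt_ratio hμ h)
        (edgeOp_op hμ hd)⟩

end Weight

end FreeGraph

end

noncomputable section

/-! ## The three cases -/

namespace FreeGraph

section Abstract

variable {A X : Type*} [Add A] [Mul A] [SMul ℂ A] [Star A] [TopologicalSpace X]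

section Split

variable (φ : A ≃⋆ₐ[ℂ] C(unitInterval, Matrix (Fin 2) (Fin 2) ℂ) × ℂ × C₀(X, ℂ))

/-- The image of `p_α` is `e₁₁` in the matrix summand together with the unit of `ℂ`; `q` and `r` are
the preimages of these two parts. -/
lemma exists_split_projections {a b : A}
    (ha : φ a = (ContinuousMap.const _ (Matrix.diagonal ![1, 0]), 1, 0))
    (hb : φ b = (ContinuousMap.const _ (Matrix.diagonal ![0, 1]), 0, 0)) :
    ∃ q r : A, IsStarProjection q ∧ IsStarProjection r ∧ IsStarProjection (b + q) ∧
      a = q + r ∧ φ (b + q) = (1, 0, 0) ∧ φ r = (0, 1, 0) := by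
  set m : C(unitInterval, Matrix (Fin 2) (Fin 2) ℂ) :=
    ContinuousMap.const _ (Matrix.diagonal ![1, 0]) with hm
  have hφq : φ (φ.symm (m, 0, 0)) = (m, 0, 0) := φ.apply_symm_apply _
  have hφr : φ (φ.symm (0, 1, 0)) = (0, 1, 0) := φ.apply_symm_apply _
  have hu : φ (b + φ.symm (m, 0, 0)) = (1, 0, 0) := by
    rw [equiv_add φ hb hφq]
    refine Prod.ext ?_ (Prod.ext (add_zero _) (add_zero _))
    ext t i j
    change Matrix.diagonal ![0, 1] i j + Matrix.diagonal ![1, 0] i j =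
      (1 : Matrix (Fin 2) (Fin 2) ℂ) i j
    fin_cases i <;> fin_cases j <;> simp
  have hmm : m * m = m := by
    ext t i j
    change (Matrix.diagonal ![1, 0] * Matrix.diagonal ![1, 0] : Matrix (Fin 2) (Fin 2) ℂ) i j =
      (Matrix.diagonal ![1, 0] : Matrix (Fin 2) (Fin 2) ℂ) i j
    rw [Matrix.diagonal_mul_diagonal]
    fin_cases i <;> fin_cases j <;> simp
  have hms : star m = m := by
    ext t i j
    change star ((Matrix.diagonal ![1, 0] : Matrix (Fin 2) (Fin 2) ℂ) j i) =
      (Matrix.diagonal ![1, 0] : Matrix (Fin 2) (Fin 2) ℂ) i j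
    fin_cases i <;> fin_cases j <;> simp
  refine ⟨_, _, isStarProjection_of_equiv φ hφq
      (Prod.ext hmm (Prod.ext (mul_zero _) (mul_zero _)))
      (Prod.ext hms (Prod.ext (star_zero _) (star_zero _))),
    isStarProjection_of_equiv φ hφr
      (Prod.ext (mul_zero _) (Prod.ext (mul_one _) (mul_zero _)))
      (Prod.ext (star_zero _) (Prod.ext (star_one _) (star_zero _))),
    isStarProjection_of_equiv φ hu
      (Prod.ext (mul_one _) (Prod.ext (mul_zero _) (mul_zero _)))
      (Prod.ext (star_one _) (Prod.ext (star_zero _) (star_zero _))),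
    EquivLike.injective φ ?_, hu, hφr⟩
  rw [ha, equiv_add φ hφq hφr]
  exact Prod.ext (add_zero _).symm (Prod.ext (zero_add _).symm (add_zero _).symm)

lemma split_corner {u x : A} (hu : φ u = (1, 0, 0)) (hx : u * x * u = x) :
    (φ x).2 = 0 := by
  have h1 := equiv_corner φ hu hx
  rw [← h1]
  exact Prod.ext (mul_zero _) (mul_zero _)

end Split

section Unital

variable {B : Type*} [Semiring B] [StarRing B] [Algebra ℂ B] (φ : A ≃⋆ₐ[ℂ] B × C₀(X, ℂ))

lemma isStarProjection_of_equiv_one {u : A} (hu : φ u = (1, 0)) : IsStarProjection u :=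
  isStarProjection_of_equiv φ hu (Prod.ext (mul_one _) (mul_zero _))
    (Prod.ext (star_one _) (star_zero _))

lemma unital_corner {u x : A} (hu : φ u = (1, 0)) (hx : u * x * u = x) : (φ x).2 = 0 := by
  have h1 := equiv_corner φ hu hx
  rw [← h1]
  exact mul_zero _

end Unital

end Abstract

variable {V E : Type*} {Λ : Graph V E} [TopologicalSpace V] [DiscreteTopology V]
  {μ : Λ.vertexSet → ℝ} {d e : DirEdge Λ}

section Restrict

lemma restrictZero_vertexProj {P : Λ.vertexSet → Prop} {α : Λ.vertexSet} (h : ∀ v, P v → v ≠ α) :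
    restrictZero P (vertexProj α) = 0 := by
  ext ⟨v, hv⟩
  change vertexProj α v = 0
  rw [vertexProj_apply, if_neg (h v hv)]

lemma vertexProj_self (α : Λ.vertexSet) : vertexProj α α = 1 := by
  rw [vertexProj_apply, if_pos rfl]

lemma vertexProj_of_ne {α v : Λ.vertexSet} (h : v ≠ α) : vertexProj α v = 0 := by
  rw [vertexProj_apply, if_neg h]

end Restrict

section Split

variable (hμ : ∀ v, 0 < μ v) (he : e.src ≠ e.tgt) (ha : 1 < ratio μ e)
  (hT : edgeOp μ d = edgeComb (ratio μ e) (create e) (create e.op))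

lemma vacState_eq_zero_of_split {b : C(unitInterval, Matrix (Fin 2) (Fin 2) ℂ) × ℂ ×
        C₀({v : Λ.vertexSet // v ≠ e.src ∧ v ≠ e.tgt}, ℂ)}
    [DecidableEq Λ.vertexSet] (hb : b.2.2 = 0) (v : Λ.vertexSet)
    (hv : v ∉ ({e.src, e.tgt} : Finset Λ.vertexSet)) :
    vacState v (splitModel he ha b) = 0 := by
  have hv' : v ≠ e.src ∧ v ≠ e.tgt := by simpa using hv
  rw [vacState_splitModel_of_ne he ha _ hv', hb]
  rfl

include hμ he ha hT

set_option maxHeartbeats 2000000 in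
theorem split_case :
    ∃ (φ : edgeAlg μ d ≃⋆ₐ[ℂ] C(unitInterval, Matrix (Fin 2) (Fin 2) ℂ) × ℂ ×
        C₀({v : Λ.vertexSet // v ≠ e.src ∧ v ≠ e.tgt}, ℂ)) (q r : edgeAlg μ d),
      IsStarProjection q ∧ IsStarProjection r ∧
      incl μ d (vertexProj e.src) = q + r ∧
      φ (incl μ d (vertexProj e.tgt) + q) = (1, 0, 0) ∧
      φ r = (0, 1, 0) ∧
      (∀ c v, (φ (incl μ d c)).2.2 v = c v) ∧
      Tr μ (incl μ d (vertexProj e.tgt) + q : edgeAlg μ d) = ENNReal.ofReal (2 * μ e.tgt) ∧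
      Tr μ r = ENNReal.ofReal (μ e.src - μ e.tgt) ∧
      ∀ x : edgeAlg μ d,
        (incl μ d (vertexProj e.tgt) + q) * x * (incl μ d (vertexProj e.tgt) + q) = x →
        HasTr μ x (μ e.tgt * ∫ t, ((φ x).1 t).trace) ∧
        (IsPos x → Tr μ x = ENNReal.ofReal (μ e.tgt * ∫ t, ((φ x).1 t).trace.re)) := by
  classical
  have htd := tracialData_split hμ he ha hT
  refine (exists_split_equiv he ha hT).elim fun φ H => ?_
  have hφ := H.1
  have h := H.2
  let I : C(unitInterval, Matrix (Fin 2) (Fin 2) ℂ) × ℂ ×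
      C₀({v : Λ.vertexSet // v ≠ e.src ∧ v ≠ e.tgt}, ℂ) → ℂ := fun b =>
    -- The weighted vacuum sum over the two endpoints, transported to the model. It is the whole of
    -- `Tr_μ` on elements whose `C₀` component vanishes.
    ((μ e.src - μ e.tgt : ℝ) : ℂ) * b.2.1 + (μ e.tgt : ℂ) * ∫ t, (b.1 t).trace
  have hI : ∀ x : edgeAlg μ d,
      ∑ v ∈ {e.src, e.tgt}, (μ v : ℂ) * vacState v (x : FockOp Λ) = I (φ x) :=
    fun x => (h x ▸ sum_splitModel hμ he ha (φ x) :)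
  have hZ : ∀ x : edgeAlg μ d, (φ x).2.2 = 0 →
      ∀ v ∉ ({e.src, e.tgt} : Finset Λ.vertexSet), vacState v (x : FockOp Λ) = 0 :=
    fun x hx v hv => (h x ▸ vacState_eq_zero_of_split he ha hx v hv :)
  have hα : φ (incl μ d (vertexProj e.src)) =
      (ContinuousMap.const _ (Matrix.diagonal ![1, 0]), 1, 0) := by
    refine (hφ _).trans ?_
    rw [restrictZero_vertexProj fun v hv => hv.1, vertexProj_self, vertexProj_of_ne he.symm]
  have hβ : φ (incl μ d (vertexProj e.tgt)) =
      (ContinuousMap.const _ (Matrix.diagonal ![0, 1]), 0, 0) := by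
    refine (hφ _).trans ?_
    rw [restrictZero_vertexProj fun v hv => hv.2, vertexProj_self, vertexProj_of_ne he]
  refine (exists_split_projections φ hα hβ).elim fun q H => H.elim fun r H => ?_
  refine ⟨φ, q, r, H.1, H.2.1, H.2.2.2.1, H.2.2.2.2.1, H.2.2.2.2.2, fun c v => ?_, ?_, ?_,
    fun x hx => ?_⟩
  · exact congrArg (fun b => b.2.2 v) (hφ c)
  · refine (htd.Tr_of_equiv φ (I := I) (Z := fun b => b.2.2 = 0) hI hZ hμ
      (isPos_of_isStarProjection H.2.2.1) H.2.2.2.2.1 rfl).trans ?_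
    change ENNReal.ofReal (((μ e.src - μ e.tgt : ℝ) : ℂ) * 0 + (μ e.tgt : ℂ) *
      ∫ t, ((1 : C(unitInterval, Matrix (Fin 2) (Fin 2) ℂ)) t).trace).re = _
    rw [integral_trace_one, mul_zero, zero_add, Complex.re_ofReal_mul, mul_comm]
    rfl
  · refine (htd.Tr_of_equiv φ (I := I) (Z := fun b => b.2.2 = 0) hI hZ hμ
      (isPos_of_isStarProjection H.2.1) H.2.2.2.2.2 rfl).trans ?_
    simp [I]
  · have h1 := split_corner φ H.2.2.2.2.1 hx
    have h2 : (φ x).2.2 = 0 := congrArg Prod.snd h1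
    have h3 : I (φ x) = (μ e.tgt : ℂ) * ∫ t, ((φ x).1 t).trace := by
      have h4 : (φ x).2.1 = 0 := congrArg Prod.fst h1
      exact (congrArg (fun z : ℂ => ((μ e.src - μ e.tgt : ℝ) : ℂ) * z + _) h4).trans
        (by rw [mul_zero, zero_add])
    refine ⟨h3 ▸ htd.hasTr_of_equiv φ (I := I) (Z := fun b => b.2.2 = 0) hI hZ h2,
      fun hpos => ?_⟩
    refine (htd.Tr_of_equiv φ (I := I) (Z := fun b => b.2.2 = 0) hI hZ hμ hpos rfl h2).trans
      (congrArg ENNReal.ofReal ((congrArg Complex.re h3).trans (re_mul_integral_trace _ _)))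

end Split

section Glued

variable (hμ : ∀ v, 0 < μ v) (he : e.src ≠ e.tgt) (hμe : μ e.src = μ e.tgt)
  (hT : edgeOp μ d = edgeComb 1 (create e) (create e.op))

lemma vacState_eq_zero_of_glued
    {b : diagAtZero × C₀({v : Λ.vertexSet // v ≠ e.src ∧ v ≠ e.tgt}, ℂ)}
    [DecidableEq Λ.vertexSet] (hb : b.2 = 0) (v : Λ.vertexSet)
    (hv : v ∉ ({e.src, e.tgt} : Finset Λ.vertexSet)) :
    vacState v (gluedModel he b) = 0 := by
  have hv' : v ≠ e.src ∧ v ≠ e.tgt := by simpa using hv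
  rw [vacState_gluedModel_of_ne he _ hv', hb]
  rfl

include hμ he hμe hT

set_option maxHeartbeats 2000000 in
theorem glued_case :
    ∃ φ : edgeAlg μ d ≃⋆ₐ[ℂ] diagAtZero × C₀({v : Λ.vertexSet // v ≠ e.src ∧ v ≠ e.tgt}, ℂ),
      (∀ c, ((φ (incl μ d c)).1 : C(unitInterval, Matrix (Fin 2) (Fin 2) ℂ)) =
          ContinuousMap.const _ (Matrix.diagonal ![c e.src, c e.tgt]) ∧
        ∀ v, (φ (incl μ d c)).2 v = c v) ∧
      Tr μ (incl μ d (vertexProj e.src) + incl μ d (vertexProj e.tgt) : edgeAlg μ d)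
        = ENNReal.ofReal (2 * μ e.src) ∧
      ∀ x : edgeAlg μ d,
        (incl μ d (vertexProj e.src) + incl μ d (vertexProj e.tgt)) * x *
          (incl μ d (vertexProj e.src) + incl μ d (vertexProj e.tgt)) = x →
        HasTr μ x (μ e.src * ∫ t, ((φ x).1.1 t).trace) ∧
        (IsPos x → Tr μ x = ENNReal.ofReal (μ e.src * ∫ t, ((φ x).1.1 t).trace.re)) := by
  classical
  have htd := tracialData_glued he hμe hT
  refine (exists_glued_equiv he hT).elim fun φ H => ?_
  have hφ := H.1
  have h := H.2
  let I : diagAtZero × C₀({v : Λ.vertexSet // v ≠ e.src ∧ v ≠ e.tgt}, ℂ) → ℂ := fun b =>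
    (μ e.src : ℂ) * ∫ t, (b.1.1 t).trace
  have hI : ∀ x : edgeAlg μ d,
      ∑ v ∈ {e.src, e.tgt}, (μ v : ℂ) * vacState v (x : FockOp Λ) = I (φ x) :=
    fun x => (h x ▸ sum_gluedModel he hμe (φ x) :)
  have hZ : ∀ x : edgeAlg μ d, (φ x).2 = 0 →
      ∀ v ∉ ({e.src, e.tgt} : Finset Λ.vertexSet), vacState v (x : FockOp Λ) = 0 :=
    fun x hx v hv => (h x ▸ vacState_eq_zero_of_glued he hx v hv :)
  have hu : φ (incl μ d (vertexProj e.src) + incl μ d (vertexProj e.tgt)) = (1, 0) := by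
    refine (equiv_add φ (hφ _) (hφ _)).trans ?_
    rw [restrictZero_vertexProj fun v hv => hv.1, restrictZero_vertexProj fun v hv => hv.2,
      vertexProj_self, vertexProj_self, vertexProj_of_ne he, vertexProj_of_ne he.symm]
    refine Prod.ext (Subtype.ext ?_) (add_zero _)
    ext t i j
    change Matrix.diagonal ![1, 0] i j + Matrix.diagonal ![0, 1] i j =
      (1 : Matrix (Fin 2) (Fin 2) ℂ) i j
    fin_cases i <;> fin_cases j <;> simp
  refine ⟨φ, fun c => ⟨congrArg (fun b => b.1.1) (hφ c), fun v => congrArg (fun b => b.2 v) (hφ c)⟩,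
    ?_, fun x hx => ?_⟩
  · refine (htd.Tr_of_equiv φ (I := I) (Z := fun b => b.2 = 0) hI hZ hμ
      (isPos_of_isStarProjection (isStarProjection_of_equiv_one φ hu)) hu rfl).trans ?_
    change ENNReal.ofReal ((μ e.src : ℂ) *
      ∫ t, ((1 : C(unitInterval, Matrix (Fin 2) (Fin 2) ℂ)) t).trace).re = _
    rw [integral_trace_one, Complex.re_ofReal_mul, mul_comm]
    rfl
  · have h1 := unital_corner φ hu hx
    refine ⟨htd.hasTr_of_equiv φ (I := I) (Z := fun b => b.2 = 0) hI hZ h1, fun hpos => ?_⟩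
    refine (htd.Tr_of_equiv φ (I := I) (Z := fun b => b.2 = 0) hI hZ hμ hpos rfl h1).trans
      (congrArg ENNReal.ofReal (re_mul_integral_trace _ _))

end Glued

lemma vacState_eq_zero_of_loop (hd : d.src = d.tgt)
    {b : C(unitInterval, ℂ) × C₀({v : Λ.vertexSet // v ≠ d.src}, ℂ)} (hb : b.2 = 0)
    (v : Λ.vertexSet) (hv : v ∉ ({d.src} : Finset Λ.vertexSet)) :
    vacState v (loopModel hd b) = 0 := by
  have hv' : v ≠ d.src := by simpa using hv
  rw [vacState_loopModel_of_ne hd _ hv', hb]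
  rfl

lemma sum_loopModel (hd : d.src = d.tgt)
    (b : C(unitInterval, ℂ) × C₀({v : Λ.vertexSet // v ≠ d.src}, ℂ)) :
    ∑ v ∈ {d.src}, (μ v : ℂ) * vacState v (loopModel hd b) = (μ d.src : ℂ) * ∫ t, b.1 t := by
  rw [Finset.sum_singleton, vacState_loopModel_self]

set_option maxHeartbeats 2000000 in
theorem loop_case (hμ : ∀ v, 0 < μ v) (hd : d.src = d.tgt) :
    ∃ φ : edgeAlg μ d ≃⋆ₐ[ℂ] C(unitInterval, ℂ) × C₀({v : Λ.vertexSet // v ≠ d.src}, ℂ),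
      (∀ c, (φ (incl μ d c)).1 = ContinuousMap.const _ (c d.src) ∧
        ∀ v, (φ (incl μ d c)).2 v = c v) ∧
      Tr μ (incl μ d (vertexProj d.src)) = ENNReal.ofReal (μ d.src) ∧
      ∀ x : edgeAlg μ d,
        incl μ d (vertexProj d.src) * x * incl μ d (vertexProj d.src) = x →
        HasTr μ x (μ d.src * ∫ t, (φ x).1 t) ∧
        (IsPos x → Tr μ x = ENNReal.ofReal (μ d.src * ∫ t, ((φ x).1 t).re)) := by
  have htd := tracialData_loop (μ := μ) hd
  refine (exists_loop_equiv (μ := μ) hd).elim fun φ H => ?_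
  have hφ := H.1
  have h := H.2
  let I : C(unitInterval, ℂ) × C₀({v : Λ.vertexSet // v ≠ d.src}, ℂ) → ℂ := fun b =>
    (μ d.src : ℂ) * ∫ t, b.1 t
  have hI : ∀ x : edgeAlg μ d,
      ∑ v ∈ {d.src}, (μ v : ℂ) * vacState v (x : FockOp Λ) = I (φ x) :=
    fun x => (h x ▸ sum_loopModel hd (φ x) :)
  have hZ : ∀ x : edgeAlg μ d, (φ x).2 = 0 →
      ∀ v ∉ ({d.src} : Finset Λ.vertexSet), vacState v (x : FockOp Λ) = 0 :=
    fun x hx v hv => (h x ▸ vacState_eq_zero_of_loop hd hx v hv :)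
  have hu : φ (incl μ d (vertexProj d.src)) = (1, 0) := by
    refine (hφ _).trans ?_
    rw [restrictZero_vertexProj fun v hv => hv, vertexProj_self]
    rfl
  refine ⟨φ, fun c => ⟨congrArg Prod.fst (hφ c), fun v => congrArg (fun b => b.2 v) (hφ c)⟩, ?_,
    fun x hx => ?_⟩
  · refine (htd.Tr_of_equiv φ (I := I) (Z := fun b => b.2 = 0) hI hZ hμ
      (isPos_of_isStarProjection (isStarProjection_of_equiv_one φ hu)) hu rfl).trans ?_
    simp [I]
  · have h1 := unital_corner φ hu hx
    refine ⟨htd.hasTr_of_equiv φ (I := I) (Z := fun b => b.2 = 0) hI hZ h1, fun hpos => ?_⟩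
    refine (htd.Tr_of_equiv φ (I := I) (Z := fun b => b.2 = 0) hI hZ hμ hpos rfl h1).trans
      (congrArg ENNReal.ofReal (re_mul_integral _ _))

end FreeGraph

end

open FreeGraph in
theorem mainTheorem5 {V E : Type*} [TopologicalSpace V] [DiscreteTopology V] (Λ : Graph V E)
    (μ : Λ.vertexSet → ℝ) (hμ : ∀ v, 0 < μ v) (d : DirEdge Λ) :
    -- `E` is well defined and `Tr_μ = τ_μ ∘ E` is a lower semicontinuous tracial weight on `𝓢_ε`
    (∀ x : edgeAlg μ d,
      Summable fun α => inner C₀(Λ.vertexSet, ℂ) (vacuum α) ((x : FockOp Λ).1 (vacuum α))) ∧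
    IsLscTracialWeight (fun x : edgeAlg μ d => Tr μ x) ∧
    ((∀ x : edgeAlg μ d, IsPos x → Tr μ x < ∞) ↔ Summable μ) ∧
    -- a loop at `α`
    (∀ α : Λ.vertexSet, Λ.IsLink d.edge α α →
      ∃ φ : edgeAlg μ d ≃⋆ₐ[ℂ] C(unitInterval, ℂ) × C₀({v : Λ.vertexSet // v ≠ α}, ℂ),
        (∀ c, (φ (incl μ d c)).1 = ContinuousMap.const _ (c α) ∧
          ∀ v, (φ (incl μ d c)).2 v = c v) ∧
        Tr μ (incl μ d (vertexProj α)) = ENNReal.ofReal (μ α) ∧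
        ∀ x : edgeAlg μ d,
          incl μ d (vertexProj α) * x * incl μ d (vertexProj α) = x →
          HasTr μ x (μ α * ∫ t, (φ x).1 t) ∧
          (IsPos x → Tr μ x = ENNReal.ofReal (μ α * ∫ t, ((φ x).1 t).re))) ∧
    -- an edge between `α` and `β` with `μ α > μ β`
    (∀ α β : Λ.vertexSet, Λ.IsLink d.edge α β → α ≠ β → μ β < μ α →
      ∃ (φ : edgeAlg μ d ≃⋆ₐ[ℂ] C(unitInterval, Matrix (Fin 2) (Fin 2) ℂ) × ℂ ×
          C₀({v : Λ.vertexSet // v ≠ α ∧ v ≠ β}, ℂ)) (q r : edgeAlg μ d),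
        IsStarProjection q ∧ IsStarProjection r ∧
        incl μ d (vertexProj α) = q + r ∧
        φ (incl μ d (vertexProj β) + q) = (1, 0, 0) ∧
        φ r = (0, 1, 0) ∧
        (∀ c v, (φ (incl μ d c)).2.2 v = c v) ∧
        Tr μ (incl μ d (vertexProj β) + q : edgeAlg μ d) = ENNReal.ofReal (2 * μ β) ∧
        Tr μ r = ENNReal.ofReal (μ α - μ β) ∧
        ∀ x : edgeAlg μ d,
          (incl μ d (vertexProj β) + q) * x * (incl μ d (vertexProj β) + q) = x →
          HasTr μ x (μ β * ∫ t, ((φ x).1 t).trace) ∧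
          (IsPos x → Tr μ x = ENNReal.ofReal (μ β * ∫ t, ((φ x).1 t).trace.re))) ∧
    -- an edge between `α` and `β` with `μ α = μ β`
    (∀ α β : Λ.vertexSet, Λ.IsLink d.edge α β → α ≠ β → μ α = μ β →
      ∃ φ : edgeAlg μ d ≃⋆ₐ[ℂ] diagAtZero × C₀({v : Λ.vertexSet // v ≠ α ∧ v ≠ β}, ℂ),
        (∀ c, ((φ (incl μ d c)).1 : C(unitInterval, Matrix (Fin 2) (Fin 2) ℂ)) =
            ContinuousMap.const _ (Matrix.diagonal ![c α, c β]) ∧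
          ∀ v, (φ (incl μ d c)).2 v = c v) ∧
        Tr μ (incl μ d (vertexProj α) + incl μ d (vertexProj β) : edgeAlg μ d)
          = ENNReal.ofReal (2 * μ α) ∧
        ∀ x : edgeAlg μ d,
          (incl μ d (vertexProj α) + incl μ d (vertexProj β)) * x *
            (incl μ d (vertexProj α) + incl μ d (vertexProj β)) = x →
          HasTr μ x (μ α * ∫ t, ((φ x).1.1 t).trace) ∧
          (IsPos x → Tr μ x = ENNReal.ofReal (μ α * ∫ t, ((φ x).1.1 t).trace.re))) := by
  refine (exists_tracialData hμ d).elim fun s htd => ?_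
  refine ⟨htd.summable_inner, htd.isLscTracialWeight hμ, htd.Tr_lt_top_iff hμ,
    fun α h => ?_, fun α β h hne hlt => ?_, fun α β h hne heq => ?_⟩
  -- The endpoints of an edge are unique as an unordered pair, so both ends of `d` are `α`.
  · have hd : d.src = α ∧ d.tgt = α := by
      rcases d.isLink.eq_and_eq_or_eq_and_eq h with h | h <;>
        exact ⟨Subtype.ext h.1, Subtype.ext h.2⟩
    have h1 := hd.1
    subst h1
    exact loop_case hμ hd.2.symm
  · refine (exists_oriented hμ h hne).elim fun e H => ?_
    have h1 := H.1
    have h2 := H.2.1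
    subst h1 h2
    exact split_case hμ hne (one_lt_ratio hμ hlt) H.2.2
  · refine (exists_oriented hμ h hne).elim fun e H => ?_
    have h1 := H.1
    have h2 := H.2.1
    subst h1 h2
    -- Equal weights make the ratio one, so the gap of the spectrum closes.
    exact glued_case hμ hne heq (ratio_eq_one hμ heq ▸ H.2.2)
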